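/- For $n\ge 1$ let $\iota_n$ denote the identity map of $S^n$, and let $[\iota_n,\iota_n]\colon S^{2n-1}\to S^n$ be its Whitehead square. The homotopy cofibre of the diagonal map $\Delta\colon S^n\to S^n\times S^n$ is homotopy equivalent to $S^n\cup_{[\iota_n,\iota_n]}e^{2n}$. Moreover, the weak topological complexity of $S^n$ is $$\mathrm{wTC}(S^n)=\begin{cases}1,& n \text{ odd},\\ 2,& n\text{ even}.\end{cases}$$ Here $\mathrm{wTC}(X)=\mathrm{wsecat}(\pi_X)$, where $\pi_X\colon X^{[0,1]}\to X\times X$, $\pi_X(\gamma)=(\gamma(0),\gamma(1))$. For a map $p\colon E\to B$ define maps $\kappa_m\colon T^m(p)\to B^{m+1}$ inductively: $\kappa_0=p$, and $\kappa_m$ is the join of $\kappa_{m-1}\times \mathrm{id}_B$ and $\mathrm{id}_{B^m}\times p$. The join of two maps $A\to C\leftarrow D$ is the canonical map to $C$ from the homotopy pushout (double mapping cylinder) of the two projections of their homotopy pullback. Then $\mathrm{wsecat}(p)$ is the least integer $m\ge 0$ (or $\infty$) such that the composite $B\to B^{m+1}\to C_{\kappa_m}$ of the diagonal with the natural map to the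 homotopy cofibre of $\kappa_m$ is null-homotopic. -/

import Mathlib

open scoped unitInterval

namespace WeakTC

universe u

/-! ### Homotopy pushouts, homotopy cofibres, homotopy pullbacks and joins -/

section Pushout

variable {L A B Z : Type u} [TopologicalSpace L] [TopologicalSpace A] [TopologicalSpace B]
  [TopologicalSpace Z]

/-- The gluing relation of the double mapping cylinder of `A ← L → B`:
`(l, 0)` is glued to `a l` and `(l, 1)` to `b l`. -/
inductive CylRel (a : C(L, A)) (b : C(L, B)) : A ⊕ ((L × I) ⊕ B) → A ⊕ ((L × I) ⊕ B) → Prop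
  | left (l : L) : CylRel a b (Sum.inr (Sum.inl (l, 0))) (Sum.inl (a l))
  | right (l : L) : CylRel a b (Sum.inr (Sum.inl (l, 1))) (Sum.inr (Sum.inr (b l)))

/-- The standard homotopy pushout (double mapping cylinder) `A ⨿ L × [0,1] ⨿ B / ∼`
of `A ← L → B`, with the quotient topology. -/
def HomotopyPushout (a : C(L, A)) (b : C(L, B)) : Type u := Quot (CylRel a b)

instance (a : C(L, A)) (b : C(L, B)) : TopologicalSpace (HomotopyPushout a b) :=
  inferInstanceAs (TopologicalSpace (Quot (CylRel a b)))

/-- The canonical map from `A` to the homotopy pushout of `A ← L → B`. -/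
def HomotopyPushout.inl (a : C(L, A)) (b : C(L, B)) : C(A, HomotopyPushout a b) where
  toFun x := Quot.mk _ (Sum.inl x)
  continuous_toFun := continuous_quot_mk.comp continuous_inl

/-- The homotopy cofibre (mapping cone) `C_f = A ∪_f C L` of `f : L → A`: the homotopy pushout of
`A ← L → *`. -/
abbrev HomotopyCofibre (f : C(L, A)) : Type u :=
  HomotopyPushout f (ContinuousMap.const L PUnit.unit.{u + 1})

/-- The induced map `A → C_f` of `A` to the homotopy cofibre of `f : L → A`. -/
abbrev HomotopyCofibre.incl (f : C(L, A)) : C(A, HomotopyCofibre f) :=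
  HomotopyPushout.inl f (ContinuousMap.const L PUnit.unit.{u + 1})

/-- The standard homotopy pullback of `f : A → Z` and `g : B → Z`: triples `(a, γ, b)` with `γ` a
path in `Z` from `f a` to `g b` (paths carry the compact-open topology). -/
def HomotopyPullback (f : C(A, Z)) (g : C(B, Z)) : Type u :=
  {x : A × C(I, Z) × B // x.2.1 0 = f x.1 ∧ x.2.1 1 = g x.2.2}

instance (f : C(A, Z)) (g : C(B, Z)) : TopologicalSpace (HomotopyPullback f g) :=
  inferInstanceAs (TopologicalSpace
    {x : A × C(I, Z) × B // x.2.1 0 = f x.1 ∧ x.2.1 1 = g x.2.2})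

/-- The projection of the homotopy pullback to `A`. -/
def HomotopyPullback.fst (f : C(A, Z)) (g : C(B, Z)) : C(HomotopyPullback f g, A) where
  toFun x := x.1.1
  continuous_toFun := continuous_fst.comp continuous_subtype_val

/-- The projection of the homotopy pullback to `B`. -/
def HomotopyPullback.snd (f : C(A, Z)) (g : C(B, Z)) : C(HomotopyPullback f g, B) where
  toFun x := x.1.2.2
  continuous_toFun := (continuous_snd.comp continuous_snd).comp continuous_subtype_val

/-- The join `A *_Z B` of `f : A → Z` and `g : B → Z`: the homotopy pushout of the two projections
of the homotopy pullback of `f` and `g`. -/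
abbrev Join (f : C(A, Z)) (g : C(B, Z)) : Type u :=
  HomotopyPushout (HomotopyPullback.fst f g) (HomotopyPullback.snd f g)

/-- The join map (co-whisker map) `A *_Z B → Z`: it is `f` on `A`, it is `g` on `B`, and it sends
the point of the cylinder with coordinates `(a, γ, b)` and `t` to `γ t`. -/
def joinMap (f : C(A, Z)) (g : C(B, Z)) : C(Join f g, Z) where
  toFun := Quot.lift
    (Sum.elim f (Sum.elim (fun x : HomotopyPullback f g × I => x.1.1.2.1 x.2) g)) (by
      rintro _ _ (l | l)
      · exact l.2.1
      · exact l.2.2)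
  continuous_toFun := by
    refine continuous_quot_lift _ ?_
    refine Continuous.sumElim f.continuous (Continuous.sumElim ?_ g.continuous)
    have h : Continuous fun x : HomotopyPullback f g × I => x.1.1.2.1 :=
      (continuous_fst.comp continuous_snd).comp (continuous_subtype_val.comp continuous_fst)
    exact h.eval continuous_snd

end Pushout

/-! ### Weak sectional category and weak topological complexity -/

/-- A space over `Z`: a space together with a continuous map to `Z`. -/
structure SpaceOver (Z : Type u) [TopologicalSpace Z] where
  Dom : Type u
  [top : TopologicalSpace Dom]
  map : C(Dom, Z)

attribute [instance] SpaceOver.top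

section Wsecat

variable {E B : Type u} [TopologicalSpace E] [TopologicalSpace B]

/-- For `κ : T → B^n`, the map `κ × id : T × B → B^n × B = B^(n+1)`. -/
def prodId {T : Type u} [TopologicalSpace T] {n : ℕ} (κ : C(T, Fin n → B)) :
    C(T × B, Fin (n + 1) → B) where
  toFun x := Fin.snoc (α := fun _ => B) (κ x.1) x.2
  continuous_toFun :=
    Continuous.finSnoc (A := fun _ => B) (κ.continuous.comp continuous_fst) continuous_snd

/-- For `p : E → B`, the map `id × p : B^n × E → B^n × B = B^(n+1)`. -/
def idProd (p : C(E, B)) (n : ℕ) : C((Fin n → B) × E, Fin (n + 1) → B) where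
  toFun x := Fin.snoc (α := fun _ => B) x.1 (p x.2)
  continuous_toFun :=
    Continuous.finSnoc (A := fun _ => B) continuous_fst (p.continuous.comp continuous_snd)

/-- The diagonal `Δ_n : B → B^n`. -/
def diagPow (B : Type u) [TopologicalSpace B] (n : ℕ) : C(B, Fin n → B) where
  toFun b := fun _ => b
  continuous_toFun := continuous_pi fun _ => continuous_id

/-- The `n`-sectional fat wedge `κ_n : T^n(p) → B^(n+1)` of `p : E → B`: `κ_0` is
`p : E → B = B^1`, and `κ_(n+1)` is the join map of `κ_n × id_B` and `id × p`. -/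
def fatWedge (p : C(E, B)) : (n : ℕ) → SpaceOver (Fin (n + 1) → B)
  | 0 => ⟨E, (diagPow B 1).comp p⟩
  | n + 1 =>
    ⟨Join (prodId (fatWedge p n).map) (idProd p (n + 1)),
      joinMap (prodId (fatWedge p n).map) (idProd p (n + 1))⟩

/-- The weak sectional category of `p : E → B`: the least `n` (or `∞`) such that the composite
`B → B^(n+1) → C_(κ_n)` of the diagonal with the map to the homotopy cofibre of `κ_n` is
homotopically trivial. -/
noncomputable def wsecat (p : C(E, B)) : ℕ∞ :=
  sInf {m : ℕ∞ | ∃ n : ℕ, m = n ∧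
    ((HomotopyCofibre.incl (fatWedge p n).map).comp (diagPow B (n + 1))).Nullhomotopic}

end Wsecat

/-- The evaluation fibration `π_X : X^I → X × X`, `π_X γ = (γ 0, γ 1)`. -/
def pathFibration (X : Type u) [TopologicalSpace X] : C(C(I, X), X × X) where
  toFun γ := (γ 0, γ 1)
  continuous_toFun := (continuous_eval_const (0 : I)).prodMk (continuous_eval_const (1 : I))

/-- The weak topological complexity of `X`. -/
noncomputable def wTC (X : Type u) [TopologicalSpace X] : ℕ∞ := wsecat (pathFibration X)

/-! ### Spheres, cell attachments and Whitehead products -/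

/-- The standard sphere `S^n`, the unit sphere of `ℝ^(n+1)`. -/
abbrev Sph (n : ℕ) : Type := Metric.sphere (0 : EuclideanSpace ℝ (Fin (n + 1))) 1

/-- The standard closed ball `D^m`. -/
abbrev Ball (m : ℕ) : Type := Metric.closedBall (0 : EuclideanSpace ℝ (Fin m)) 1

/-- The boundary sphere `S^(m-1)` of the ball `D^m` (empty for `m = 0`). -/
abbrev BallBdry (m : ℕ) : Type := Metric.sphere (0 : EuclideanSpace ℝ (Fin m)) 1

/-- The diagonal map `X → X × X`. -/
def diagonal (X : Type u) [TopologicalSpace X] : C(X, X × X) :=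
  (ContinuousMap.id X).prodMk (ContinuousMap.id X)

/-- The gluing relation `v ∼ φ v` for `v` in the boundary of `D^m`. -/
inductive CellRel {X : Type} [TopologicalSpace X] {m : ℕ} (φ : C(BallBdry m, X)) :
    X ⊕ Ball m → X ⊕ Ball m → Prop
  | glue (v : BallBdry m) :
    CellRel φ (Sum.inr ⟨v.1, Metric.sphere_subset_closedBall v.2⟩) (Sum.inl (φ v))

/-- The space `X ∪_φ e^m` obtained by attaching an `m`-cell to `X` along `φ : S^(m-1) → X`. -/
def AttachCell {X : Type} [TopologicalSpace X] {m : ℕ} (φ : C(BallBdry m, X)) : Type :=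
  Quot (CellRel φ)

instance {X : Type} [TopologicalSpace X] {m : ℕ} (φ : C(BallBdry m, X)) :
    TopologicalSpace (AttachCell φ) :=
  inferInstanceAs (TopologicalSpace (Quot (CellRel φ)))

lemma norm_sq_snoc {p : ℕ} (v : Fin p → ℝ) (c : ℝ) :
    ‖(WithLp.toLp 2 (Fin.snoc (α := fun _ => ℝ) v c) : EuclideanSpace ℝ (Fin (p + 1)))‖ ^ 2
      = (∑ i, v i ^ 2) + c ^ 2 := by
  rw [EuclideanSpace.real_norm_sq_eq, Fin.sum_univ_castSucc]
  simp

/-- The base point `(0, …, 0, 1)` of `S^n`. -/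
noncomputable def basePt (n : ℕ) : Sph n :=
  ⟨WithLp.toLp 2 (Fin.snoc (α := fun _ => ℝ) (fun _ => 0) 1), by
    rw [mem_sphere_zero_iff_norm, ← sq_eq_sq₀ (norm_nonneg _) zero_le_one, norm_sq_snoc]
    simp⟩

/-- The standard relative homeomorphism `(D^p, S^(p-1)) → (S^p, *)`, which collapses the boundary
of the ball to the base point: `x ↦ (2 √(1 - |x|²) x, 2 |x|² - 1)`. -/
noncomputable def collapse (p : ℕ) : C(Ball p, Sph p) where
  toFun x :=
    ⟨WithLp.toLp 2 (Fin.snoc (α := fun _ => ℝ)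
        (fun i => 2 * √(1 - ‖x.1‖ ^ 2) * x.1 i) (2 * ‖x.1‖ ^ 2 - 1)), by
      have hx : ‖x.1‖ ≤ 1 := mem_closedBall_zero_iff.1 x.2
      have h0 : 0 ≤ 1 - ‖x.1‖ ^ 2 := by nlinarith [norm_nonneg x.1]
      rw [mem_sphere_zero_iff_norm, ← sq_eq_sq₀ (norm_nonneg _) zero_le_one, norm_sq_snoc]
      simp only [mul_pow, Real.sq_sqrt h0]
      rw [← Finset.mul_sum, ← EuclideanSpace.real_norm_sq_eq]
      ring⟩
  continuous_toFun := by
    refine Continuous.subtype_mk ?_ _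
    refine (PiLp.continuous_toLp 2 _).comp ?_
    refine Continuous.finSnoc (A := fun _ => ℝ) ?_ ?_ <;> fun_prop

lemma collapse_bdry {p : ℕ} (x : Ball p) (hx : ‖x.1‖ = 1) : collapse p x = basePt p := by
  apply Subtype.ext
  simp only [collapse, basePt, ContinuousMap.coe_mk, hx]
  norm_num

/-- The boundary of `D^p × D^q`. Products carry the maximum norm, so it is the unit sphere of
`ℝ^p × ℝ^q`. -/
abbrev BoxBdry (p q : ℕ) : Type :=
  Metric.sphere (0 : EuclideanSpace ℝ (Fin p) × EuclideanSpace ℝ (Fin q)) 1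

lemma BoxBdry.max_eq {p q : ℕ} (z : BoxBdry p q) : max ‖z.1.1‖ ‖z.1.2‖ = 1 :=
  mem_sphere_zero_iff_norm.1 z.2

/-- The first coordinate of a point of `∂(D^p × D^q)`. -/
def BoxBdry.fst {p q : ℕ} (z : BoxBdry p q) : Ball p :=
  ⟨z.1.1, mem_closedBall_zero_iff.2 ((le_max_left _ _).trans z.max_eq.le)⟩

/-- The second coordinate of a point of `∂(D^p × D^q)`. -/
def BoxBdry.snd {p q : ℕ} (z : BoxBdry p q) : Ball q :=
  ⟨z.1.2, mem_closedBall_zero_iff.2 ((le_max_right _ _).trans z.max_eq.le)⟩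

/-- The identification of the boundary `S^(p+q-1)` of `D^(p+q)` with the boundary of `D^p × D^q`:
the radial projection `(x, y) ↦ (x, y) / max |x| |y|`. -/
noncomputable def toBoxBdry (p q : ℕ) : C(BallBdry (p + q), BoxBdry p q) :=
  let split : EuclideanSpace ℝ (Fin (p + q)) →
      EuclideanSpace ℝ (Fin p) × EuclideanSpace ℝ (Fin q) := fun v =>
    (WithLp.toLp 2 fun i => v (Fin.castAdd q i), WithLp.toLp 2 fun j => v (Fin.natAdd p j))
  have hc : Continuous split := by
    refine Continuous.prodMk ?_ ?_
    · exact (PiLp.continuous_toLp 2 _).comp (by fun_prop)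
    · exact (PiLp.continuous_toLp 2 _).comp (by fun_prop)
  have h0 : ∀ v : BallBdry (p + q), ‖split v.1‖ ≠ 0 := by
    intro v h
    have h1 : split v.1 = 0 := norm_eq_zero.1 h
    have h2 : v.1 = 0 := by
      ext i
      refine Fin.addCases (fun i => ?_) (fun j => ?_) i
      · exact congrArg (fun w : EuclideanSpace ℝ (Fin p) => w i) (congrArg Prod.fst h1)
      · exact congrArg (fun w : EuclideanSpace ℝ (Fin q) => w j) (congrArg Prod.snd h1)
    have h3 : ‖v.1‖ = 1 := mem_sphere_zero_iff_norm.1 v.2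
    rw [h2, norm_zero] at h3
    exact zero_ne_one h3
  { toFun := fun v => ⟨‖split v.1‖⁻¹ • split v.1, by
      rw [mem_sphere_zero_iff_norm, norm_smul, norm_inv, norm_norm, inv_mul_cancel₀ (h0 v)]⟩
    continuous_toFun := by
      have hs : Continuous fun v : BallBdry (p + q) => split v.1 :=
        hc.comp continuous_subtype_val
      exact ((hs.norm.inv₀ h0).smul hs).subtype_mk _ }

/-- The map `∂(D^p × D^q) = D^p × S^(q-1) ∪ S^(p-1) × D^q → S^p ∨ S^q → X` induced by
`f : S^p → X` and `g : S^q → X` with the same value at the base points. It is `f` applied to the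
collapsed first coordinate on `D^p × S^(q-1)` (the part with `|x| ≤ |y|`), and `g` applied to the
collapsed second coordinate on `S^(p-1) × D^q`. -/
noncomputable def boxMap {X : Type} [TopologicalSpace X] {p q : ℕ} (f : C(Sph p, X))
    (g : C(Sph q, X)) (h : f (basePt p) = g (basePt q)) : C(BoxBdry p q, X) where
  toFun z := if ‖z.1.1‖ ≤ ‖z.1.2‖ then f (collapse p z.fst) else g (collapse q z.snd)
  continuous_toFun := by
    refine Continuous.if_le ?_ ?_ ?_ ?_ ?_
    · refine f.continuous.comp ((collapse p).continuous.comp ?_)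
      exact Continuous.subtype_mk (continuous_fst.comp continuous_subtype_val) _
    · refine g.continuous.comp ((collapse q).continuous.comp ?_)
      exact Continuous.subtype_mk (continuous_snd.comp continuous_subtype_val) _
    · exact (continuous_fst.comp continuous_subtype_val).norm
    · exact (continuous_snd.comp continuous_subtype_val).norm
    · intro z hz
      have hm := z.max_eq
      rw [hz, max_self] at hm
      rw [collapse_bdry z.fst (hz.trans hm), collapse_bdry z.snd hm, h]

/-- The Whitehead product `[f, g] : S^(p+q-1) → X` of `f : S^p → X` and `g : S^q → X`. -/
noncomputable def whitehead {X : Type} [TopologicalSpace X] {p q : ℕ} (f : C(Sph p, X))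
    (g : C(Sph q, X)) (h : f (basePt p) = g (basePt q)) : C(BallBdry (p + q), X) :=
  (boxMap f g h).comp (toBoxBdry p q)

/-- The Whitehead square `[ι_n, ι_n] : S^(2n-1) → S^n` of the identity of `S^n`. -/
noncomputable def whiteheadSquare (n : ℕ) : C(BallBdry (n + n), Sph n) :=
  whitehead (ContinuousMap.id (Sph n)) (ContinuousMap.id (Sph n)) rfl

end WeakTC

/-! The cofibre. Nearby points of a sphere can be merged along normalised chords, so the diagonal
has the homotopy extension property and its cofibre is the quotient of `S^n × S^n` by the diagonal.
The reflection with normal `mirror n a` takes the base point to `collapse n a` and depends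
continuously on `a`. Hence `diagCell`, which reflects the second collapsed coordinate in this way,
is the characteristic map of a 2n-cell: the boundary part `|b| = 1` lands in the diagonal and the
part `|a| = 1` in the fibre over the base point. Once the diagonal is a point, what remains is `S^n`
with one 2n-cell attached by `diagAttach`. Turning the mirrors (`boxHomotopy`) deforms this map into
the Whitehead square, and homotopic maps have equivalent cofibres.

Upper bounds. If the diagonal lifts to `κ_m`, its composite into the cofibre is null-homotopic. Such
a lift is assembled from continuous motion planners on `m + 1` open sets covering `S^n × S^n`, with
join coordinates given by a partition of unity (`exists_lift_fatWedge_succ`). Two sets suffice for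
odd `n`, where `ℝ^(n+1)` has a complex structure; three always suffice for `n ≥ 1`.

Lower bounds. For `m = 0, 1`, a map on `(X × X)^(m+1)` which is constant as soon as one of the pairs
lies on the diagonal of `X` extends over the cofibre of `κ_m`. If the composite defining `wsecat` is
null-homotopic, so is the restriction of that map to the diagonal of `(X × X)^(m+1)`. It is thus
enough to exhibit one such map with essential restriction. The maps used have values in a loop space
(`m = 0`) or a double loop space (`m = 1`) of the complement of the origin in `W × ℝ`, a homotopy
sphere. For `m = 1` and `n` even, the restriction is governed by the zeros of a map that correspond
to the two fixed points of an isometry of `S^n`; they count with equal sign, reflecting the Euler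
characteristic 2.

Essentiality is a degree argument with differential forms (`degree_principle_pi`): pull back a bump
form supported near the origin along a smooth approximation of the homotopy and apply Stokes'
theorem in space-time. -/

namespace WeakTC

universe u v

open Topology

/-! ### Maps and homotopies out of homotopy pushouts -/

section Pushout

variable {L A B : Type u} {Z : Type v} [TopologicalSpace L] [TopologicalSpace A]
  [TopologicalSpace B] [TopologicalSpace Z]

/-- The point of the homotopy pushout with cylinder coordinates `(l, t)`. -/
def HomotopyPushout.cyl (a : C(L, A)) (b : C(L, B)) : C(L × I, HomotopyPushout a b) where
  toFun x := Quot.mk _ (Sum.inr (Sum.inl x))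
  continuous_toFun := continuous_quot_mk.comp (continuous_inr.comp continuous_inl)

/-- The canonical map from `B` to the homotopy pushout of `A ← L → B`. -/
def HomotopyPushout.inr (a : C(L, A)) (b : C(L, B)) : C(B, HomotopyPushout a b) where
  toFun x := Quot.mk _ (Sum.inr (Sum.inr x))
  continuous_toFun := continuous_quot_mk.comp (continuous_inr.comp continuous_inr)

lemma HomotopyPushout.cyl_zero (a : C(L, A)) (b : C(L, B)) (l : L) :
    HomotopyPushout.cyl a b (l, 0) = HomotopyPushout.inl a b (a l) :=
  Quot.sound (CylRel.left l)

lemma HomotopyPushout.cyl_one (a : C(L, A)) (b : C(L, B)) (l : L) :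
    HomotopyPushout.cyl a b (l, 1) = HomotopyPushout.inr a b (b l) :=
  Quot.sound (CylRel.right l)

lemma HomotopyPushout.ind {a : C(L, A)} {b : C(L, B)} {P : HomotopyPushout a b → Prop}
    (hl : ∀ x, P (HomotopyPushout.inl a b x)) (hc : ∀ l t, P (HomotopyPushout.cyl a b (l, t)))
    (hr : ∀ x, P (HomotopyPushout.inr a b x)) (x : HomotopyPushout a b) : P x := by
  induction x using Quot.ind with
  | mk x =>
    rcases x with x | ⟨l, t⟩ | x
    exacts [hl x, hc l t, hr x]

/-- The map out of a homotopy pushout given by compatible maps on its three parts. -/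
def HomotopyPushout.desc (a : C(L, A)) (b : C(L, B)) (f : C(A, Z)) (c : C(L × I, Z)) (g : C(B, Z))
    (h0 : ∀ l, c (l, 0) = f (a l)) (h1 : ∀ l, c (l, 1) = g (b l)) :
    C(HomotopyPushout a b, Z) where
  toFun := Quot.lift (Sum.elim f (Sum.elim c g)) (by
    rintro _ _ (l | l)
    exacts [h0 l, h1 l])
  continuous_toFun := continuous_quot_lift _
    (Continuous.sumElim f.continuous (Continuous.sumElim c.continuous g.continuous))

/-- Treating a homotopy as a map into the path space lets it be defined on a quotient by the
universal property, without asking whether the product of the quotient with `I` is again a quotient.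
-/
lemma curry_homotopic {X : Type*} [TopologicalSpace X] {F G : C(X, Z)} (h : C(X, C(I, Z)))
    (h0 : ∀ x, h x 0 = F x) (h1 : ∀ x, h x 1 = G x) : F.Homotopic G :=
  ⟨{ toFun := fun p => h p.2 p.1
     continuous_toFun := (h.continuous.comp continuous_snd).eval continuous_fst
     map_zero_left := h0
     map_one_left := h1 }⟩

/-- A homotopy between maps out of a homotopy pushout may be given on its three parts. -/
lemma HomotopyPushout.homotopic {a : C(L, A)} {b : C(L, B)} {F G : C(HomotopyPushout a b, Z)}
    (f : C(A × I, Z)) (c : C((L × I) × I, Z)) (g : C(B × I, Z))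
    (h0 : ∀ l t, c ((l, 0), t) = f (a l, t)) (h1 : ∀ l t, c ((l, 1), t) = g (b l, t))
    (hF : ∀ x, f (x, 0) = F (inl a b x)) (hF' : ∀ x, c (x, 0) = F (cyl a b x))
    (hF'' : ∀ x, g (x, 0) = F (inr a b x)) (hG : ∀ x, f (x, 1) = G (inl a b x))
    (hG' : ∀ x, c (x, 1) = G (cyl a b x)) (hG'' : ∀ x, g (x, 1) = G (inr a b x)) :
    F.Homotopic G := by
  refine curry_homotopic (desc a b f.curry c.curry g.curry (fun l => ?_) (fun l => ?_))
    (fun x => ?_) (fun x => ?_)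
  · ext t; exact h0 l t
  · ext t; exact h1 l t
  · induction x using HomotopyPushout.ind with
    | hl x => exact hF x
    | hc l t => exact hF' (l, t)
    | hr x => exact hF'' x
  · induction x using HomotopyPushout.ind with
    | hl x => exact hG x
    | hc l t => exact hG' (l, t)
    | hr x => exact hG'' x

end Pushout

/-! ### Comparison of quotients -/

section Quotients

variable {S T : Type*} [TopologicalSpace S] [TopologicalSpace T]

/-- A quotient of `S` is homeomorphic to a quotient of a quotient `T` of `S` if the two relations
correspond to each other. -/
lemma nonempty_homeomorph_quot {p : S → T} (hp : IsQuotientMap p) (r : S → S → Prop)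
    (R : T → T → Prop) (h1 : ∀ s s', r s s' → Quot.mk R (p s) = Quot.mk R (p s'))
    (h2 : ∀ s s', p s = p s' → Quot.mk r s = Quot.mk r s')
    (h3 : ∀ s s', R (p s) (p s') → Quot.mk r s = Quot.mk r s') :
    Nonempty (Quot r ≃ₜ Quot R) := by
  let q : C(S, T) := ⟨p, hp.continuous⟩
  have hq : IsQuotientMap q := hp
  let m : C(S, Quot r) := ⟨Quot.mk r, continuous_quot_mk⟩
  have hm : Function.FactorsThrough m q := fun s s' h => h2 s s' h
  let k : C(T, Quot r) := hq.lift m hm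
  have hk : ∀ s, k (p s) = Quot.mk r s := fun s => congrArg (fun f : C(S, Quot r) => f s)
    (hq.lift_comp m hm)
  have hR : ∀ t t', R t t' → k t = k t' := by
    intro t t' h
    obtain ⟨s, rfl⟩ := hp.surjective t
    obtain ⟨s', rfl⟩ := hp.surjective t'
    rw [hk, hk]
    exact h3 s s' h
  exact ⟨{ toFun := Quot.lift (fun s => Quot.mk R (p s)) h1
           invFun := Quot.lift k hR
           left_inv := by
            rintro ⟨s⟩
            exact hk s
           right_inv := by
            rintro ⟨t⟩
            obtain ⟨s, rfl⟩ := hp.surjective t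
            change Quot.lift _ h1 (k (p s)) = _
            rw [hk]
           continuous_toFun := continuous_quot_lift _ (continuous_quot_mk.comp hp.continuous)
           continuous_invFun := continuous_quot_lift _ k.continuous }⟩

end Quotients

/-! ### Homotopy cofibres -/

section Cofibre

variable {L A : Type u} [TopologicalSpace L] [TopologicalSpace A]

/-- The cone point of a homotopy cofibre. -/
abbrev HomotopyCofibre.apex (f : C(L, A)) : HomotopyCofibre f :=
  HomotopyPushout.inr f (ContinuousMap.const L PUnit.unit.{u + 1}) PUnit.unit

/-- The point of a homotopy cofibre with cone coordinates `(l, t)`. -/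
abbrev HomotopyCofibre.cone (f : C(L, A)) : C(L × I, HomotopyCofibre f) :=
  HomotopyPushout.cyl f (ContinuousMap.const L PUnit.unit.{u + 1})

lemma HomotopyCofibre.cone_zero (f : C(L, A)) (l : L) :
    HomotopyCofibre.cone f (l, 0) = HomotopyCofibre.incl f (f l) :=
  HomotopyPushout.cyl_zero f _ l

lemma HomotopyCofibre.cone_one (f : C(L, A)) (l : L) :
    HomotopyCofibre.cone f (l, 1) = HomotopyCofibre.apex f :=
  HomotopyPushout.cyl_one f _ l

/-- The composite of a map with the inclusion in its homotopy cofibre is nullhomotopic. -/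
lemma HomotopyCofibre.incl_comp_nullhomotopic (f : C(L, A)) :
    ((HomotopyCofibre.incl f).comp f).Nullhomotopic := by
  refine ⟨HomotopyCofibre.apex f, curry_homotopic (HomotopyCofibre.cone f).curry
    (fun l => HomotopyCofibre.cone_zero f l) (fun l => HomotopyCofibre.cone_one f l)⟩

/-- The relation on `A` which identifies the image of `i : L → A` to one point. -/
def CollapseRel (i : C(L, A)) (x y : A) : Prop := ∃ l l', x = i l ∧ y = i l'

/-- If the inclusion `A → C_i` extends to a homotopy which slides the image of `i` up the cone,
then the homotopy cofibre of `i` is homotopy equivalent to the quotient of `A` by the image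
of `i`. -/
lemma HomotopyCofibre.nonempty_homotopyEquiv_quot [Nonempty L] (i : C(L, A)) (k : C(I, I))
    (hk0 : k 0 = 0) (hk1 : k 1 = 1) (H : C(A × I, HomotopyCofibre i))
    (H0 : ∀ x, H (x, 0) = HomotopyCofibre.incl i x)
    (H1 : ∀ l t, H (i l, t) = HomotopyCofibre.cone i (l, k t)) :
    Nonempty (ContinuousMap.HomotopyEquiv (HomotopyCofibre i) (Quot (CollapseRel i))) := by
  classical
  obtain ⟨l0⟩ := ‹Nonempty L›
  let mk : C(A, Quot (CollapseRel i)) := ⟨Quot.mk _, continuous_quot_mk⟩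
  have hmk : ∀ l l', mk (i l) = mk (i l') := fun l l' => Quot.sound ⟨l, l', rfl, rfl⟩
  let F : C(HomotopyCofibre i, Quot (CollapseRel i)) :=
    HomotopyPushout.desc _ _ mk (mk.comp (i.comp ContinuousMap.fst))
      (ContinuousMap.const _ (mk (i l0))) (fun l => rfl) (fun l => hmk l l0)
  have hH1 : ∀ l, H (i l, 1) = HomotopyCofibre.apex i := fun l => by
    rw [H1, hk1, HomotopyCofibre.cone_one]
  let G : C(Quot (CollapseRel i), HomotopyCofibre i) :=
    ⟨Quot.lift (fun x => H (x, 1)) (by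
      rintro _ _ ⟨l, l', rfl, rfl⟩
      rw [hH1, hH1]), continuous_quot_lift _ (by fun_prop)⟩
  refine ⟨⟨F, G, ?_, ?_⟩⟩
  · refine ContinuousMap.Homotopic.symm ?_
    -- On the cone the homotopy only raises the height to at least `k s`. At height 0 this is what
    -- `H` does on the image of `i`, and at the final time everything is at the apex.
    let c : C((L × I) × I, HomotopyCofibre i) :=
      (HomotopyCofibre.cone i).comp
        ⟨fun x => (x.1.1, max x.1.2 (k x.2)), by fun_prop⟩
    refine HomotopyPushout.homotopic H c (ContinuousMap.const _ (HomotopyCofibre.apex i))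
      ?_ ?_ ?_ ?_ ?_ ?_ ?_ ?_
    · intro l t
      rw [H1]
      change HomotopyCofibre.cone i (l, max 0 (k t)) = _
      rw [max_eq_right (show (0 : I) ≤ k t from (k t).2.1)]
    · intro l t
      change HomotopyCofibre.cone i (l, max 1 (k t)) = _
      rw [max_eq_left (show k t ≤ 1 from (k t).2.2), HomotopyCofibre.cone_one]
      rfl
    · exact H0
    · rintro ⟨l, t⟩
      change HomotopyCofibre.cone i (l, max t (k 0)) = _
      rw [hk0, max_eq_left (show (0 : I) ≤ t from t.2.1)]
      rfl
    · intro x; rfl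
    · intro x; rfl
    · rintro ⟨l, t⟩
      change HomotopyCofibre.cone i (l, max t (k 1)) = H (i l, 1)
      rw [hk1, max_eq_right (show t ≤ 1 from t.2.2), hH1, HomotopyCofibre.cone_one]
    · intro x
      exact (hH1 l0).symm
  · refine ContinuousMap.Homotopic.symm ?_
    refine curry_homotopic ⟨Quot.lift (F.comp H).curry ?_, continuous_quot_lift _ (by fun_prop)⟩
      ?_ ?_
    · rintro _ _ ⟨l, l', rfl, rfl⟩
      ext t
      change F (H (i l, t)) = F (H (i l', t))
      rw [H1, H1]
      exact hmk l l'
    · rintro ⟨x⟩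
      change F (H (x, 0)) = mk x
      rw [H0]
      rfl
    · rintro ⟨x⟩
      rfl

/-- The map of cofibres induced by a homotopy between two maps. -/
noncomputable def HomotopyCofibre.ofHomotopy {f g : C(L, A)} (K : f.Homotopy g) :
    C(HomotopyCofibre f, HomotopyCofibre g) :=
  HomotopyPushout.desc _ _ (HomotopyCofibre.incl g)
    ⟨fun x => if (x.2 : ℝ) ≤ 1 / 2 then
        HomotopyCofibre.incl g (K (Set.projIcc 0 1 zero_le_one (2 * x.2 : ℝ), x.1))
      else HomotopyCofibre.cone g (x.1, Set.projIcc 0 1 zero_le_one (2 * x.2 - 1 : ℝ)), by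
      refine Continuous.if_le ?_ ?_ (by fun_prop) continuous_const ?_
      · exact (HomotopyCofibre.incl g).continuous.comp (K.continuous.comp
          ((continuous_projIcc.comp (by fun_prop)).prodMk continuous_fst))
      · exact (HomotopyCofibre.cone g).continuous.comp
          (continuous_fst.prodMk (continuous_projIcc.comp (by fun_prop)))
      · intro x hx
        rw [hx, Set.projIcc_of_right_le _ (by norm_num), Set.projIcc_of_le_left _ (by norm_num)]
        change HomotopyCofibre.incl g (K (1, x.1)) = HomotopyCofibre.cone g (x.1, 0)
        rw [HomotopyCofibre.cone_zero, K.apply_one]⟩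
    (ContinuousMap.const _ (HomotopyCofibre.apex g))
    (fun l => by
      have h : ((0 : I) : ℝ) ≤ 1 / 2 := by norm_num
      simp only [ContinuousMap.coe_mk, h, if_true]
      rw [Set.projIcc_of_le_left _ (by norm_num)]
      change HomotopyCofibre.incl g (K (0, l)) = _
      rw [K.apply_zero])
    (fun l => by
      have h : ¬ ((1 : I) : ℝ) ≤ 1 / 2 := by norm_num
      simp only [ContinuousMap.coe_mk, h, if_false]
      rw [Set.projIcc_of_right_le _ (by norm_num)]
      exact HomotopyCofibre.cone_one g l)

lemma HomotopyCofibre.ofHomotopy_cone {f g : C(L, A)} (K : f.Homotopy g) (l : L) (t : I) :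
    HomotopyCofibre.ofHomotopy K (HomotopyCofibre.cone f (l, t)) =
      if (t : ℝ) ≤ 1 / 2 then
        HomotopyCofibre.incl g (K (Set.projIcc 0 1 zero_le_one (2 * t : ℝ), l))
      else HomotopyCofibre.cone g (l, Set.projIcc 0 1 zero_le_one (2 * t - 1 : ℝ)) := rfl

lemma HomotopyCofibre.ofHomotopy_symm_comp {f g : C(L, A)} (K : f.Homotopy g) :
    ((HomotopyCofibre.ofHomotopy K.symm).comp (HomotopyCofibre.ofHomotopy K)).Homotopic
      (ContinuousMap.id _) := by
  -- At time 0 the composite runs along `K` up to height 1/2, back along `K` up to 3/4, and then up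
  -- the cone with coordinate `4t - 3`. The function `ε` deforms `4t - 3` into `t`; where it is
  -- negative, `min (2t) (-ε)` is the stage of `K`, which at time 0 is precisely the out-and-back
  -- motion.
  let ε : (L × I) × I → ℝ := fun x => x.1.2 - 3 * (1 - x.2) * (1 - x.1.2)
  have hε : Continuous ε := by fun_prop
  let c : C((L × I) × I, HomotopyCofibre f) :=
    ⟨fun x => if ε x ≤ 0 then
        HomotopyCofibre.incl f (K (Set.projIcc 0 1 zero_le_one (min (2 * x.1.2) (-ε x) : ℝ), x.1.1))
      else HomotopyCofibre.cone f (x.1.1, Set.projIcc 0 1 zero_le_one (ε x)), by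
      refine Continuous.if_le ?_ ?_ hε continuous_const ?_
      · exact (HomotopyCofibre.incl f).continuous.comp (K.continuous.comp
          ((continuous_projIcc.comp (by fun_prop)).prodMk (by fun_prop)))
      · exact (HomotopyCofibre.cone f).continuous.comp
          ((by fun_prop : Continuous fun x : (L × I) × I => x.1.1).prodMk
            (continuous_projIcc.comp hε))
      · intro x hx
        rw [hx, Set.projIcc_of_le_left _ (min_le_right _ _ |>.trans (by simp)),
          Set.projIcc_of_le_left _ le_rfl]
        change HomotopyCofibre.incl f (K (0, x.1.1)) = HomotopyCofibre.cone f (x.1.1, 0)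
        rw [HomotopyCofibre.cone_zero, K.apply_zero]⟩
  have hc : ∀ x, c x = if ε x ≤ 0 then
        HomotopyCofibre.incl f (K (Set.projIcc 0 1 zero_le_one (min (2 * x.1.2) (-ε x) : ℝ), x.1.1))
      else HomotopyCofibre.cone f (x.1.1, Set.projIcc 0 1 zero_le_one (ε x)) := fun x => rfl
  refine HomotopyPushout.homotopic ((HomotopyCofibre.incl f).comp ContinuousMap.fst) c
      (ContinuousMap.const _ (HomotopyCofibre.apex f)) ?_ ?_ ?_ ?_ ?_ ?_ ?_ ?_
  · intro l t
    have h1 : ε ((l, 0), t) ≤ 0 := by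
      have := t.2.2
      simp only [ε, Set.Icc.coe_zero]; linarith
    rw [hc, if_pos h1, Set.projIcc_of_le_left _ ((min_le_left _ _).trans (by simp))]
    change HomotopyCofibre.incl f (K (0, l)) = _
    rw [K.apply_zero]
    rfl
  · intro l t
    have h1 : ε ((l, 1), t) = 1 := by simp [ε]
    rw [hc, h1, if_neg (by norm_num), Set.projIcc_of_right_le _ le_rfl]
    exact HomotopyCofibre.cone_one f l
  · intro x; rfl
  · rintro ⟨l, t⟩
    have h1 : ε ((l, t), 0) = 4 * t - 3 := by simp only [ε, Set.Icc.coe_zero]; ring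
    rw [hc, h1, ContinuousMap.comp_apply, HomotopyCofibre.ofHomotopy_cone]
    by_cases h2 : (t : ℝ) ≤ 1 / 2
    · rw [if_pos h2, if_pos (by linarith), min_eq_left (by simp only; linarith)]
      rfl
    · rw [if_neg h2, HomotopyCofibre.ofHomotopy_cone]
      have h3 : 2 * (t : ℝ) - 1 ∈ Set.Icc (0 : ℝ) 1 := ⟨by linarith, by linarith [t.2.2]⟩
      rw [Set.projIcc_of_mem _ h3, min_eq_right (by simp only; linarith)]
      simp only
      by_cases h4 : 4 * (t : ℝ) - 3 ≤ 0
      · have h5 : -(4 * (t : ℝ) - 3) ∈ Set.Icc (0 : ℝ) 1 := ⟨by linarith, by linarith⟩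
        have h6 : 2 * (2 * (t : ℝ) - 1) ∈ Set.Icc (0 : ℝ) 1 := ⟨by linarith, by linarith⟩
        rw [if_pos h4, if_pos (by linarith), Set.projIcc_of_mem _ h5, Set.projIcc_of_mem _ h6,
          ContinuousMap.Homotopy.symm_apply]
        congr 3
        ext
        simp only [unitInterval.coe_symm_eq]
        ring
      · rw [if_neg h4, if_neg (by linarith)]
        have h5 : 2 * (2 * (t : ℝ) - 1) - 1 = 4 * t - 3 := by ring
        rw [h5]
  · intro x; rfl
  · intro x; rfl
  · rintro ⟨l, t⟩
    have h1 : ε ((l, t), 1) = t := by simp [ε]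
    rw [hc, h1]
    by_cases h2 : (t : ℝ) ≤ 0
    · have h3 : t = 0 := le_antisymm h2 t.2.1
      subst h3
      rw [if_pos h2, Set.projIcc_of_le_left _ ((min_le_left _ _).trans (by simp))]
      change HomotopyCofibre.incl f (K (0, l)) = HomotopyCofibre.cone f (l, 0)
      rw [K.apply_zero, HomotopyCofibre.cone_zero]
    · rw [if_neg h2, Set.projIcc_val]
      rfl
  · intro x; rfl

/-- Homotopic maps have homotopy equivalent cofibres. -/
lemma HomotopyCofibre.nonempty_homotopyEquiv {f g : C(L, A)} (K : f.Homotopic g) :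
    Nonempty (ContinuousMap.HomotopyEquiv (HomotopyCofibre f) (HomotopyCofibre g)) := by
  obtain ⟨K⟩ := K
  refine ⟨⟨HomotopyCofibre.ofHomotopy K, HomotopyCofibre.ofHomotopy K.symm,
    HomotopyCofibre.ofHomotopy_symm_comp K, ?_⟩⟩
  have h := HomotopyCofibre.ofHomotopy_symm_comp K.symm
  rwa [ContinuousMap.Homotopy.symm_symm] at h

end Cofibre

/-! ### Normalisation and reflections of the sphere -/

section Sphere

variable {n : ℕ}

/-- The radial projection to the unit sphere (with an arbitrary value at the origin). -/
noncomputable def toSph (v : EuclideanSpace ℝ (Fin (n + 1))) : Sph n :=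
  if h : v = 0 then basePt n else ⟨‖v‖⁻¹ • v, by
    rw [mem_sphere_zero_iff_norm, norm_smul, norm_inv, norm_norm,
      inv_mul_cancel₀ (norm_ne_zero_iff.2 h)]⟩

lemma toSph_coe {v : EuclideanSpace ℝ (Fin (n + 1))} (h : v ≠ 0) :
    (toSph v : EuclideanSpace ℝ (Fin (n + 1))) = ‖v‖⁻¹ • v := by
  rw [toSph, dif_neg h]

lemma Sph.norm_coe (x : Sph n) : ‖(x : EuclideanSpace ℝ (Fin (n + 1)))‖ = 1 :=
  mem_sphere_zero_iff_norm.1 x.2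

lemma Sph.coe_ne_zero (x : Sph n) : (x : EuclideanSpace ℝ (Fin (n + 1))) ≠ 0 := by
  rw [← norm_ne_zero_iff, x.norm_coe]; exact one_ne_zero

lemma toSph_smul (x : Sph n) {r : ℝ} (hr : 0 < r) :
    toSph (r • (x : EuclideanSpace ℝ (Fin (n + 1)))) = x := by
  apply Subtype.ext
  rw [toSph_coe (smul_ne_zero hr.ne' x.coe_ne_zero), norm_smul, x.norm_coe, mul_one, smul_smul,
    Real.norm_of_nonneg hr.le, inv_mul_cancel₀ hr.ne', one_smul]

@[simp] lemma toSph_self (x : Sph n) : toSph (x : EuclideanSpace ℝ (Fin (n + 1))) = x := by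
  simpa using toSph_smul x one_pos

lemma norm_smul_toSph {v : EuclideanSpace ℝ (Fin (n + 1))} (h : v ≠ 0) :
    ‖v‖ • (toSph v : EuclideanSpace ℝ (Fin (n + 1))) = v := by
  rw [toSph_coe h, smul_smul, mul_inv_cancel₀ (norm_ne_zero_iff.2 h), one_smul]

lemma continuousOn_toSph :
    ContinuousOn (toSph : EuclideanSpace ℝ (Fin (n + 1)) → Sph n) {v | v ≠ 0} := by
  rw [IsInducing.subtypeVal.continuousOn_iff]
  have h : ContinuousOn (fun v : EuclideanSpace ℝ (Fin (n + 1)) => ‖v‖⁻¹ • v) {v | v ≠ 0} :=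
    (continuousOn_id.norm.inv₀ fun v hv => norm_ne_zero_iff.2 hv).smul continuousOn_id
  exact h.congr fun v hv => toSph_coe hv

lemma Continuous.toSph {X : Type*} [TopologicalSpace X] {g : X → EuclideanSpace ℝ (Fin (n + 1))}
    (hg : Continuous g) (h : ∀ x, g x ≠ 0) : Continuous fun x => toSph (g x) :=
  continuousOn_toSph.comp_continuous hg h

/-- The reflection of the sphere in the hyperplane orthogonal to a unit vector. -/
noncomputable def sphRefl (n : ℕ) : C(Sph n × Sph n, Sph n) where
  toFun x := ⟨x.2.1 - (2 * inner ℝ x.1.1 x.2.1) • x.1.1, by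
    have h1 := x.1.norm_coe
    have h2 := x.2.norm_coe
    rw [mem_sphere_zero_iff_norm, ← sq_eq_sq₀ (norm_nonneg _) zero_le_one, norm_sub_sq_real,
      norm_smul, inner_smul_right, h1, h2, real_inner_comm, mul_one, Real.norm_eq_abs, sq_abs]
    ring⟩
  continuous_toFun := by
    refine Continuous.subtype_mk ?_ _
    fun_prop

lemma sphRefl_coe (u x : Sph n) :
    (sphRefl n (u, x) : EuclideanSpace ℝ (Fin (n + 1))) =
      x.1 - (2 * inner ℝ u.1 x.1) • u.1 := rfl

@[simp] lemma sphRefl_sphRefl (u x : Sph n) : sphRefl n (u, sphRefl n (u, x)) = x := by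
  apply Subtype.ext
  rw [sphRefl_coe, sphRefl_coe, inner_sub_right, inner_smul_right, real_inner_self_eq_norm_sq,
    u.norm_coe]
  module

lemma sphRefl_injective (u : Sph n) : Function.Injective fun x => sphRefl n (u, x) :=
  Function.LeftInverse.injective (g := fun x => sphRefl n (u, x)) (sphRefl_sphRefl u)

end Sphere

/-! ### The homotopy cofibre of the diagonal and the quotient by the diagonal -/

/-- Two multiples of unit vectors can cancel only if they have the same length, and for nonnegative
coefficients this means `a = b`. -/
lemma smul_add_smul_ne_zero {n : ℕ} {x y : Sph n} {a b : ℝ} (ha : 0 ≤ a) (hb : 0 ≤ b)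
    (hab : 0 < a + b) (h : a = b → (x : EuclideanSpace ℝ (Fin (n + 1))) + y ≠ 0) :
    a • (x : EuclideanSpace ℝ (Fin (n + 1))) + b • (y : EuclideanSpace ℝ (Fin (n + 1))) ≠ 0 := by
  intro h0
  have h1 : ‖a • (x : EuclideanSpace ℝ (Fin (n + 1)))‖ =
      ‖b • (y : EuclideanSpace ℝ (Fin (n + 1)))‖ := by
    rw [eq_neg_of_add_eq_zero_left h0, norm_neg]
  rw [norm_smul, norm_smul, x.norm_coe, y.norm_coe, mul_one, mul_one, Real.norm_of_nonneg ha,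
    Real.norm_of_nonneg hb] at h1
  refine h h1 ?_
  rw [h1, ← smul_add] at h0
  exact (smul_eq_zero.1 h0).resolve_left (by linarith)

/-- This provides the homotopy extension for the diagonal: up to time 1/2 the second point of a
close pair moves onto the first, and afterwards the merged pair climbs the cone. -/
lemma nonempty_cofibre_diagonal_homotopyEquiv (n : ℕ) :
    Nonempty (ContinuousMap.HomotopyEquiv (HomotopyCofibre (diagonal (Sph n)))
      (Quot (CollapseRel (diagonal (Sph n))))) := by
  -- The weight of the first point on the chord: for distance at most 1/2 it reaches 1 at time 1/2,
  -- and for distance at least 1 it stays 0, so chords between antipodes are never used.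
  let l : (Sph n × Sph n) × I → ℝ := fun z =>
    min 1 (2 * (z.2 : ℝ)) * max 0 (min 1 (2 - 2 * dist z.1.1 z.1.2))
  have hl : Continuous l := by fun_prop
  have hl0 : ∀ z, 0 ≤ l z := fun z =>
    mul_nonneg (le_min zero_le_one (mul_nonneg two_pos.le z.2.2.1)) (le_max_left _ _)
  have hl1 : ∀ z, l z ≤ 1 := fun z => mul_le_one₀ (min_le_left _ _) (le_max_left _ _)
    (max_le zero_le_one (min_le_left _ _))
  let g : (Sph n × Sph n) × I → EuclideanSpace ℝ (Fin (n + 1)) := fun z =>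
    l z • z.1.1.1 + (1 - l z) • z.1.2.1
  have hg : Continuous g := by fun_prop
  have hg0 : ∀ z, g z ≠ 0 := by
    intro z
    refine smul_add_smul_ne_zero (hl0 z) (sub_nonneg.2 (hl1 z)) (by linarith) fun h h' => ?_
    have h2 : dist z.1.1 z.1.2 = 2 := by
      rw [Subtype.dist_eq, dist_eq_norm, eq_neg_of_add_eq_zero_right h', sub_neg_eq_add,
        ← two_smul ℝ, norm_smul, Sph.norm_coe]
      norm_num
    have h3 : l z = 0 := by
      simp only [l, h2]
      norm_num
    rw [h3] at h
    norm_num at h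
  -- The height on the cone. It is nonnegative only for times at least 1/2 and distances at most
  -- 1/2, where the pair is already merged; on the diagonal it is `2t - 1`.
  let ε : (Sph n × Sph n) × I → ℝ := fun z => min (2 * z.2 - 1) (1 - 2 * dist z.1.1 z.1.2)
  have hε : Continuous ε := by fun_prop
  have hlε : ∀ z, 0 ≤ ε z → l z = 1 := by
    intro z hz
    have h1 := hz.trans (min_le_left _ _)
    have h2 := hz.trans (min_le_right _ _)
    simp only [l]
    rw [min_eq_left (by linarith), min_eq_left (by linarith), max_eq_right zero_le_one, one_mul]
  let H : C((Sph n × Sph n) × I, HomotopyCofibre (diagonal (Sph n))) :=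
    ⟨fun z => if ε z ≤ 0 then HomotopyCofibre.incl (diagonal (Sph n)) (z.1.1, toSph (g z))
      else HomotopyCofibre.cone (diagonal (Sph n)) (z.1.1, Set.projIcc 0 1 zero_le_one (ε z)), by
      refine Continuous.if_le ?_ ?_ hε continuous_const ?_
      · exact (HomotopyCofibre.incl _).continuous.comp
          ((by fun_prop : Continuous fun z : (Sph n × Sph n) × I => z.1.1).prodMk
            (Continuous.toSph hg hg0))
      · exact (HomotopyCofibre.cone _).continuous.comp
          ((by fun_prop : Continuous fun z : (Sph n × Sph n) × I => z.1.1).prodMk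
            (continuous_projIcc.comp hε))
      · intro z hz
        have h1 := hlε z hz.ge
        have h2 : g z = z.1.1.1 := by simp only [g, h1]; module
        rw [hz, Set.projIcc_of_le_left _ le_rfl, h2, toSph_self]
        exact (HomotopyCofibre.cone_zero _ _).symm⟩
  have hH : ∀ z, H z = if ε z ≤ 0 then
      HomotopyCofibre.incl (diagonal (Sph n)) (z.1.1, toSph (g z))
      else HomotopyCofibre.cone (diagonal (Sph n)) (z.1.1, Set.projIcc 0 1 zero_le_one (ε z)) :=
    fun z => rfl
  have : Nonempty (Sph n) := ⟨basePt n⟩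
  refine HomotopyCofibre.nonempty_homotopyEquiv_quot (diagonal (Sph n))
    ⟨fun t => Set.projIcc (0 : ℝ) 1 zero_le_one (2 * t - 1 : ℝ), continuous_projIcc.comp (by fun_prop)⟩
    ?_ ?_ H ?_ ?_
  · exact Set.projIcc_of_le_left zero_le_one (by norm_num)
  · exact Set.projIcc_of_right_le zero_le_one (by norm_num)
  · rintro ⟨x, y⟩
    have h1 : l ((x, y), 0) = 0 := by simp [l]
    have h2 : g ((x, y), 0) = y.1 := by simp only [g, h1]; module
    rw [hH, if_pos ((min_le_left _ _).trans (by simp)), h2, toSph_self]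
  · intro x t
    have h1 : ε ((x, x), t) = 2 * t - 1 := by
      simp only [ε, dist_self]
      exact min_eq_left (by linarith [t.2.2])
    have h2 : g ((x, x), t) = x.1 := by simp only [g]; module
    change H ((x, x), t) = _
    rw [hH, h1, h2, toSph_self]
    by_cases h3 : 2 * (t : ℝ) - 1 ≤ 0
    · rw [if_pos h3]
      refine (HomotopyCofibre.cone_zero _ x).symm.trans ?_
      exact congrArg (fun s => HomotopyCofibre.cone (diagonal (Sph n)) (x, s))
        (Set.projIcc_of_le_left zero_le_one h3).symm
    · rw [if_neg h3]
      rfl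

/-! ### The cone on a sphere is a ball -/

/-- Attaching a cell is forming a homotopy cofibre. -/
lemma nonempty_cofibre_homeomorph_attachCell {X : Type} [TopologicalSpace X] [CompactSpace X]
    [T2Space X] {m : ℕ} [Nonempty (BallBdry m)] (φ : C(BallBdry m, X)) :
    Nonempty (HomotopyCofibre φ ≃ₜ AttachCell φ) := by
  let c : BallBdry m × I → Ball m := fun x => ⟨(1 - (x.2 : ℝ)) • x.1.1, by
    rw [mem_closedBall_zero_iff, norm_smul, mem_sphere_zero_iff_norm.1 x.1.2, mul_one,
      Real.norm_of_nonneg (sub_nonneg.2 x.2.2.2)]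
    linarith [x.2.2.1]⟩
  have hc : Continuous c := Continuous.subtype_mk (by fun_prop) _
  have hcn : ∀ x, ‖(c x).1‖ = 1 - x.2 := fun x => by
    simp only [c]
    rw [norm_smul, mem_sphere_zero_iff_norm.1 x.1.2, mul_one,
      Real.norm_of_nonneg (sub_nonneg.2 x.2.2.2)]
  let z : Ball m := ⟨0, by simp⟩
  let p : X ⊕ ((BallBdry m × I) ⊕ PUnit.{1}) → X ⊕ Ball m :=
    Sum.map id (Sum.elim c fun _ => z)
  have hp : Continuous p := Continuous.sumMap continuous_id (hc.sumElim continuous_const)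
  have hs : Function.Surjective p := by
    rintro (x | b)
    · exact ⟨Sum.inl x, rfl⟩
    by_cases hb : b.1 = 0
    · exact ⟨Sum.inr (Sum.inr PUnit.unit), congrArg Sum.inr (Subtype.ext hb.symm)⟩
    · have h0 := norm_ne_zero_iff.2 hb
      have h1 : ‖b.1‖ ≤ 1 := mem_closedBall_zero_iff.1 b.2
      refine ⟨Sum.inr (Sum.inl (⟨‖b.1‖⁻¹ • b.1, ?_⟩, ⟨1 - ‖b.1‖, ?_⟩)),
        congrArg Sum.inr (Subtype.ext ?_)⟩
      · rw [mem_sphere_zero_iff_norm, norm_smul, norm_inv, norm_norm, inv_mul_cancel₀ h0]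
      · exact ⟨by linarith, by linarith [norm_nonneg b.1]⟩
      · change (1 - (1 - ‖b.1‖)) • (‖b.1‖⁻¹ • b.1) = b.1
        rw [sub_sub_cancel, smul_smul, mul_inv_cancel₀ h0, one_smul]
  have key : ∀ (v v' : BallBdry m) (u u' : I), c (v, u) = c (v', u') →
      u = u' ∧ (u = 1 ∨ v = v') := by
    intro v v' u u' h
    have h1 := hcn (v, u)
    rw [h, hcn] at h1
    have h2 : u = u' := Subtype.ext (by simp only at h1; linarith)
    subst h2
    refine ⟨rfl, ?_⟩
    by_cases hu : u = 1
    · exact Or.inl hu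
    · refine Or.inr (Subtype.ext ?_)
      have h3 : (1 - (u : ℝ)) ≠ 0 := fun h => hu (Subtype.ext (by
        rw [Set.Icc.coe_one]; linarith))
      exact smul_right_injective _ h3 (congrArg Subtype.val h)
  have key2 : ∀ (v : BallBdry m) (u : I), c (v, u) = z → u = 1 := by
    intro v u h
    have h1 := hcn (v, u)
    rw [h] at h1
    simp only [z, norm_zero] at h1
    exact Subtype.ext (by rw [Set.Icc.coe_one]; linarith)
  have sd : ∀ v v' : BallBdry m, HomotopyCofibre.cone φ (v, 1) = HomotopyCofibre.cone φ (v', 1) :=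
    fun v v' => by rw [HomotopyCofibre.cone_one, HomotopyCofibre.cone_one]
  -- A continuous surjection from a compact space to a Hausdorff space is a quotient map; this is
  -- where compactness and separation of `X` enter.
  refine nonempty_homeomorph_quot (IsQuotientMap.of_surjective_continuous hs hp) _ (CellRel φ)
    ?_ ?_ ?_
  · rintro _ _ (v | v)
    · refine Quot.sound ?_
      have h : p (Sum.inr (Sum.inl (v, 0))) =
          Sum.inr ⟨v.1, Metric.sphere_subset_closedBall v.2⟩ := by
        refine congrArg Sum.inr (Subtype.ext ?_)
        change (1 - ((0 : I) : ℝ)) • v.1 = v.1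
        simp
      rw [h]
      exact CellRel.glue v
    · congr 1
      refine congrArg Sum.inr (Subtype.ext ?_)
      change (1 - ((1 : I) : ℝ)) • v.1 = 0
      simp
  · rintro (x | ⟨v, u⟩ | x) (x' | ⟨v', u'⟩ | x') h
    · exact congrArg _ (congrArg Sum.inl (Sum.inl_injective h))
    · exact absurd h (by simp [p])
    · exact absurd h (by simp [p])
    · exact absurd h (by simp [p])
    · obtain ⟨rfl, rfl | rfl⟩ := key _ _ _ _ (Sum.inr_injective h)
      · exact sd v v'
      · rfl
    · obtain rfl := key2 _ _ (Sum.inr_injective h)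
      exact HomotopyCofibre.cone_one φ v
    · exact absurd h (by simp [p])
    · obtain rfl := key2 _ _ (Sum.inr_injective h).symm
      exact (HomotopyCofibre.cone_one φ v').symm
    · rfl
  · intro s s' h
    generalize ht : p s = t at h
    generalize ht' : p s' = t' at h
    obtain ⟨v⟩ := h
    rcases s' with x' | s'
    swap
    · exact absurd ht' (by simp [p])
    obtain rfl : x' = φ v := Sum.inl_injective ht'
    rcases s with x | ⟨w, u⟩ | x
    · exact absurd ht (by simp [p])
    · have h1 : c (w, u) = ⟨v.1, Metric.sphere_subset_closedBall v.2⟩ := Sum.inr_injective ht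
      have h2 := hcn (w, u)
      rw [h1] at h2
      simp only [mem_sphere_zero_iff_norm.1 v.2] at h2
      obtain rfl : u = 0 := Subtype.ext (by rw [Set.Icc.coe_zero]; linarith)
      obtain rfl : w = v := Subtype.ext (by simpa [c] using congrArg Subtype.val h1)
      exact HomotopyCofibre.cone_zero φ w
    · have h1 : z = ⟨v.1, Metric.sphere_subset_closedBall v.2⟩ := Sum.inr_injective ht
      have h2 : ‖v.1‖ = 1 := mem_sphere_zero_iff_norm.1 v.2
      rw [← congrArg Subtype.val h1] at h2
      simp [z] at h2

/-! ### The cell structure of the quotient of `S^n × S^n` by the diagonal -/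

section Collapse

variable {n : ℕ}

lemma collapse_castSucc (x : Ball n) (i : Fin n) :
    (collapse n x).1 (Fin.castSucc i) = 2 * √(1 - ‖x.1‖ ^ 2) * x.1 i := by
  simp [collapse]

lemma collapse_last (x : Ball n) : (collapse n x).1 (Fin.last n) = 2 * ‖x.1‖ ^ 2 - 1 := by
  simp [collapse]

@[simp] lemma basePt_castSucc (i : Fin n) : (basePt n).1 (Fin.castSucc i) = 0 := by
  simp [basePt]

@[simp] lemma basePt_last : (basePt n).1 (Fin.last n) = 1 := by
  simp [basePt]

lemma Sph.ext_snoc {x y : Sph n} (h : ∀ i : Fin n, x.1 (Fin.castSucc i) = y.1 (Fin.castSucc i))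
    (h' : x.1 (Fin.last n) = y.1 (Fin.last n)) : x = y := by
  apply Subtype.ext
  ext i
  induction i using Fin.lastCases with
  | last => exact h'
  | cast i => exact h i

lemma Ball.norm_le (x : Ball n) : ‖x.1‖ ≤ 1 := mem_closedBall_zero_iff.1 x.2

lemma collapse_eq_basePt_iff (x : Ball n) : collapse n x = basePt n ↔ ‖x.1‖ = 1 := by
  refine ⟨fun h => ?_, collapse_bdry x⟩
  have h1 := collapse_last x
  rw [h, basePt_last] at h1
  nlinarith [norm_nonneg x.1]

lemma collapse_inj {x y : Ball n} (hx : ‖x.1‖ ≠ 1) (h : collapse n x = collapse n y) : x = y := by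
  have h1 : ‖x.1‖ = ‖y.1‖ := by
    have h2 := collapse_last x
    rw [h, collapse_last] at h2
    rw [← sq_eq_sq₀ (norm_nonneg _) (norm_nonneg _)]
    linarith
  have h2 : 0 < 1 - ‖x.1‖ ^ 2 := by
    nlinarith [norm_nonneg x.1, lt_of_le_of_ne x.norm_le hx]
  apply Subtype.ext
  ext i
  have h3 := collapse_castSucc x i
  rw [h, collapse_castSucc, ← h1] at h3
  exact (mul_left_cancel₀ (mul_pos two_pos (Real.sqrt_pos.2 h2)).ne' h3).symm

lemma Sph.sum_sq (x : Sph n) :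
    ∑ i : Fin n, x.1 (Fin.castSucc i) ^ 2 + x.1 (Fin.last n) ^ 2 = 1 := by
  rw [← Fin.sum_univ_castSucc (fun i => x.1 i ^ 2), ← EuclideanSpace.real_norm_sq_eq, x.norm_coe,
    one_pow]

/-- The base point is attained only on the boundary of the ball, which is empty for `n = 0`.
Elsewhere the last coordinate determines `|a|` and the others then determine `a`. -/
lemma collapse_surjective (hn : 1 ≤ n) : Function.Surjective (collapse n) := by
  intro x
  have hx := x.sum_sq
  have h0 : 0 ≤ ∑ i : Fin n, x.1 (Fin.castSucc i) ^ 2 := Finset.sum_nonneg fun i _ => sq_nonneg _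
  set t := x.1 (Fin.last n) with ht
  have ht1 : t ≤ 1 := by nlinarith
  rcases eq_or_lt_of_le ht1 with h1 | h1
  · refine ⟨⟨EuclideanSpace.single ⟨0, hn⟩ 1, by simp⟩, ?_⟩
    rw [collapse_bdry _ (by simp)]
    refine Sph.ext_snoc (fun i => ?_) (by rw [basePt_last, ← ht, h1])
    rw [h1] at hx
    have h2 := (Finset.sum_eq_zero_iff_of_nonneg fun i _ => sq_nonneg _).1
      (by linarith : ∑ i : Fin n, x.1 (Fin.castSucc i) ^ 2 = 0) i (Finset.mem_univ i)
    rw [basePt_castSucc, pow_eq_zero_iff two_ne_zero |>.1 h2]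
  · have h2 : 0 < (1 - t) / 2 := by linarith
    have h3 := Real.sqrt_pos.2 h2
    let a : EuclideanSpace ℝ (Fin n) := WithLp.toLp 2 fun i =>
      (2 * √((1 - t) / 2))⁻¹ * x.1 (Fin.castSucc i)
    have ha : ‖a‖ ^ 2 = (1 + t) / 2 := by
      rw [EuclideanSpace.real_norm_sq_eq]
      simp only [a, mul_pow]
      rw [← Finset.mul_sum, inv_pow, mul_pow, Real.sq_sqrt h2.le]
      have : ∑ i : Fin n, x.1 (Fin.castSucc i) ^ 2 = (1 - t) * (1 + t) := by linarith
      rw [this]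
      field_simp
    have hb : a ∈ Metric.closedBall (0 : EuclideanSpace ℝ (Fin n)) 1 := by
      rw [mem_closedBall_zero_iff]
      nlinarith [norm_nonneg a]
    refine ⟨⟨a, hb⟩, Sph.ext_snoc (fun i => ?_) ?_⟩
    · rw [collapse_castSucc]
      simp only [ha]
      have h4 : 1 - (1 + t) / 2 = (1 - t) / 2 := by ring
      rw [h4]
      simp only [a]
      rw [← mul_assoc, mul_inv_cancel₀ (by positivity), one_mul]
    · rw [collapse_last]
      simp only [ha]
      ring

/-- The unit vector `(-a, √(1 - |a|²))`, which is orthogonal to the hyperplane of the reflection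
which interchanges the base point and `collapse a`. -/
noncomputable def mirror (n : ℕ) : C(Ball n, Sph n) where
  toFun a := ⟨WithLp.toLp 2 (Fin.snoc (α := fun _ => ℝ) (fun i => - a.1 i) (√(1 - ‖a.1‖ ^ 2))), by
    have h : 0 ≤ 1 - ‖a.1‖ ^ 2 := by nlinarith [norm_nonneg a.1, a.norm_le]
    rw [mem_sphere_zero_iff_norm, ← sq_eq_sq₀ (norm_nonneg _) zero_le_one, norm_sq_snoc,
      Real.sq_sqrt h]
    simp only [neg_sq]
    rw [← EuclideanSpace.real_norm_sq_eq]
    ring⟩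
  continuous_toFun := by
    refine Continuous.subtype_mk ?_ _
    refine (PiLp.continuous_toLp 2 _).comp ?_
    refine Continuous.finSnoc (A := fun _ => ℝ) ?_ ?_ <;> fun_prop

lemma mirror_castSucc (x : Ball n) (i : Fin n) :
    (mirror n x).1 (Fin.castSucc i) = - x.1 i := by
  simp [mirror]

lemma mirror_last (x : Ball n) : (mirror n x).1 (Fin.last n) = √(1 - ‖x.1‖ ^ 2) := by
  simp [mirror]

lemma inner_basePt (u : Sph n) : inner ℝ u.1 (basePt n).1 = u.1 (Fin.last n) := by
  rw [PiLp.inner_apply, Fin.sum_univ_castSucc]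
  simp

lemma sphRefl_mirror_basePt (a : Ball n) : sphRefl n (mirror n a, basePt n) = collapse n a := by
  have h : 0 ≤ 1 - ‖a.1‖ ^ 2 := by nlinarith [norm_nonneg a.1, a.norm_le]
  refine Sph.ext_snoc (fun i => ?_) ?_
  · rw [sphRefl_coe, inner_basePt, collapse_castSucc, PiLp.sub_apply, PiLp.smul_apply,
      mirror_castSucc, mirror_last, basePt_castSucc, smul_eq_mul]
    ring
  · rw [sphRefl_coe, inner_basePt, collapse_last, PiLp.sub_apply, PiLp.smul_apply, mirror_last,
      basePt_last, smul_eq_mul]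
    linear_combination -2 * Real.mul_self_sqrt h

lemma sphRefl_basePt_castSucc (x : Sph n) (i : Fin n) :
    (sphRefl n (basePt n, x)).1 (Fin.castSucc i) = x.1 (Fin.castSucc i) := by
  rw [sphRefl_coe, PiLp.sub_apply, PiLp.smul_apply, basePt_castSucc, smul_zero, sub_zero]

lemma sphRefl_basePt_last (x : Sph n) :
    (sphRefl n (basePt n, x)).1 (Fin.last n) = - x.1 (Fin.last n) := by
  rw [sphRefl_coe, PiLp.sub_apply, PiLp.smul_apply, basePt_last, real_inner_comm, inner_basePt,
    smul_eq_mul]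
  ring

/-- Scaling of the ball by a number in the unit interval. -/
def ballSmul (n : ℕ) : C(I × Ball n, Ball n) where
  toFun x := ⟨(x.1 : ℝ) • x.2.1, by
    rw [mem_closedBall_zero_iff, norm_smul, Real.norm_of_nonneg x.1.2.1]
    exact mul_le_one₀ x.1.2.2 (norm_nonneg _) x.2.norm_le⟩
  continuous_toFun := Continuous.subtype_mk (by fun_prop) _

lemma norm_ballSmul (t : I) (x : Ball n) : ‖(ballSmul n (t, x)).1‖ = t * ‖x.1‖ := by
  change ‖(t : ℝ) • x.1‖ = _
  rw [norm_smul, Real.norm_of_nonneg t.2.1]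

lemma ballSmul_zero (x : Ball n) : (ballSmul n (0, x)).1 = 0 := by
  change ((0 : I) : ℝ) • x.1 = 0
  simp

lemma ballSmul_one (x : Ball n) : ballSmul n (1, x) = x := by
  apply Subtype.ext
  change ((1 : I) : ℝ) • x.1 = x.1
  simp

lemma mirror_ballSmul_zero (x : Ball n) : mirror n (ballSmul n (0, x)) = basePt n := by
  refine Sph.ext_snoc (fun i => ?_) ?_
  · rw [mirror_castSucc, ballSmul_zero, basePt_castSucc, PiLp.zero_apply, neg_zero]
  · rw [mirror_last, ballSmul_zero, basePt_last]
    simp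

/-- The number `√(1 - s²)` for `s` in the unit interval. -/
noncomputable def cosine : C(I, I) where
  toFun s := ⟨√(1 - (s : ℝ) ^ 2), Real.sqrt_nonneg _, by
    exact Real.sqrt_le_iff.2 ⟨zero_le_one, by nlinarith [sq_nonneg (s : ℝ)]⟩⟩
  continuous_toFun := Continuous.subtype_mk (by fun_prop) _

lemma cosine_sq (s : I) : (cosine s : ℝ) ^ 2 = 1 - (s : ℝ) ^ 2 :=
  Real.sq_sqrt (by nlinarith [s.2.1, s.2.2])

/-- Replacing `s` by `√(1 - s²)` preserves `2s√(1 - s²)` and changes the sign of `2s² - 1`, which is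
the effect of the reflection. This makes the two halves of `boxHomotopy` fit together. -/
lemma sphRefl_collapse_cosine (s : I) (a : Ball n) (ha : ‖a.1‖ = 1) :
    sphRefl n (basePt n, collapse n (ballSmul n (cosine s, a))) =
      collapse n (ballSmul n (s, a)) := by
  have h1 : 1 - ((cosine s : ℝ) * 1) ^ 2 = (s : ℝ) ^ 2 := by
    rw [mul_one, cosine_sq]; ring
  refine Sph.ext_snoc (fun i => ?_) ?_
  · rw [sphRefl_basePt_castSucc, collapse_castSucc, collapse_castSucc, norm_ballSmul,
      norm_ballSmul, ha, h1, Real.sqrt_sq s.2.1, mul_one]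
    change 2 * (s : ℝ) * ((cosine s : ℝ) * a.1 i) = 2 * (cosine s : ℝ) * ((s : ℝ) * a.1 i)
    ring
  · rw [sphRefl_basePt_last, collapse_last, collapse_last, norm_ballSmul, norm_ballSmul, ha,
      mul_one, cosine_sq]
    ring

end Collapse

/-! ### The attaching map of the top cell and its deformation to the Whitehead square. -/

section Box

variable {n : ℕ}

lemma BoxBdry.continuous_fst {p q : ℕ} : Continuous (BoxBdry.fst : BoxBdry p q → Ball p) :=
  Continuous.subtype_mk (_root_.continuous_fst.comp continuous_subtype_val) _

lemma BoxBdry.continuous_snd {p q : ℕ} : Continuous (BoxBdry.snd : BoxBdry p q → Ball q) :=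
  Continuous.subtype_mk (_root_.continuous_snd.comp continuous_subtype_val) _

lemma BoxBdry.snd_eq_one {p q : ℕ} {z : BoxBdry p q} (h : ‖z.fst.1‖ ≤ ‖z.snd.1‖) :
    ‖z.snd.1‖ = 1 :=
  (max_eq_right h).symm.trans z.max_eq

lemma BoxBdry.fst_eq_one {p q : ℕ} {z : BoxBdry p q} (h : ¬ ‖z.fst.1‖ ≤ ‖z.snd.1‖) :
    ‖z.fst.1‖ = 1 :=
  (max_eq_left (not_le.1 h).le).symm.trans z.max_eq

/-- A homotopy on the boundary of `D^n × D^n` from the attaching map of the top cell of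
`(S^n × S^n) / Δ` to the map which represents the Whitehead square. -/
noncomputable def boxHomotopy (n : ℕ) : C(I × BoxBdry n n, Sph n) where
  toFun x := if ‖x.2.fst.1‖ ≤ ‖x.2.snd.1‖ then collapse n (ballSmul n (x.1, x.2.fst))
    else sphRefl n (basePt n, sphRefl n (mirror n (ballSmul n (cosine x.1, x.2.fst)),
      collapse n x.2.snd))
  continuous_toFun := by
    have h1 : Continuous fun x : I × BoxBdry n n => x.2.fst :=
      BoxBdry.continuous_fst.comp continuous_snd
    have h2 : Continuous fun x : I × BoxBdry n n => x.2.snd :=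
      BoxBdry.continuous_snd.comp continuous_snd
    refine Continuous.if_le (by fun_prop) (by fun_prop) (by fun_prop) (by fun_prop) ?_
    intro x hx
    -- On the seam both norms are 1: the second coordinate collapses to the base point, which the
    -- mirror sends to `collapse` of the scaled first coordinate.
    have h3 := BoxBdry.snd_eq_one hx.le
    rw [collapse_bdry _ h3, sphRefl_mirror_basePt, sphRefl_collapse_cosine _ _ (hx.trans h3)]

lemma boxHomotopy_apply (s : I) (z : BoxBdry n n) :
    boxHomotopy n (s, z) =
      if ‖z.fst.1‖ ≤ ‖z.snd.1‖ then collapse n (ballSmul n (s, z.fst))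
      else sphRefl n (basePt n, sphRefl n (mirror n (ballSmul n (cosine s, z.fst)),
        collapse n z.snd)) := rfl

lemma boxHomotopy_one (z : BoxBdry n n) :
    boxHomotopy n (1, z) =
      boxMap (ContinuousMap.id (Sph n)) (ContinuousMap.id (Sph n)) rfl z := by
  have h : cosine 1 = 0 := Subtype.ext (by simp [cosine])
  rw [boxHomotopy_apply, h, mirror_ballSmul_zero, sphRefl_sphRefl, ballSmul_one]
  rfl

/-- The attaching map of the top cell of `(S^n × S^n) / Δ`. -/
noncomputable def diagAttach (n : ℕ) : C(BallBdry (n + n), Sph n) :=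
  ⟨fun v => boxHomotopy n (0, toBoxBdry n n v), by fun_prop⟩

lemma diagAttach_homotopic (n : ℕ) : (diagAttach n).Homotopic (whiteheadSquare n) :=
  ⟨{ toFun := fun x => boxHomotopy n (x.1, toBoxBdry n n x.2)
     continuous_toFun := by fun_prop
     map_zero_left := fun _ => rfl
     map_one_left := fun _ => boxHomotopy_one _ }⟩

/-- At time 0 the first half of `boxHomotopy` is constantly `collapse` of the centre, the antipode
of the base point. The reflection in `basePt` is the chart of the fibre, so this part of the
boundary meets the fibre in its diagonal point. -/
lemma diagAttach_of_snd (v : BallBdry (n + n)) (h : ‖(toBoxBdry n n v).snd.1‖ = 1) :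
    sphRefl n (basePt n, diagAttach n v) = basePt n := by
  change sphRefl n (basePt n, boxHomotopy n (0, toBoxBdry n n v)) = basePt n
  rw [boxHomotopy_apply, if_pos (by rw [h]; exact (toBoxBdry n n v).fst.norm_le)]
  refine Sph.ext_snoc (fun i => ?_) ?_
  · rw [sphRefl_basePt_castSucc, collapse_castSucc, ballSmul_zero, basePt_castSucc]
    simp
  · rw [sphRefl_basePt_last, collapse_last, ballSmul_zero, basePt_last]
    simp

/-- On this part the chart undoes the outer reflection of `boxHomotopy` and leaves the second
coordinate of `diagCell`. -/
lemma diagAttach_of_fst (v : BallBdry (n + n)) (h : ‖(toBoxBdry n n v).fst.1‖ = 1)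
    (h' : ‖(toBoxBdry n n v).snd.1‖ ≠ 1) :
    sphRefl n (basePt n, diagAttach n v) =
      sphRefl n (mirror n (toBoxBdry n n v).fst, collapse n (toBoxBdry n n v).snd) := by
  change sphRefl n (basePt n, boxHomotopy n (0, toBoxBdry n n v)) = _
  have h1 : cosine 0 = 1 := Subtype.ext (by simp [cosine])
  rw [boxHomotopy_apply, if_neg (by
    rw [h]; exact not_le.2 (lt_of_le_of_ne (toBoxBdry n n v).snd.norm_le h')), sphRefl_sphRefl, h1,
    ballSmul_one]

/-- The splitting of a vector of `ℝ^(p+q)` in its two parts. -/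
noncomputable def splitVec {p q : ℕ} (v : EuclideanSpace ℝ (Fin (p + q))) :
    EuclideanSpace ℝ (Fin p) × EuclideanSpace ℝ (Fin q) :=
  (WithLp.toLp 2 fun i => v (Fin.castAdd q i), WithLp.toLp 2 fun j => v (Fin.natAdd p j))

lemma splitVec_smul {p q : ℕ} (c : ℝ) (v : EuclideanSpace ℝ (Fin (p + q))) :
    splitVec (c • v) = c • splitVec v := rfl

lemma splitVec_injective {p q : ℕ} : Function.Injective (splitVec (p := p) (q := q)) := by
  intro v w h
  ext i
  refine Fin.addCases (fun i => ?_) (fun j => ?_) i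
  · exact congrArg (fun w : EuclideanSpace ℝ (Fin p) => w i) (congrArg Prod.fst h)
  · exact congrArg (fun w : EuclideanSpace ℝ (Fin q) => w j) (congrArg Prod.snd h)

lemma splitVec_surjective {p q : ℕ} : Function.Surjective (splitVec (p := p) (q := q)) := by
  rintro ⟨x, y⟩
  refine ⟨WithLp.toLp 2 (Fin.append x y), ?_⟩
  simp [splitVec]

lemma toBoxBdry_coe {p q : ℕ} (v : BallBdry (p + q)) :
    (toBoxBdry p q v).1 = ‖splitVec v.1‖⁻¹ • splitVec v.1 := rfl

lemma splitVec_ne_zero {p q : ℕ} {v : EuclideanSpace ℝ (Fin (p + q))} (h : v ≠ 0) :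
    splitVec v ≠ 0 := fun h' => h (splitVec_injective (h'.trans rfl))

lemma BallBdry.ne_zero {m : ℕ} (v : BallBdry m) : v.1 ≠ 0 := by
  rw [← norm_ne_zero_iff, mem_sphere_zero_iff_norm.1 v.2]; exact one_ne_zero

lemma toBoxBdry_injective (p q : ℕ) : Function.Injective (toBoxBdry p q) := by
  intro v w h
  have h1 := congrArg Subtype.val h
  rw [toBoxBdry_coe, toBoxBdry_coe, ← splitVec_smul, ← splitVec_smul] at h1
  have h2 := splitVec_injective h1
  have hv := norm_pos_iff.2 (splitVec_ne_zero v.ne_zero)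
  have hw := norm_pos_iff.2 (splitVec_ne_zero w.ne_zero)
  have h3 := congrArg norm h2
  rw [norm_smul, norm_smul, mem_sphere_zero_iff_norm.1 v.2, mem_sphere_zero_iff_norm.1 w.2,
    norm_inv, norm_inv, norm_norm, norm_norm, mul_one, mul_one] at h3
  rw [h3] at h2
  exact Subtype.ext (smul_right_injective _ (inv_pos.2 hw).ne' h2)

lemma toBoxBdry_surjective (p q : ℕ) : Function.Surjective (toBoxBdry p q) := by
  intro z
  obtain ⟨w, hw⟩ := splitVec_surjective z.1
  have hz : ‖z.1‖ = 1 := mem_sphere_zero_iff_norm.1 z.2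
  have h0 : w ≠ 0 := by
    rintro rfl
    rw [← hw] at hz
    have : splitVec (0 : EuclideanSpace ℝ (Fin (p + q))) = 0 := rfl
    rw [this, norm_zero] at hz
    exact zero_ne_one hz
  have h1 := norm_pos_iff.2 h0
  refine ⟨⟨‖w‖⁻¹ • w, ?_⟩, Subtype.ext ?_⟩
  · rw [mem_sphere_zero_iff_norm, norm_smul, norm_inv, norm_norm, inv_mul_cancel₀ h1.ne']
  · rw [toBoxBdry_coe]
    simp only
    rw [splitVec_smul, hw, norm_smul, hz, norm_inv, norm_norm, mul_one, inv_inv, smul_smul,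
      mul_inv_cancel₀ h1.ne', one_smul]

end Box

/-- The characteristic map of the top cell of `S^n × S^n` relative to the diagonal and
a fibre. -/
noncomputable def diagCell (n : ℕ) : C(Ball n × Ball n, Sph n × Sph n) :=
  ⟨fun x => (collapse n x.1, sphRefl n (mirror n x.1, collapse n x.2)), by fun_prop⟩

/-- The reflection is injective and sends the base point to the first coordinate, so the two
coordinates agree only if the second ball coordinate collapses to the base point. -/
lemma diagCell_mem_diagonal {n : ℕ} (x : Ball n × Ball n) :
    (diagCell n x).1 = (diagCell n x).2 ↔ ‖x.2.1‖ = 1 := by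
  change collapse n x.1 = sphRefl n (mirror n x.1, collapse n x.2) ↔ _
  rw [← sphRefl_mirror_basePt, (sphRefl_injective _).eq_iff' rfl, eq_comm, collapse_eq_basePt_iff]

lemma diagCell_inj {n : ℕ} {x y : Ball n × Ball n} (hx : ‖x.1.1‖ ≠ 1) (hx' : ‖x.2.1‖ ≠ 1)
    (h : diagCell n x = diagCell n y) : x = y := by
  have h1 : x.1 = y.1 := collapse_inj hx (congrArg Prod.fst h)
  have h2 : sphRefl n (mirror n x.1, collapse n x.2) =
    sphRefl n (mirror n y.1, collapse n y.2) := congrArg Prod.snd h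
  rw [← h1] at h2
  exact Prod.ext h1 (collapse_inj hx' (sphRefl_injective _ h2))

lemma diagCell_surjective {n : ℕ} (hn : 1 ≤ n) : Function.Surjective (diagCell n) := by
  rintro ⟨x, y⟩
  obtain ⟨a, rfl⟩ := collapse_surjective hn x
  obtain ⟨b, hb⟩ := collapse_surjective hn (sphRefl n (mirror n a, y))
  refine ⟨(a, b), Prod.ext rfl ?_⟩
  change sphRefl n (mirror n a, collapse n b) = y
  rw [hb, sphRefl_sphRefl]

/-- Polar coordinates in `D^n × D^n`. -/
noncomputable def boxPolar (n : ℕ) : C(BallBdry (n + n) × I, Ball n × Ball n) :=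
  ⟨fun x => (ballSmul n (σ x.2, (toBoxBdry n n x.1).fst),
      ballSmul n (σ x.2, (toBoxBdry n n x.1).snd)), by
    have h1 : Continuous fun x : BallBdry (n + n) × I => (toBoxBdry n n x.1).fst :=
      BoxBdry.continuous_fst.comp (by fun_prop)
    have h2 : Continuous fun x : BallBdry (n + n) × I => (toBoxBdry n n x.1).snd :=
      BoxBdry.continuous_snd.comp (by fun_prop)
    fun_prop⟩

lemma boxPolar_val {n : ℕ} (v : BallBdry (n + n)) (u : I) :
    ((boxPolar n (v, u)).1.1, (boxPolar n (v, u)).2.1) =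
      (1 - (u : ℝ)) • (toBoxBdry n n v).1 := rfl

lemma boxPolar_inj {n : ℕ} {v v' : BallBdry (n + n)} {u u' : I}
    (h : boxPolar n (v, u) = boxPolar n (v', u')) : u = u' ∧ (u = 1 ∨ v = v') := by
  have h1 : (1 - (u : ℝ)) • (toBoxBdry n n v).1 = (1 - (u' : ℝ)) • (toBoxBdry n n v').1 := by
    rw [← boxPolar_val, h, boxPolar_val]
  have h2 := congrArg norm h1
  rw [norm_smul, norm_smul, mem_sphere_zero_iff_norm.1 (toBoxBdry n n v).2,
    mem_sphere_zero_iff_norm.1 (toBoxBdry n n v').2, mul_one, mul_one,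
    Real.norm_of_nonneg (sub_nonneg.2 u.2.2), Real.norm_of_nonneg (sub_nonneg.2 u'.2.2)] at h2
  obtain rfl : u = u' := Subtype.ext (by linarith)
  refine ⟨rfl, ?_⟩
  by_cases hu : u = 1
  · exact Or.inl hu
  · refine Or.inr (toBoxBdry_injective n n (Subtype.ext ?_))
    have h3 : (1 - (u : ℝ)) ≠ 0 := fun h => hu (Subtype.ext (by
      rw [Set.Icc.coe_one]; linarith))
    exact smul_right_injective _ h3 h1

lemma boxPolar_fst_eq_one {n : ℕ} {v : BallBdry (n + n)} {u : I}
    (h : ‖(boxPolar n (v, u)).1.1‖ = 1) : u = 0 ∧ ‖(toBoxBdry n n v).fst.1‖ = 1 := by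
  have h0 : (1 - (u : ℝ)) * ‖(toBoxBdry n n v).fst.1‖ = 1 := (norm_ballSmul _ _).symm.trans h
  have h1 := (toBoxBdry n n v).fst.norm_le
  have h2 := mul_nonneg u.2.1 (norm_nonneg (toBoxBdry n n v).fst.1)
  have h3 : ‖(toBoxBdry n n v).fst.1‖ = 1 := by linarith
  rw [h3] at h0
  exact ⟨Subtype.ext (by rw [Set.Icc.coe_zero]; linarith), h3⟩

lemma boxPolar_snd_eq_one {n : ℕ} {v : BallBdry (n + n)} {u : I}
    (h : ‖(boxPolar n (v, u)).2.1‖ = 1) : u = 0 ∧ ‖(toBoxBdry n n v).snd.1‖ = 1 := by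
  have h0 : (1 - (u : ℝ)) * ‖(toBoxBdry n n v).snd.1‖ = 1 := (norm_ballSmul _ _).symm.trans h
  have h1 := (toBoxBdry n n v).snd.norm_le
  have h2 := mul_nonneg u.2.1 (norm_nonneg (toBoxBdry n n v).snd.1)
  have h3 : ‖(toBoxBdry n n v).snd.1‖ = 1 := by linarith
  rw [h3] at h0
  exact ⟨Subtype.ext (by rw [Set.Icc.coe_zero]; linarith), h3⟩

lemma boxPolar_zero {n : ℕ} (v : BallBdry (n + n)) :
    boxPolar n (v, 0) = ((toBoxBdry n n v).fst, (toBoxBdry n n v).snd) := by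
  change (ballSmul n (σ 0, _), ballSmul n (σ 0, _)) = _
  rw [unitInterval.symm_zero, ballSmul_one, ballSmul_one]

lemma boxPolar_surjective {n : ℕ} [Nonempty (BallBdry (n + n))] :
    Function.Surjective (boxPolar n) := by
  rintro ⟨a, b⟩
  suffices h : ∃ v u, (1 - ((u : I) : ℝ)) • (toBoxBdry n n v).1 = (a.1, b.1) by
    obtain ⟨v, u, h⟩ := h
    rw [← boxPolar_val] at h
    exact ⟨(v, u), Prod.ext (Subtype.ext (congrArg Prod.fst h))
      (Subtype.ext (congrArg Prod.snd h))⟩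
  by_cases h0 : (a.1, b.1) = 0
  · obtain ⟨v⟩ := ‹Nonempty (BallBdry (n + n))›
    exact ⟨v, 1, by simp [h0]⟩
  · have h1 := norm_pos_iff.2 h0
    have h2 : ‖(a.1, b.1)‖ ≤ 1 := max_le a.norm_le b.norm_le
    obtain ⟨v, hv⟩ := toBoxBdry_surjective n n ⟨‖(a.1, b.1)‖⁻¹ • (a.1, b.1), by
      rw [mem_sphere_zero_iff_norm, norm_smul, norm_inv, norm_norm, inv_mul_cancel₀ h1.ne']⟩
    refine ⟨v, ⟨1 - ‖(a.1, b.1)‖, by linarith, by linarith⟩, ?_⟩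
    rw [hv]
    simp only
    rw [sub_sub_cancel, smul_smul, mul_inv_cancel₀ h1.ne', one_smul]

/-- The quotient of `S^n × S^n` by the diagonal is `S^n` with a `2n`-cell attached. -/
lemma nonempty_cofibre_diagAttach_homeomorph {n : ℕ} (hn : 1 ≤ n)
    [Nonempty (BallBdry (n + n))] :
    Nonempty (HomotopyCofibre (diagAttach n) ≃ₜ Quot (CollapseRel (diagonal (Sph n)))) := by
  let z : Ball n := ⟨0, by simp⟩
  -- The fibre over the base point is parametrised through a reflection. At the end of `boxHomotopy`
  -- the mirror is `basePt` itself, so the two reflections cancel and the identity appears on that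
  -- half of the Whitehead square.
  let q : Sph n → Sph n × Sph n := fun y => (basePt n, sphRefl n (basePt n, y))
  let p : Sph n ⊕ ((BallBdry (n + n) × I) ⊕ PUnit.{1}) → Sph n × Sph n :=
    Sum.elim q (Sum.elim (fun x => diagCell n (boxPolar n x)) fun _ => diagCell n (z, z))
  have hp : Continuous p := by
    refine Continuous.sumElim ?_ (Continuous.sumElim ?_ continuous_const) <;> fun_prop
  have hs : Function.Surjective p := by
    intro x
    obtain ⟨w, rfl⟩ := diagCell_surjective hn x
    obtain ⟨v, rfl⟩ := boxPolar_surjective w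
    exact ⟨Sum.inr (Sum.inl v), rfl⟩
  have hz : ∀ v, boxPolar n (v, 1) = (z, z) := by
    intro v
    change (ballSmul n (σ 1, _), ballSmul n (σ 1, _)) = _
    rw [unitInterval.symm_one]
    exact Prod.ext (Subtype.ext (ballSmul_zero _)) (Subtype.ext (ballSmul_zero _))
  let mk : Sph n ⊕ ((BallBdry (n + n) × I) ⊕ PUnit.{1}) → HomotopyCofibre (diagAttach n) :=
    Quot.mk _
  -- every point is equivalent to one of the first two kinds
  have hred : ∀ s, ∃ s', p s' = p s ∧ mk s' = mk s ∧
      ((∃ y, s' = Sum.inl y) ∨ ∃ x, s' = Sum.inr (Sum.inl x)) := by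
    rintro (y | x | x)
    · exact ⟨_, rfl, rfl, Or.inl ⟨y, rfl⟩⟩
    · exact ⟨_, rfl, rfl, Or.inr ⟨x, rfl⟩⟩
    · obtain ⟨v⟩ := ‹Nonempty (BallBdry (n + n))›
      exact ⟨Sum.inr (Sum.inl (v, 1)), congrArg (diagCell n) (hz v),
        HomotopyCofibre.cone_one (diagAttach n) v, Or.inr ⟨_, rfl⟩⟩
  have hbd : ∀ v, mk (Sum.inr (Sum.inl (v, 0))) = mk (Sum.inl (diagAttach n v)) :=
    HomotopyCofibre.cone_zero (diagAttach n)
  -- All points over the diagonal already agree in the cofibre of `diagAttach`: each is glued to the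
  -- single diagonal point of the fibre.
  have hdiag : ∀ s, (p s).1 = (p s).2 →
      mk s = mk (Sum.inl (sphRefl n (basePt n, basePt n))) := by
    intro s
    obtain ⟨s', h1, h2, h3⟩ := hred s
    rw [← h1, ← h2]
    rcases h3 with ⟨y, rfl⟩ | ⟨⟨v, u⟩, rfl⟩
    · intro h
      change basePt n = sphRefl n (basePt n, y) at h
      rw [← sphRefl_sphRefl (basePt n) y, ← h]
    · intro h
      obtain ⟨rfl, h4⟩ := boxPolar_snd_eq_one ((diagCell_mem_diagonal _).1 h)
      rw [hbd, ← sphRefl_sphRefl (basePt n) (diagAttach n v), diagAttach_of_snd v h4]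
  have hedge : ∀ v u, ‖(boxPolar n (v, u)).1.1‖ = 1 →
      (p (Sum.inr (Sum.inl (v, u)))).1 ≠ (p (Sum.inr (Sum.inl (v, u)))).2 →
      ∃ y, mk (Sum.inr (Sum.inl (v, u))) = mk (Sum.inl y) ∧
        p (Sum.inl y) = p (Sum.inr (Sum.inl (v, u))) := by
    intro v u h h'
    obtain ⟨rfl, h1⟩ := boxPolar_fst_eq_one h
    have h2 : ‖(toBoxBdry n n v).snd.1‖ ≠ 1 := by
      intro h3
      refine h' ((diagCell_mem_diagonal _).2 ?_)
      rw [boxPolar_zero]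
      exact h3
    refine ⟨diagAttach n v, hbd v, ?_⟩
    change (basePt n, sphRefl n (basePt n, diagAttach n v)) = diagCell n (boxPolar n (v, 0))
    rw [boxPolar_zero, diagAttach_of_fst v h1 h2]
    exact Prod.ext (collapse_bdry _ h1).symm rfl
  have hinl : ∀ y y', p (Sum.inl y) = p (Sum.inl y') → y = y' := fun y y' h =>
    sphRefl_injective _ (congrArg Prod.snd h)
  have hcell : ∀ y v u, p (Sum.inl y) = p (Sum.inr (Sum.inl (v, u))) →
      ‖(boxPolar n (v, u)).1.1‖ = 1 := fun y v u h =>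
    (collapse_eq_basePt_iff _).1 (congrArg Prod.fst h).symm
  -- Off the diagonal, first push cell points with `|a| = 1` into the fibre. What is left lies in
  -- the fibre or in the interior of the cell, and `p` separates these and is injective on each, up
  -- to the choice of direction at the centre.
  have hinj : ∀ s s', (p s).1 ≠ (p s).2 → p s = p s' → mk s = mk s' := by
    intro s s'
    obtain ⟨t, h1, h2, h3⟩ := hred s
    obtain ⟨t', h1', h2', h3'⟩ := hred s'
    rw [← h1, ← h1', ← h2, ← h2']
    intro hd h
    have red : ∀ t, (p t).1 ≠ (p t).2 →
        ((∃ y, t = Sum.inl y) ∨ ∃ x, t = Sum.inr (Sum.inl x)) →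
        ∃ t', p t' = p t ∧ mk t' = mk t ∧ ((∃ y, t' = Sum.inl y) ∨
          ∃ x, t' = Sum.inr (Sum.inl x) ∧ ‖(boxPolar n x).1.1‖ ≠ 1) := by
      rintro t ht (⟨y, rfl⟩ | ⟨⟨v, u⟩, rfl⟩)
      · exact ⟨_, rfl, rfl, Or.inl ⟨y, rfl⟩⟩
      · by_cases h4 : ‖(boxPolar n (v, u)).1.1‖ = 1
        · obtain ⟨y, h5, h6⟩ := hedge v u h4 ht
          exact ⟨_, h6, h5.symm, Or.inl ⟨y, rfl⟩⟩
        · exact ⟨_, rfl, rfl, Or.inr ⟨_, rfl, h4⟩⟩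
    obtain ⟨w, e1, e2, e3⟩ := red t hd h3
    obtain ⟨w', e1', e2', e3'⟩ := red t' (h ▸ hd) h3'
    rw [← e2, ← e2']
    have h7 : p w = p w' := by rw [e1, e1', h]
    rw [← e1] at hd
    rcases e3 with ⟨y, rfl⟩ | ⟨⟨v, u⟩, rfl, hv⟩ <;> rcases e3' with ⟨y', rfl⟩ | ⟨⟨v', u'⟩, rfl, hv'⟩
    · rw [hinl _ _ h7]
    · exact absurd (hcell _ _ _ h7) hv'
    · exact absurd (hcell _ _ _ h7.symm) hv
    · have h8 := diagCell_inj hv (fun h => hd ((diagCell_mem_diagonal _).2 h)) h7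
      obtain ⟨rfl, rfl | rfl⟩ := boxPolar_inj h8
      · exact (HomotopyCofibre.cone_one _ v).trans (HomotopyCofibre.cone_one _ v').symm
      · rfl
  have hrel : ∀ x y : Sph n × Sph n, x.1 = x.2 → y.1 = y.2 →
      Quot.mk (CollapseRel (diagonal (Sph n))) x = Quot.mk _ y := by
    rintro ⟨x, x'⟩ ⟨y, y'⟩ h h'
    obtain rfl : x = x' := h
    obtain rfl : y = y' := h'
    exact Quot.sound ⟨x, y, rfl, rfl⟩
  refine nonempty_homeomorph_quot (IsQuotientMap.of_surjective_continuous hs hp) _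
    (CollapseRel (diagonal (Sph n))) ?_ ?_ ?_
  · rintro _ _ (v | v)
    · by_cases h : ‖(toBoxBdry n n v).snd.1‖ = 1
      · refine hrel _ _ ?_ ?_
        · refine (diagCell_mem_diagonal _).2 ?_
          rw [boxPolar_zero]
          exact h
        · exact (diagAttach_of_snd v h).symm
      · have h1 : ‖(boxPolar n (v, 0)).1.1‖ = 1 := by
          rw [boxPolar_zero]
          by_contra h2
          exact h (BoxBdry.snd_eq_one (by
            by_contra h3
            exact h2 (BoxBdry.fst_eq_one h3)))
        obtain ⟨y, h2, h3⟩ := hedge v 0 h1 (fun h2 => h (by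
          have := (diagCell_mem_diagonal _).1 h2
          rwa [boxPolar_zero] at this))
        congr 1
        rw [← h3]
        have h4 := diagAttach_of_fst v (by rwa [boxPolar_zero] at h1) h
        refine Prod.ext rfl ?_
        rw [h3]
        change (diagCell n (boxPolar n (v, 0))).2 = sphRefl n (basePt n, diagAttach n v)
        rw [h4, boxPolar_zero]
        rfl
    · exact congrArg _ (congrArg (diagCell n) (hz v))
  · intro s s' h
    by_cases hd : (p s).1 = (p s).2
    · exact (hdiag s hd).trans (hdiag s' (h ▸ hd)).symm
    · exact hinj s s' hd h
  · rintro s s' ⟨x, y, hx, hy⟩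
    refine (hdiag s ?_).trans (hdiag s' ?_).symm
    · rw [hx]; rfl
    · rw [hy]; rfl

/-- The homotopy cofibre of the diagonal of `S^n` is `S^n` with a `2n`-cell attached along the
Whitehead square. -/
theorem nonempty_cofibre_diagonal_homotopyEquiv_attachCell {n : ℕ} (hn : 1 ≤ n) :
    Nonempty (ContinuousMap.HomotopyEquiv (HomotopyCofibre (diagonal (Sph n)))
      (AttachCell (whiteheadSquare n))) := by
  have : Nonempty (BallBdry (n + n)) :=
    ⟨⟨EuclideanSpace.single ⟨0, by omega⟩ 1, by simp⟩⟩
  obtain ⟨e1⟩ := nonempty_cofibre_diagonal_homotopyEquiv n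
  obtain ⟨e2⟩ := nonempty_cofibre_diagAttach_homeomorph hn
  obtain ⟨e3⟩ := HomotopyCofibre.nonempty_homotopyEquiv (diagAttach_homotopic n)
  obtain ⟨e4⟩ := nonempty_cofibre_homeomorph_attachCell (whiteheadSquare n)
  exact ⟨((e1.trans e2.symm.toHomotopyEquiv).trans e3).trans e4.toHomotopyEquiv⟩

/-! ### Lifts of the diagonal to fat wedges -/

section Lift

lemma snoc_const {B : Type*} {m : ℕ} (b : B) :
    Fin.snoc (α := fun _ : Fin (m + 1) => B) (fun _ => b) b = fun _ => b := by
  ext i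
  induction i using Fin.lastCases with
  | last => simp
  | cast i => simp

variable {E B : Type u} [TopologicalSpace E] [TopologicalSpace B]

/-- If `f : A → B` lifts to the `m`-th fat wedge over the open set `d₀ > 0` and to `E` over the
open set `d₁ > 0`, and if these sets cover `A`, then `f` lifts to the next fat wedge. -/
lemma exists_lift_fatWedge_succ {A : Type v} [TopologicalSpace A] (p : C(E, B)) (m : ℕ)
    (f : C(A, B)) (d0 d1 : C(A, ℝ)) (h0 : ∀ a, 0 ≤ d0 a) (h1 : ∀ a, 0 ≤ d1 a)
    (hpos : ∀ a, 0 < d0 a + d1 a)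
    (hs : ∃ s : C({a // 0 < d0 a}, (fatWedge p m).Dom),
      ∀ a, (fatWedge p m).map (s a) = fun _ => f a)
    (hσ : ∃ s : C({a // 0 < d1 a}, E), ∀ a, p (s a) = f a) :
    ∃ s : C(A, (fatWedge p (m + 1)).Dom), ∀ a, (fatWedge p (m + 1)).map (s a) = fun _ => f a := by
  obtain ⟨s, hs⟩ := hs
  obtain ⟨r, hr⟩ := hσ
  let κ := prodId (fatWedge p m).map
  let ι := idProd p (m + 1)
  -- The cylinder coordinate is `3τ - 1` clamped to the unit interval. The lift thus sits at an end
  -- of the join before either local lift ceases to be defined, which gives continuity there.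
  let τ : A → ℝ := fun a => d1 a / (d0 a + d1 a)
  have hτ : Continuous τ := d1.continuous.div (by fun_prop) fun a => (hpos a).ne'
  have hτ0 : ∀ a, τ a < 2 / 3 → 0 < d0 a := by
    intro a ha
    rw [div_lt_iff₀ (hpos a)] at ha
    linarith [h0 a, h1 a, hpos a]
  have hτ1 : ∀ a, 1 / 3 < τ a → 0 < d1 a := by
    intro a ha
    rw [lt_div_iff₀ (hpos a)] at ha
    linarith [h0 a, h1 a, hpos a]
  have hκ : ∀ a : {a // 0 < d0 a}, κ (s a, f a) = fun _ => f a := fun a => by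
    change Fin.snoc (α := fun _ => B) ((fatWedge p m).map (s a)) (f a) = _
    rw [hs, snoc_const]
  have hι : ∀ a : {a // 0 < d1 a}, ι ((fun _ => f a), r a) = fun _ => f a := fun a => by
    change Fin.snoc (α := fun _ => B) (fun _ => f a) (p (r a)) = _
    rw [hr, snoc_const]
  let pt : {a // 0 < d0 a ∧ 0 < d1 a} → HomotopyPullback κ ι := fun a =>
    ⟨((s ⟨a, a.2.1⟩, f a), ContinuousMap.const I (fun _ => f a), ((fun _ => f a), r ⟨a, a.2.2⟩)),
      (hκ ⟨a, a.2.1⟩).symm, (hι ⟨a, a.2.2⟩).symm⟩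
  have hpt : Continuous pt := by
    refine Continuous.subtype_mk ?_ _
    refine Continuous.prodMk ?_ (Continuous.prodMk ?_ ?_)
    · exact (s.continuous.comp (by fun_prop)).prodMk (by fun_prop)
    · exact ContinuousMap.continuous_const'.comp (by fun_prop)
    · exact Continuous.prodMk (by fun_prop) (r.continuous.comp (by fun_prop))
  let S : A → Join κ ι := fun a =>
    if h : 0 < d0 a then
      if h' : 0 < d1 a then
        HomotopyPushout.cyl _ _ (pt ⟨a, h, h'⟩, Set.projIcc 0 1 zero_le_one (3 * τ a - 1))
      else HomotopyPushout.inl _ _ (s ⟨a, h⟩, f a)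
    else if h' : 0 < d1 a then HomotopyPushout.inr _ _ ((fun _ => f a), r ⟨a, h'⟩)
    -- This branch is never reached, since the two functions have positive sum.
    else HomotopyPushout.inl _ _ (s ⟨a, by linarith [hpos a, h0 a, h1 a]⟩, f a)
  have hS0 : ∀ a (h : τ a < 1 / 3), S a = HomotopyPushout.inl _ _
      (s ⟨a, hτ0 a (by linarith)⟩, f a) := by
    intro a h
    simp only [S, dif_pos (hτ0 a (by linarith))]
    split_ifs with h'
    · rw [Set.projIcc_of_le_left _ (by linarith)]
      exact HomotopyPushout.cyl_zero _ _ _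
    · rfl
  have hS1 : ∀ a (h : 2 / 3 < τ a), S a = HomotopyPushout.inr _ _
      ((fun _ => f a), r ⟨a, hτ1 a (by linarith)⟩) := by
    intro a h
    simp only [S, dif_pos (hτ1 a (by linarith))]
    split_ifs with h'
    · rw [Set.projIcc_of_right_le _ (by linarith)]
      exact HomotopyPushout.cyl_one _ _ _
    · rfl
  have hS2 : ∀ a : {a // 0 < d0 a ∧ 0 < d1 a}, S a =
      HomotopyPushout.cyl _ _ (pt a, Set.projIcc 0 1 zero_le_one (3 * τ a - 1)) := by
    intro a
    simp only [S, dif_pos a.2.1, dif_pos a.2.2]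
  have hS : Continuous S := by
    rw [continuous_iff_continuousAt]
    intro a
    have key : ∀ U : Set A, IsOpen U → a ∈ U → Continuous (U.domRestrict S) → ContinuousAt S a :=
      fun U hU ha hc => (continuousOn_iff_continuous_domRestrict.2 hc).continuousAt (hU.mem_nhds ha)
    rcases lt_or_ge (τ a) (1 / 3) with h | h
    · refine key {a | τ a < 1 / 3} (isOpen_lt hτ continuous_const) h ?_
      have : Set.domRestrict {a | τ a < 1 / 3} S =
          fun a : {a | τ a < 1 / 3} => HomotopyPushout.inl _ _
          (s ⟨a, hτ0 a (by linarith [show τ a < 1 / 3 from a.2])⟩, f a) :=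
        funext fun a => hS0 a a.2
      rw [this]
      exact (HomotopyPushout.inl _ _).continuous.comp
        ((s.continuous.comp (by fun_prop)).prodMk (by fun_prop))
    rcases lt_or_ge (2 / 3) (τ a) with h' | h'
    · refine key {a | 2 / 3 < τ a} (isOpen_lt continuous_const hτ) h' ?_
      have : Set.domRestrict {a | 2 / 3 < τ a} S =
          fun a : {a | 2 / 3 < τ a} => HomotopyPushout.inr _ _
          ((fun _ => f a), r ⟨a, hτ1 a (by linarith [show 2 / 3 < τ a from a.2])⟩) :=
        funext fun a => hS1 a a.2
      rw [this]
      exact (HomotopyPushout.inr _ _).continuous.comp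
        (Continuous.prodMk (by fun_prop) (r.continuous.comp (by fun_prop)))
    · refine key {a | 0 < d0 a ∧ 0 < d1 a} ((isOpen_lt continuous_const d0.continuous).inter
        (isOpen_lt continuous_const d1.continuous)) ?_ ?_
      · have h2 : τ a * (d0 a + d1 a) = d1 a := div_mul_cancel₀ _ (hpos a).ne'
        constructor
        · nlinarith [hpos a]
        · nlinarith [hpos a]
      · have : Set.domRestrict {a | 0 < d0 a ∧ 0 < d1 a} S = fun a =>
            HomotopyPushout.cyl _ _ (pt a, Set.projIcc 0 1 zero_le_one (3 * τ a - 1)) :=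
          funext fun a => hS2 a
        rw [this]
        exact (HomotopyPushout.cyl _ _).continuous.comp
          (hpt.prodMk (continuous_projIcc.comp (by fun_prop)))
  refine ⟨⟨S, hS⟩, fun a => ?_⟩
  change joinMap κ ι (S a) = _
  by_cases h : 0 < d0 a
  · by_cases h' : 0 < d1 a
    · rw [hS2 ⟨a, h, h'⟩]
      rfl
    · simp only [S, dif_pos h, dif_neg h']
      exact hκ ⟨a, h⟩
  · have h' : 0 < d1 a := by linarith [hpos a]
    simp only [S, dif_neg h, dif_pos h']
    exact hι ⟨a, h'⟩

/-- The diagonal factors through the fat wedge, whose composite with the inclusion contracts along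
the cone. -/
lemma nullhomotopic_of_lift (p : C(E, B)) (m : ℕ)
    (h : ∃ s : C(B, (fatWedge p m).Dom), ∀ b, (fatWedge p m).map (s b) = fun _ => b) :
    ((HomotopyCofibre.incl (fatWedge p m).map).comp (diagPow B (m + 1))).Nullhomotopic := by
  obtain ⟨s, hs⟩ := h
  have h1 : diagPow B (m + 1) = (fatWedge p m).map.comp s := ContinuousMap.ext fun b => (hs b).symm
  rw [h1, ← ContinuousMap.comp_assoc]
  exact (HomotopyCofibre.incl_comp_nullhomotopic _).comp_left s

end Lift

/-! ### Motion planning on spheres -/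

section Planning

variable {n : ℕ}

/-- Paths from `x` to `y` which pass through an intermediate point that is antipodal to neither
of them may be chosen continuously. -/
lemma exists_path_section {A : Type*} [TopologicalSpace A] (x w y : C(A, Sph n))
    (hxw : ∀ a, (x a).1 + (w a).1 ≠ 0) (hwy : ∀ a, (w a).1 + (y a).1 ≠ 0) :
    ∃ s : C(A, C(I, Sph n)), ∀ a, pathFibration (Sph n) (s a) = (x a, y a) := by
  -- The broken chord from `x` to `w` to `y`, traversed with `w` at time 1/2. Neither segment meets
  -- the origin, so it can be projected to the sphere.
  let g : A × I → EuclideanSpace ℝ (Fin (n + 1)) := fun z =>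
    max 0 (1 - 2 * (z.2 : ℝ)) • (x z.1).1 + min (2 * (z.2 : ℝ)) (2 - 2 * (z.2 : ℝ)) • (w z.1).1 +
      max 0 (2 * (z.2 : ℝ) - 1) • (y z.1).1
  have hg : Continuous g := by fun_prop
  have hg0 : ∀ z, g z ≠ 0 := by
    rintro ⟨a, t⟩
    have ht0 := t.2.1
    have ht1 := t.2.2
    simp only [g]
    rcases le_total (t : ℝ) (1 / 2) with h | h
    · rw [max_eq_right (by linarith), min_eq_left (by linarith),
        max_eq_left (by linarith : 2 * (t : ℝ) - 1 ≤ 0), zero_smul, add_zero]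
      exact smul_add_smul_ne_zero (by linarith) (by linarith) (by linarith) fun _ => hxw a
    · rw [max_eq_left (by linarith), min_eq_right (by linarith),
        max_eq_right (by linarith : 0 ≤ 2 * (t : ℝ) - 1), zero_smul, zero_add]
      exact smul_add_smul_ne_zero (by linarith) (by linarith) (by linarith) fun _ => hwy a
  refine ⟨ContinuousMap.curry ⟨fun z => toSph (g z), Continuous.toSph hg hg0⟩, fun a => ?_⟩
  refine Prod.ext ?_ ?_
  · change toSph (g (a, 0)) = x a
    have : g (a, 0) = (x a).1 := by simp [g]
    rw [this, toSph_self]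
  · change toSph (g (a, 1)) = y a
    have : g (a, 1) = (y a).1 := by
      simp only [g, Set.Icc.coe_one]
      norm_num
    rw [this, toSph_self]

/-- The sign `1` on the first half of the coordinates (with the middle one) and `-1` on
the second half. -/
def halfSign (i : Fin (n + 1)) : ℝ := if i ≤ i.rev then 1 else -1

lemma halfSign_mul_self (i : Fin (n + 1)) : halfSign i * halfSign i = 1 := by
  rw [halfSign]; split_ifs <;> norm_num

lemma halfSign_mul_rev (i : Fin (n + 1)) (h : i ≠ i.rev) : halfSign i * halfSign i.rev = -1 := by
  rw [halfSign, halfSign, Fin.rev_rev]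
  rcases lt_or_gt_of_ne h with h | h
  · rw [if_pos h.le, if_neg (not_le.2 h)]; norm_num
  · rw [if_neg (not_le.2 h), if_pos h.le]; norm_num

/-- The isometry `v ↦ (± v_{n-i})_i` of `ℝ^(n+1)`. It is a complex structure if `n` is odd. -/
noncomputable def twist (n : ℕ) :
    EuclideanSpace ℝ (Fin (n + 1)) →L[ℝ] EuclideanSpace ℝ (Fin (n + 1)) :=
  LinearMap.toContinuousLinearMap
    { toFun := fun v => WithLp.toLp 2 fun i => halfSign i * v i.rev
      map_add' := fun v w => by ext i; simp [mul_add]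
      map_smul' := fun c v => by ext i; simp [mul_left_comm] }

lemma twist_apply (v : EuclideanSpace ℝ (Fin (n + 1))) (i : Fin (n + 1)) :
    twist n v i = halfSign i * v i.rev := rfl

lemma norm_twist (v : EuclideanSpace ℝ (Fin (n + 1))) : ‖twist n v‖ = ‖v‖ := by
  rw [← sq_eq_sq₀ (norm_nonneg _) (norm_nonneg _), EuclideanSpace.real_norm_sq_eq,
    EuclideanSpace.real_norm_sq_eq, ← Equiv.sum_comp Fin.revPerm]
  refine Finset.sum_congr rfl fun i _ => ?_
  rw [twist_apply, mul_pow, sq (halfSign _), halfSign_mul_self, one_mul, Fin.revPerm_apply,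
    Fin.rev_rev]

lemma twist_twist_apply (v : EuclideanSpace ℝ (Fin (n + 1))) {i : Fin (n + 1)} (h : i ≠ i.rev) :
    twist n (twist n v) i = - v i := by
  rw [twist_apply, twist_apply, Fin.rev_rev, ← mul_assoc, halfSign_mul_rev i h, neg_one_mul]

lemma ne_rev_of_odd (hn : Odd n) (i : Fin (n + 1)) : i ≠ i.rev := by
  intro h
  have h1 := congrArg Fin.val h
  rw [Fin.val_rev] at h1
  obtain ⟨k, hk⟩ := hn
  omega

/-- The twist of the sphere. -/
noncomputable def sphTwist (n : ℕ) : C(Sph n, Sph n) where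
  toFun x := ⟨twist n x.1, by rw [mem_sphere_zero_iff_norm, norm_twist, x.norm_coe]⟩
  continuous_toFun := Continuous.subtype_mk (by fun_prop) _

lemma twist_twist_of_odd (hn : Odd n) (v : EuclideanSpace ℝ (Fin (n + 1))) :
    twist n (twist n v) = -v := by
  ext i
  exact twist_twist_apply v (ne_rev_of_odd hn i)

/-- An eigenvalue `c` with `c² = 1` would contradict that the square of the twist is `-1`. -/
lemma twist_ne_of_odd (hn : Odd n) {v : EuclideanSpace ℝ (Fin (n + 1))} (hv : v ≠ 0) {c : ℝ}
    (hc : c * c = 1) (h : twist n v = c • v) : False := by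
  have h1 := twist_twist_of_odd hn v
  rw [h, map_smul, h, smul_smul, hc, one_smul] at h1
  have h2 : (2 : ℝ) • v = 0 := by rw [two_smul]; nth_rewrite 1 [h1]; simp
  exact hv ((smul_eq_zero.1 h2).resolve_left two_ne_zero)

lemma Sph.add_self_ne_zero (x : Sph n) : x.1 + x.1 ≠ 0 := by
  rw [← two_smul ℝ]
  exact smul_ne_zero two_ne_zero x.coe_ne_zero

/-- Two planners suffice: go straight from `x` to `y` unless they are antipodal, or pass through the
twist `Ty` unless it is antipodal to `x`. Both fail only if `y = Ty`, and `Ty = -y` is likewise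
impossible. -/
lemma nullhomotopic_of_odd (hn : Odd n) :
    ((HomotopyCofibre.incl (fatWedge (pathFibration (Sph n)) 1).map).comp
      (diagPow (Sph n × Sph n) 2)).Nullhomotopic := by
  refine nullhomotopic_of_lift _ _ ?_
  let d0 : C(Sph n × Sph n, ℝ) := ⟨fun z => ‖z.1.1 + z.2.1‖, by fun_prop⟩
  let d1 : C(Sph n × Sph n, ℝ) := ⟨fun z => ‖z.1.1 + (sphTwist n z.2).1‖, by fun_prop⟩
  refine exists_lift_fatWedge_succ _ 0 (ContinuousMap.id _) d0 d1
    (fun z => norm_nonneg (z.1.1 + z.2.1))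
    (fun z => norm_nonneg (z.1.1 + (sphTwist n z.2).1)) ?_ ?_ ?_
  · intro z
    by_contra h
    have h1 : ‖z.1.1 + z.2.1‖ = 0 :=
      le_antisymm (by linarith [norm_nonneg (z.1.1 + (sphTwist n z.2).1),
        show ¬ 0 < ‖z.1.1 + z.2.1‖ + ‖z.1.1 + (sphTwist n z.2).1‖ from h]) (norm_nonneg _)
    have h2 : ‖z.1.1 + (sphTwist n z.2).1‖ = 0 :=
      le_antisymm (by linarith [norm_nonneg (z.1.1 + z.2.1),
        show ¬ 0 < ‖z.1.1 + z.2.1‖ + ‖z.1.1 + (sphTwist n z.2).1‖ from h]) (norm_nonneg _)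
    refine twist_ne_of_odd hn (c := 1) z.2.coe_ne_zero (by norm_num) ?_
    have h3 := (norm_eq_zero.1 h1).trans (norm_eq_zero.1 h2).symm
    rw [one_smul]
    exact (add_left_cancel h3).symm
  · obtain ⟨s, hs⟩ := exists_path_section (A := {a // 0 < d0 a})
      ⟨fun a => a.1.1, by fun_prop⟩ ⟨fun a => a.1.1, by fun_prop⟩ ⟨fun a => a.1.2, by fun_prop⟩
      (fun a => a.1.1.add_self_ne_zero) (fun a => norm_pos_iff.1 a.2)
    exact ⟨s, fun a => funext fun _ => hs a⟩
  · exact exists_path_section (A := {a // 0 < d1 a})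
      ⟨fun a => a.1.1, by fun_prop⟩ ⟨fun a => sphTwist n a.1.2, by fun_prop⟩
      ⟨fun a => a.1.2, by fun_prop⟩ (fun a => norm_pos_iff.1 a.2) (fun a h =>
        twist_ne_of_odd hn (c := -1) a.1.2.coe_ne_zero (by norm_num) (by
          rw [neg_one_smul]; exact eq_neg_of_add_eq_zero_left h))

/-- The standard unit vectors. -/
noncomputable def sphBasis (i : Fin (n + 1)) : Sph n := ⟨EuclideanSpace.single i 1, by simp⟩

/-- Three planners: straight, through `e`, and through `e'`. For an antipodal pair, passing through
`e` fails only if `x = ±e`, so independent `e` and `e'` leave nothing uncovered. -/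
lemma nullhomotopic_two (hn : 1 ≤ n) :
    ((HomotopyCofibre.incl (fatWedge (pathFibration (Sph n)) 2).map).comp
      (diagPow (Sph n × Sph n) 3)).Nullhomotopic := by
  refine nullhomotopic_of_lift _ _ ?_
  let e : Sph n := sphBasis 0
  let e' : Sph n := sphBasis (Fin.last n)
  have he : e'.1 ≠ e.1 ∧ e'.1 ≠ - e.1 := by
    have h0 : Fin.last n ≠ 0 := fun h => by
      have := congrArg Fin.val h
      simp at this; omega
    constructor <;> intro h <;>
    · have := congrArg (fun v : EuclideanSpace ℝ (Fin (n + 1)) => v (Fin.last n)) h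
      simp [e, e', sphBasis, h0] at this
  let d0 : C(Sph n × Sph n, ℝ) := ⟨fun z => ‖z.1.1 + z.2.1‖, by fun_prop⟩
  let d (w : Sph n) : C(Sph n × Sph n, ℝ) := ⟨fun z => ‖z.1.1 + w.1‖ * ‖w.1 + z.2.1‖, by fun_prop⟩
  have hd0 : ∀ z, 0 ≤ d0 z := fun z => norm_nonneg (z.1.1 + z.2.1)
  have hd : ∀ w z, 0 ≤ d w z := fun w z => mul_nonneg (norm_nonneg _) (norm_nonneg _)
  have hw : ∀ w (a : {a // 0 < d w a}), a.1.1.1 + w.1 ≠ 0 ∧ w.1 + a.1.2.1 ≠ 0 := fun w a =>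
    ⟨fun h => a.2.ne' (by simp [d, h]), fun h => a.2.ne' (by simp [d, h])⟩
  refine exists_lift_fatWedge_succ _ 1 (ContinuousMap.id _) (d0 + d e) (d e')
    (fun z => add_nonneg (hd0 z) (hd e z)) (hd e') ?_ ?_ ?_
  · intro z
    by_contra h
    have h' : d0 z + d e z + d e' z ≤ 0 := not_lt.1 h
    have h1 : z.1.1 + z.2.1 = 0 := norm_eq_zero.1
      (le_antisymm (show d0 z ≤ 0 by linarith [hd e z, hd e' z]) (hd0 z))
    have h2 := mul_eq_zero.1 (le_antisymm (show d e z ≤ 0 by linarith [hd0 z, hd e' z]) (hd e z))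
    have h3 := mul_eq_zero.1 (le_antisymm (show d e' z ≤ 0 by linarith [hd0 z, hd e z]) (hd e' z))
    have hy := eq_neg_of_add_eq_zero_right h1
    rw [norm_eq_zero, norm_eq_zero, hy] at h2 h3
    rcases h2 with h2 | h2 <;> rcases h3 with h3 | h3
    · exact he.1 (add_left_cancel (h3.trans h2.symm))
    · exact he.2 (by rw [eq_neg_of_add_eq_zero_left h3, eq_neg_of_add_eq_zero_left h2, neg_neg])
    · exact he.2 (by rw [eq_neg_of_add_eq_zero_right h3, eq_neg_of_add_eq_zero_left h2, neg_neg])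
    · exact he.1 (add_right_cancel (h3.trans h2.symm))
  · refine exists_lift_fatWedge_succ (A := {z // 0 < (d0 + d e) z}) _ 0
      ⟨fun a => a.1, by fun_prop⟩ (d0.restrict {z | 0 < (d0 + d e) z})
      ((d e).restrict {z | 0 < (d0 + d e) z})
      (fun z => hd0 z.1) (fun z => hd e z.1) (fun z => z.2) ?_ ?_
    · obtain ⟨s, hs⟩ := exists_path_section
        (A := {a : {z // 0 < (d0 + d e) z} // 0 < d0.restrict {z | 0 < (d0 + d e) z} a})
        ⟨fun a => a.1.1.1, by fun_prop⟩ ⟨fun a => a.1.1.1, by fun_prop⟩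
        ⟨fun a => a.1.1.2, by fun_prop⟩
        (fun a => a.1.1.1.add_self_ne_zero) (fun a => norm_pos_iff.1 a.2)
      exact ⟨s, fun a => funext fun _ => hs a⟩
    · exact exists_path_section
        (A := {a : {z // 0 < (d0 + d e) z} // 0 < (d e).restrict {z | 0 < (d0 + d e) z} a})
        ⟨fun a => a.1.1.1, by fun_prop⟩ (ContinuousMap.const _ e) ⟨fun a => a.1.1.2, by fun_prop⟩
        (fun a => (hw e ⟨a.1.1, a.2⟩).1) (fun a => (hw e ⟨a.1.1, a.2⟩).2)
  · exact exists_path_section (A := {a // 0 < d e' a})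
      ⟨fun a => a.1.1, by fun_prop⟩ (ContinuousMap.const _ e') ⟨fun a => a.1.2, by fun_prop⟩
      (fun a => (hw e' a).1) (fun a => (hw e' a).2)

end Planning

/-! ### Maps out of the cofibres of the first two fat wedges -/

section Extension

variable {X : Type u} {Z : Type v} [TopologicalSpace X] [TopologicalSpace Z]

/-- A map on `X × X` which is constant on the diagonal factors through the cofibre of the path
fibration. -/
lemma nullhomotopic_of_const_on_diagonal (Ψ : C(X × X, Z)) (z0 : Z) (h : ∀ x, Ψ (x, x) = z0)
    (hn : ((HomotopyCofibre.incl (fatWedge (pathFibration X) 0).map).comp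
      (diagPow (X × X) 1)).Nullhomotopic) : Ψ.Nullhomotopic := by
  let Φ : C(HomotopyCofibre (fatWedge (pathFibration X) 0).map, Z) :=
    HomotopyPushout.desc _ _ ⟨fun g => Ψ (g 0), by fun_prop⟩
      -- Shrinking a path to its initial point moves its pair of end points into the diagonal.
      ⟨fun z : C(I, X) × I => Ψ (z.1 0, z.1 (σ z.2)), by fun_prop⟩
      (ContinuousMap.const _ z0)
      (fun l : C(I, X) => by
        change Ψ (l 0, l (σ 0)) = Ψ (l 0, l 1)
        rw [unitInterval.symm_zero])
      (fun l : C(I, X) => by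
        change Ψ (l 0, l (σ 1)) = z0
        rw [unitInterval.symm_one, h])
  exact hn.comp_right Φ

/-- A path `e` in `X` together with a path in `X × X` which starts at the end points of `e`. -/
def LiftData (X : Type u) [TopologicalSpace X] : Type u :=
  {z : C(I, X) × C(I, X × X) // z.2 0 = (z.1 0, z.1 1)}

instance : TopologicalSpace (LiftData X) :=
  inferInstanceAs (TopologicalSpace {z : C(I, X) × C(I, X × X) // z.2 0 = (z.1 0, z.1 1)})

lemma LiftData.continuous_val :
    Continuous (Subtype.val : LiftData X → C(I, X) × C(I, X × X)) :=
  continuous_subtype_val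

/-- The path from the point `γ t` to the diagonal which runs back along `γ` and then
contracts `e`. -/
noncomputable def slide (X : Type u) [TopologicalSpace X] : C(LiftData X × (I × I), X × X) where
  -- The whole motion has length `1 + t`: `t` back along the second path to its start, then 1 to
  -- shrink the path `e`. The parameter `s` runs through it at constant speed.
  toFun z := if (z.2.2 : ℝ) * (1 + z.2.1) ≤ z.2.1 then
      z.1.1.2 (Set.projIcc 0 1 zero_le_one (z.2.1 - z.2.2 * (1 + z.2.1) : ℝ))
    else (z.1.1.1 0, z.1.1.1
      (Set.projIcc 0 1 zero_le_one (1 - (z.2.2 * (1 + z.2.1) - z.2.1) : ℝ)))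
  continuous_toFun := by
    have h1 : Continuous fun z : LiftData X × (I × I) => z.1.1.1 :=
      continuous_fst.comp (LiftData.continuous_val.comp continuous_fst)
    have h2 : Continuous fun z : LiftData X × (I × I) => z.1.1.2 :=
      continuous_snd.comp (LiftData.continuous_val.comp continuous_fst)
    refine Continuous.if_le ?_ ?_ (by fun_prop) (by fun_prop) ?_
    · exact h2.eval (continuous_projIcc.comp (by fun_prop))
    · exact (h1.eval continuous_const).prodMk (h1.eval (continuous_projIcc.comp (by fun_prop)))
    · intro z hz
      rw [hz, sub_self, sub_zero, Set.projIcc_left, Set.projIcc_right]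
      exact z.1.2

lemma slide_apply (z : LiftData X) (t s : I) :
    slide X (z, (t, s)) = if (s : ℝ) * (1 + t) ≤ t then
      z.1.2 (Set.projIcc 0 1 zero_le_one (t - s * (1 + t) : ℝ))
    else (z.1.1 0, z.1.1 (Set.projIcc 0 1 zero_le_one (1 - (s * (1 + t) - t) : ℝ))) := rfl

lemma slide_zero_right (z : LiftData X) (t : I) : slide X (z, (t, 0)) = z.1.2 t := by
  rw [slide_apply, if_pos (by simpa using t.2.1)]
  simp

lemma slide_zero_left (z : LiftData X) (s : I) :
    slide X (z, (0, s)) = (z.1.1 0, z.1.1 (σ s)) := by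
  have h1 : Set.projIcc 0 1 zero_le_one (1 - (s : ℝ)) = σ s :=
    Set.projIcc_of_mem _ (σ s).2
  rw [slide_apply]
  by_cases hs : (s : ℝ) ≤ 0
  · obtain rfl : s = 0 := Subtype.ext (le_antisymm hs s.2.1)
    rw [if_pos (by simp)]
    simpa using z.2
  · rw [if_neg (by simpa using hs)]
    simp [h1]

lemma slide_one_right (z : LiftData X) (t : I) : slide X (z, (t, 1)) = (z.1.1 0, z.1.1 0) := by
  rw [slide_apply, if_neg (by simp)]
  simp

variable (X) in
/-- The join whose join map is the first fat wedge of the path fibration. -/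
abbrev PathJoin : Type u :=
  Join (prodId (fatWedge (pathFibration X) 0).map) (idProd (pathFibration X) 1)

variable (X) in
/-- The homotopy pullback which underlies the first fat wedge of the path fibration. -/
abbrev PathPullback : Type u :=
  HomotopyPullback (prodId (fatWedge (pathFibration X) 0).map) (idProd (pathFibration X) 1)

/-- The lifting data at the left end of the join. -/
def leftData : C(PathPullback X, LiftData X) where
  toFun x := ⟨(x.1.1.1, (ContinuousMap.mk fun g : Fin 2 → X × X => g 0).comp x.1.2.1), by
    change x.1.2.1 0 0 = _
    rw [x.2.1]
    rfl⟩
  continuous_toFun := by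
    refine Continuous.subtype_mk (Continuous.prodMk ?_ ?_) _
    · exact (continuous_fst.comp continuous_fst).comp continuous_subtype_val
    · exact (ContinuousMap.continuous_postcomp _).comp
        ((continuous_fst.comp continuous_snd).comp continuous_subtype_val)

/-- The lifting data at the right end of the join. -/
def rightData : C(PathPullback X, LiftData X) where
  toFun x := ⟨(x.1.2.2.2, ((ContinuousMap.mk fun g : Fin 2 → X × X => g 1).comp x.1.2.1).comp
      ⟨σ, by fun_prop⟩), by
    change x.1.2.1 (σ 0) 1 = _
    rw [unitInterval.symm_zero, x.2.2]
    rfl⟩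
  continuous_toFun := by
    refine Continuous.subtype_mk (Continuous.prodMk ?_ ?_) _
    · exact (continuous_snd.comp (continuous_snd.comp continuous_snd)).comp continuous_subtype_val
    · exact (ContinuousMap.continuous_precomp _).comp ((ContinuousMap.continuous_postcomp _).comp
        ((continuous_fst.comp continuous_snd).comp continuous_subtype_val))

lemma leftData_snd (x : PathPullback X) (t : I) : (leftData x).1.2 t = x.1.2.1 t 0 := rfl

lemma rightData_snd (x : PathPullback X) (t : I) : (rightData x).1.2 t = x.1.2.1 (σ t) 1 := rfl

/-- A map on `(X × X) × (X × X)` which is constant where one of the coordinates lies in the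
diagonal factors through the cofibre of the first fat wedge of the path fibration. -/
lemma nullhomotopic_of_const_on_diagonals (Ψ : C((X × X) × (X × X), Z)) (z0 : Z)
    (h1 : ∀ x b, Ψ ((x, x), b) = z0) (h2 : ∀ b x, Ψ (b, (x, x)) = z0)
    (hn : ((HomotopyCofibre.incl (fatWedge (pathFibration X) 1).map).comp
      (diagPow (X × X) 2)).Nullhomotopic) :
    (Ψ.comp (diagonal (X × X))).Nullhomotopic := by
  -- At the left end of the join only the first pair slides, at the right end only the second. At
  -- the final time the first has arrived in its diagonal if `t ≤ 1/2` and the second if `t ≥ 1/2`,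
  -- so `Ψ` is constant in either case.
  let s1 : C((PathPullback X × I) × I, I) :=
    ⟨fun z => Set.projIcc 0 1 zero_le_one (min (z.2 : ℝ) (2 * (1 - z.1.2))),
      continuous_projIcc.comp (by fun_prop)⟩
  let s2 : C((PathPullback X × I) × I, I) :=
    ⟨fun z => Set.projIcc 0 1 zero_le_one (min (z.2 : ℝ) (2 * z.1.2)),
      continuous_projIcc.comp (by fun_prop)⟩
  have s1_def : ∀ x t s, s1 ((x, t), s) =
    Set.projIcc 0 1 zero_le_one (min (s : ℝ) (2 * (1 - t))) := fun _ _ _ => rfl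
  have s2_def : ∀ x t s, s2 ((x, t), s) =
    Set.projIcc 0 1 zero_le_one (min (s : ℝ) (2 * t)) := fun _ _ _ => rfl
  let c : C((PathPullback X × I) × I, Z) :=
    ⟨fun z => Ψ (slide X (leftData z.1.1, (z.1.2, s1 z)),
      slide X (rightData z.1.1, (σ z.1.2, s2 z))), by fun_prop⟩
  have c_def : ∀ x t s, c ((x, t), s) = Ψ (slide X (leftData x, (t, s1 ((x, t), s))),
      slide X (rightData x, (σ t, s2 ((x, t), s)))) := fun _ _ _ => rfl
  let f : C((C(I, X) × (X × X)) × I, Z) :=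
    ⟨fun z => Ψ ((z.1.1 0, z.1.1 (σ z.2)), z.1.2), by fun_prop⟩
  let g : C(((Fin 1 → X × X) × C(I, X)) × I, Z) :=
    ⟨fun z => Ψ (z.1.1 0, (z.1.2 0, z.1.2 (σ z.2))), by fun_prop⟩
  let J : C(PathJoin X, C(I, Z)) := HomotopyPushout.desc _ _ f.curry c.curry g.curry
    (fun x => by
      ext s
      change c ((x, 0), s) = f (x.1.1, s)
      rw [c_def, s1_def, s2_def, slide_zero_left, Set.Icc.coe_zero, sub_zero, mul_zero,
        min_eq_left (by linarith [s.2.2]), min_eq_right s.2.1, Set.projIcc_val, Set.projIcc_left]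
      refine congrArg (fun b => Ψ (_, b)) ((slide_zero_right _ _).trans ?_)
      rw [rightData_snd, unitInterval.symm_symm, x.2.1]
      rfl)
    (fun x => by
      ext s
      change c ((x, 1), s) = g (x.1.2.2, s)
      rw [c_def, s1_def, s2_def, unitInterval.symm_one, slide_zero_left, Set.Icc.coe_one, sub_self,
        mul_zero, mul_one, min_eq_right s.2.1, min_eq_left (by linarith [s.2.2]), Set.projIcc_val,
        Set.projIcc_left]
      refine congrArg (fun b => Ψ (b, _)) ((slide_zero_right _ _).trans ?_)
      rw [leftData_snd, x.2.2]
      rfl)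
  let Φ : C(HomotopyCofibre (fatWedge (pathFibration X) 1).map, Z) :=
    HomotopyPushout.desc _ _ ⟨fun g => Ψ (g 0, g 1), by fun_prop⟩
      ⟨fun z : PathJoin X × I => J z.1 z.2,
        (J.continuous.comp continuous_fst).eval continuous_snd⟩
      (ContinuousMap.const _ z0)
      (fun l : PathJoin X => by
        induction l using HomotopyPushout.ind with
        | hl x =>
          let e : C(I, X) := x.1
          change Ψ ((e 0, e (σ 0)), x.2) = Ψ ((e 0, e 1), x.2)
          rw [unitInterval.symm_zero]
        | hc x t =>
          change c ((x, t), 0) = Ψ (x.1.2.1 t 0, x.1.2.1 t 1)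
          rw [c_def, s1_def, s2_def, Set.Icc.coe_zero,
            min_eq_left (by linarith [t.2.2]), min_eq_left (by linarith [t.2.1]),
            Set.projIcc_left]
          refine congrArg Ψ (Prod.ext (slide_zero_right _ _) ((slide_zero_right _ _).trans ?_))
          rw [rightData_snd, unitInterval.symm_symm]
        | hr x =>
          change Ψ (x.1 0, (x.2 0, x.2 (σ 0))) = Ψ (x.1 0, (x.2 0, x.2 1))
          rw [unitInterval.symm_zero])
      (fun l : PathJoin X => by
        change J l 1 = z0
        induction l using HomotopyPushout.ind with
        | hl x =>
          let e : C(I, X) := x.1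
          change Ψ ((e 0, e (σ 1)), x.2) = z0
          rw [unitInterval.symm_one, h1]
        | hc x t =>
          change c ((x, t), 1) = z0
          rw [c_def, s1_def, s2_def, Set.Icc.coe_one]
          rcases le_total (t : ℝ) (1 / 2) with ht | ht
          · rw [min_eq_left (by linarith : (1 : ℝ) ≤ 2 * (1 - t)), Set.projIcc_right]
            exact (congrArg (fun b => Ψ (b, _)) (slide_one_right _ _)).trans (h1 _ _)
          · rw [min_eq_left (by linarith : (1 : ℝ) ≤ 2 * t), Set.projIcc_right]
            exact (congrArg (fun b => Ψ (_, b)) (slide_one_right _ _)).trans (h2 _ _)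
        | hr x =>
          change Ψ (x.1 0, (x.2 0, x.2 (σ 1))) = z0
          rw [unitInterval.symm_one, h2])
  exact hn.comp_right Φ

end Extension

/-! ### A homotopy invariance principle for the degree -/

section Degree

open MeasureTheory

variable {N : ℕ}

/-- The integral of a closed form with bounded support in space is the same over two parallel
hyperplanes. -/
lemma integral_closedForm_eq
    (θ : (Fin (N + 1) → ℝ) → (Fin (N + 1) → ℝ) [⋀^Fin N]→L[ℝ] ℝ) (hθ : Differentiable ℝ θ)
    (hd : ∀ p, extDeriv θ p = 0) {R : ℝ} (hR : 0 ≤ R)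
    (hs : ∀ (p : Fin (N + 1) → ℝ) (i : Fin N), R ≤ |p i.succ| → θ p = 0) :
    ∫ x in Set.Icc (fun _ : Fin N => -R) (fun _ => R),
        θ (Fin.cons 1 x) (fun i => Pi.single i.succ 1) =
      ∫ x in Set.Icc (fun _ : Fin N => -R) (fun _ => R),
        θ (Fin.cons 0 x) (fun i => Pi.single i.succ 1) := by
  let bs : Fin (N + 1) → Fin (N + 1) → ℝ := fun j => Pi.single j 1
  let a : Fin (N + 1) → ℝ := Fin.cons 0 fun _ => -R
  let b : Fin (N + 1) → ℝ := Fin.cons 1 fun _ => R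
  have hab : a ≤ b := by
    intro i
    refine Fin.cases ?_ (fun i => ?_) i
    · simp [a, b]
    · simp only [a, b, Fin.cons_succ]; linarith
  have hdiff : ∀ i : Fin (N + 1), Differentiable ℝ fun p => θ p (i.removeNth bs) := by
    intro i p
    have := (hθ p).hasFDerivAt
    exact (this.continuousAlternatingMap_apply_const (i.removeNth bs)).differentiableAt
  have key := integral_divergence_of_hasFDerivAt_off_countable' a b hab
    (fun i p => (-1 : ℝ) ^ (i : ℕ) • θ p (i.removeNth bs))
    (fun i p => (-1 : ℝ) ^ (i : ℕ) • fderiv ℝ (fun p => θ p (i.removeNth bs)) p) ∅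
    Set.countable_empty
    (fun i => by have := (hdiff i).continuous; fun_prop)
    (fun p _ i => (hdiff i p).hasFDerivAt.fun_const_smul ((-1 : ℝ) ^ (i : ℕ)))
  have hdiv : ∀ p, ∑ i : Fin (N + 1),
      ((-1 : ℝ) ^ (i : ℕ) • fderiv ℝ (fun p => θ p (i.removeNth bs)) p) (Pi.single i 1) = 0 := by
    intro p
    have h1 := extDeriv_apply (hθ p) bs
    rw [hd p, ContinuousAlternatingMap.coe_zero, Pi.zero_apply] at h1
    simp only [zsmul_eq_mul, Int.cast_pow, Int.cast_neg, Int.cast_one] at h1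
    simp only [FunLike.coe_smul, Pi.smul_apply, smul_eq_mul]
    exact h1.symm
  simp only [hdiv] at key
  have key := key integrableOn_zero
  -- The pair of faces with index 0 consists of the two time slices; on all other faces the form
  -- vanishes.
  rw [integral_zero, Fin.sum_univ_succ] at key
  have hz : ∀ i : Fin N, ∀ (s : ℝ) (x : Fin N → ℝ), R ≤ |s| →
      θ (Fin.insertNth i.succ s x) = 0 := fun i s x h =>
    hs _ i (by rwa [Fin.insertNth_apply_same])
  have hside : ∀ i : Fin N,
      (((∫ x in Set.Icc (a ∘ i.succ.succAbove) (b ∘ i.succ.succAbove),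
        (-1 : ℝ) ^ (i.succ : ℕ) • θ (Fin.insertNth i.succ (b i.succ) x) (i.succ.removeNth bs)) -
      ∫ x in Set.Icc (a ∘ i.succ.succAbove) (b ∘ i.succ.succAbove),
        (-1 : ℝ) ^ (i.succ : ℕ) • θ (Fin.insertNth i.succ (a i.succ) x) (i.succ.removeNth bs)))
        = 0 := by
    intro i
    have h1 : ∀ x, θ (Fin.insertNth i.succ (b i.succ) x) = 0 := fun x => hz i _ x (le_abs_self R)
    have h2 : ∀ x, θ (Fin.insertNth i.succ (a i.succ) x) = 0 := fun x =>
      hz i _ x (by simp only [a, Fin.cons_succ, abs_neg]; exact le_abs_self R)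
    simp [h1, h2]
  rw [Finset.sum_eq_zero fun i _ => hside i, add_zero] at key
  have ha : a ∘ (0 : Fin (N + 1)).succAbove = fun _ => -R := by ext i; simp [a]
  have hb : b ∘ (0 : Fin (N + 1)).succAbove = fun _ => R := by ext i; simp [b]
  have hr : (0 : Fin (N + 1)).removeNth bs = fun i => Pi.single i.succ 1 := by
    ext i; simp [bs, Fin.removeNth]
  rw [ha, hb, hr] at key
  simp only [Fin.val_zero, pow_zero, one_smul, Fin.insertNth_zero'] at key
  exact (sub_eq_zero.1 key.symm)

/-- The determinant as a continuous alternating form. -/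
noncomputable def detForm (N : ℕ) : (Fin N → ℝ) [⋀^Fin N]→L[ℝ] ℝ :=
  { (Matrix.detRowAlternating : (Fin N → ℝ) [⋀^Fin N]→ₗ[ℝ] ℝ) with
    cont := Continuous.matrix_det (A := fun v : Fin N → Fin N → ℝ => Matrix.of v) continuous_id }

lemma detForm_apply (v : Fin N → Fin N → ℝ) : detForm N v = (Matrix.of v).det := rfl

lemma detForm_comp_single (A : (Fin N → ℝ) →L[ℝ] (Fin N → ℝ)) :
    detForm N (fun i => A (Pi.single i 1)) = A.det := by
  rw [detForm_apply, ContinuousLinearMap.det, ← LinearMap.det_toMatrix', ← Matrix.det_transpose]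
  congr 1

/-- Any `N + 1` vectors in `ℝ^N` are linearly dependent. -/
lemma extDeriv_top_eq_zero (η : (Fin N → ℝ) → (Fin N → ℝ) [⋀^Fin N]→L[ℝ] ℝ) (y : Fin N → ℝ) :
    extDeriv η y = 0 := by
  ext v
  refine AlternatingMap.map_linearDependent (extDeriv η y).toAlternatingMap v fun h => ?_
  have := h.fintype_card_le_finrank
  simp at this

/-- If a homotopy of functions with values in `ℝ^N` starts with a smooth function `f`, of which
all zeros in the open set `m < 0` have Jacobian determinants of the same sign, and if it has no
zeros on the boundary of the open set `m < 0` of space-time, then this set is non-empty at the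
final time. -/
theorem degree_principle_pi (f : (Fin N → ℝ) → (Fin N → ℝ)) (hf : ContDiff ℝ (⊤ : ℕ∞) f)
    (v : ℝ × (Fin N → ℝ) → (Fin N → ℝ)) (m : ℝ × (Fin N → ℝ) → ℝ) (hv : Continuous v)
    (hm : Continuous m) (hvm : ∀ p, m p = 0 → v p ≠ 0) {K : Set (Fin N → ℝ)} (hK : IsCompact K)
    (hmK : ∀ t x, x ∉ K → 1 ≤ m (t, x)) (h1 : ∀ x, 0 < m (1, x))
    (h0 : ∀ x, m (0, x) < 1 / 2 → v (0, x) = f x) (c : ℝ)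
    (hc : ∀ x, f x = 0 → m (0, x) < 0 → 0 < c * (fderiv ℝ f x).det)
    (hx : ∃ x, f x = 0 ∧ m (0, x) < 0) : False := by
  obtain ⟨x0, hx0, hmx0⟩ := hx
  let W := Fin (N + 1) → ℝ
  -- Time is stopped at 0 until 1/2. This makes the homotopy equal to the smooth map `f` on an open
  -- set around the part of space-time where the approximation must be exact.
  let cl : ℝ → ℝ := fun t => max 0 (min 1 (2 * t - 1))
  have hcl : Continuous cl := by fun_prop
  have hcl0 : ∀ t, t ≤ 1 / 2 → cl t = 0 := fun t ht =>
    max_eq_left ((min_le_right _ _).trans (by linarith))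
  have hcl1 : cl 1 = 1 := by simp only [cl]; norm_num
  have hclI : ∀ t, cl t ∈ Set.Icc (0 : ℝ) 1 := fun t =>
    ⟨le_max_left _ _, max_le zero_le_one (min_le_left _ _)⟩
  have htail : Continuous fun p : W => (Fin.tail p : Fin N → ℝ) :=
    continuous_pi fun i => continuous_apply i.succ
  let q : W → ℝ × (Fin N → ℝ) := fun p => (cl (p 0), Fin.tail p)
  have hq : Continuous q := (hcl.comp (continuous_apply 0)).prodMk htail
  -- a uniform bound
  obtain ⟨δ, hδ, hδK⟩ := (isCompact_Icc.prod hK : IsCompact (Set.Icc (0 : ℝ) 1 ×ˢ K)).exists_forall_le'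
    (f := fun p => max |m p| ‖v p‖) (hm.abs.max hv.norm).continuousOn (a := 0) (fun p _ => by
      by_cases h : m p = 0
      · exact lt_max_of_lt_right (norm_pos_iff.2 (hvm p h))
      · exact lt_max_of_lt_left (abs_pos.2 h))
  -- The bound `δ` serves over `K`; outside `K` one has `m ≥ 1`. Together they keep `v` away from 0
  -- wherever `|m| < η`.
  let η := min δ 1
  have hη : 0 < η := lt_min hδ one_pos
  have hηv : ∀ p, |m (q p)| < η → η ≤ ‖v (q p)‖ := by
    intro p hp
    by_cases h : Fin.tail p ∈ K
    · have h2 := hδK (q p) ⟨hclI _, h⟩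
      rcases le_max_iff.1 h2 with h3 | h3
      · exact absurd (hp.trans_le (min_le_left _ _)) (not_lt.2 h3)
      · exact (min_le_left _ _).trans h3
    · have h2 := hmK (cl (p 0)) _ h
      have h3 := (le_abs_self _).trans_lt hp
      exact absurd (h2.trans_lt h3) (not_lt.2 (min_le_right _ _))
  -- smooth approximation
  let S : Set W := {p | p 0 ≤ 1 / 4 ∧ m (q p) ≤ 1 / 4}
  let U : Set W := {p | p 0 < 1 / 2 ∧ m (q p) < 1 / 2}
  have hS : IsClosed S := (isClosed_le (continuous_apply 0) continuous_const).inter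
    (isClosed_le (hm.comp hq) continuous_const)
  have hU : IsOpen U := (isOpen_lt (continuous_apply 0) continuous_const).inter
    (isOpen_lt (hm.comp hq) continuous_const)
  have hSU : S ⊆ U := fun p hp => ⟨hp.1.trans_lt (by norm_num), hp.2.trans_lt (by norm_num)⟩
  have hvU : ∀ p ∈ U, v (q p) = f (Fin.tail p) := by
    intro p hp
    have h2 : q p = (0, Fin.tail p) := Prod.ext (hcl0 _ hp.1.le) rfl
    have h3 := hp.2
    rw [h2] at h3 ⊢
    exact h0 _ h3
  have htail' : ContDiff ℝ (⊤ : ℕ∞) fun p : W => (Fin.tail p : Fin N → ℝ) :=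
    contDiff_pi.2 fun i => contDiff_apply ℝ ℝ i.succ
  obtain ⟨g, hg, hgv, hgS, -⟩ := (hv.comp hq).exists_contDiff_approx_and_eqOn ⊤
    (ε := fun _ => η / 2) continuous_const (fun _ => half_pos hη) hS (hU.mem_nhdsSet.2 hSU)
    (ContDiffOn.congr (hf.comp htail').contDiffOn hvU)
  have hgη : ∀ p, |m (q p)| < η → η / 2 ≤ ‖g p‖ := by
    intro p hp
    have h2 := hηv p hp
    have h3 := hgv p
    rw [dist_eq_norm] at h3
    have h4 := norm_sub_norm_le (v (q p)) (g p)
    rw [norm_sub_rev] at h4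
    change ‖g p - v (q p)‖ < η / 2 at h3
    linarith
  -- the radius of the bump function
  have hdet : Continuous fun x => (fderiv ℝ f x).det :=
    ContinuousLinearMap.continuous_det.comp (hf.continuous_fderiv (by simp))
  -- The points with Jacobian of the wrong sign. There `f` has no zero, by `hc` where `m < 0` and by
  -- `hvm` where `m = 0`, so `‖f‖` has a positive lower bound on this set.
  have hC : IsCompact (K ∩ {x | m (0, x) ≤ 0 ∧ c * (fderiv ℝ f x).det ≤ 0}) :=
    hK.inter_right ((isClosed_le (hm.comp (by fun_prop)) continuous_const).inter
      (isClosed_le (continuous_const.mul hdet) continuous_const))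
  obtain ⟨r0, hr0, hr0C⟩ := hC.exists_forall_le' (f := fun x => ‖f x‖)
    hf.continuous.norm.continuousOn (a := 0) (fun x hx => by
      have h4 := h0 x (hx.2.1.trans_lt (by norm_num))
      rw [norm_pos_iff]
      intro h2
      rcases lt_or_eq_of_le hx.2.1 with h3 | h3
      · exact absurd (hc x h2 h3) (not_lt.2 hx.2.2)
      · exact hvm _ h3 (h4.trans h2))
  let r := min r0 (η / 2)
  have hr : 0 < r := lt_min hr0 (half_pos hη)
  have hrdet : ∀ x, m (0, x) < 0 → ‖f x‖ < r → 0 < c * (fderiv ℝ f x).det := by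
    intro x hx h2
    by_contra h3
    have hxK : x ∈ K := by
      by_contra h4
      linarith [hmK 0 x h4]
    exact absurd (h2.trans_le (min_le_left _ _)) (not_lt.2 (hr0C x ⟨hxK, hx.le, not_lt.1 h3⟩))
  let ρ : ContDiffBump (0 : Fin N → ℝ) := ⟨r / 2, r, half_pos hr, half_lt_self hr⟩
  have hρ : ∀ y : Fin N → ℝ, r ≤ ‖y‖ → ρ y = 0 := fun y hy =>
    ρ.zero_of_le_dist (by rwa [dist_zero_right])
  -- the closed form
  let G : W → ℝ := fun p => if m (q p) < 0 then ρ (g p) else 0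
  -- The cutoff at `m = 0` causes no jump: for `|m| < η` the value of `g` lies outside the support
  -- of the bump, since `r ≤ η / 2`.
  have hG : ∀ p, (∀ᶠ p' in 𝓝 p, G p' = ρ (g p')) ∨ (∀ᶠ p' in 𝓝 p, G p' = 0) := by
    intro p
    have hmq := hm.comp hq
    rcases lt_trichotomy (m (q p)) 0 with h | h | h
    · left
      filter_upwards [(isOpen_lt hmq continuous_const).mem_nhds h] with p' hp'
      exact if_pos hp'
    · right
      have h2 : |m (q p)| < η := by rw [h, abs_zero]; exact hη
      filter_upwards [(isOpen_lt hmq.abs continuous_const).mem_nhds h2] with p' hp'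
      simp only [G]
      rw [hρ _ ((min_le_right _ _).trans (hgη p' hp')), ite_self]
    · right
      filter_upwards [(isOpen_lt continuous_const hmq).mem_nhds h] with p' hp'
      exact if_neg (not_lt.2 (le_of_lt hp'))
  let η' : (Fin N → ℝ) → (Fin N → ℝ) [⋀^Fin N]→L[ℝ] ℝ := fun y => ρ y • detForm N
  have hη' : ContDiff ℝ (⊤ : ℕ∞) η' := ρ.contDiff.smul contDiff_const
  -- Locally this is zero or the pullback by `g` of a form of top degree on `ℝ^N`, hence closed.
  let θ : W → W [⋀^Fin N]→L[ℝ] ℝ := fun p =>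
    G p • (detForm N).compContinuousLinearMap (fderiv ℝ g p)
  have hθloc : ∀ p, (∀ᶠ p' in 𝓝 p, θ p' = (η' (g p')).compContinuousLinearMap (fderiv ℝ g p')) ∨
      (∀ᶠ p' in 𝓝 p, θ p' = 0) := by
    intro p
    rcases hG p with h | h
    · left
      filter_upwards [h] with p' hp'
      simp only [θ, η', hp']
      rfl
    · right
      filter_upwards [h] with p' hp'
      simp only [θ, hp', zero_smul]
  have hg' : Differentiable ℝ (fderiv ℝ g) :=
    (hg.fderiv_right (m := 1) (by norm_cast)).differentiable one_ne_zero
  have hη'' : Differentiable ℝ η' := hη'.differentiable (by simp)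
  have hθ : Differentiable ℝ θ := by
    intro p
    rcases hθloc p with h | h
    · exact (DifferentiableAt.continuousAlternatingMapCompContinuousLinearMap
        ((hη'' _).comp p (hg.differentiable (by simp) p)) (hg' p)).congr_of_eventuallyEq h
    · exact (differentiableAt_const 0).congr_of_eventuallyEq h
  have hdθ : ∀ p, extDeriv θ p = 0 := by
    intro p
    rcases hθloc p with h | h
    · rw [Filter.EventuallyEq.extDeriv_eq h, extDeriv_pullback (hη'' _) (hg.contDiffAt (x := p))
        (by
          rw [minSmoothness_of_isRCLikeNormedField]
          exact WithTop.coe_le_coe.2 (le_top : (2 : ℕ∞) ≤ ⊤)), extDeriv_top_eq_zero]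
      ext; simp
    · have h2 : θ =ᶠ[𝓝 p] fun _ => 0 := h
      rw [h2.extDeriv_eq]
      ext w
      simp [extDeriv, ContinuousAlternatingMap.alternatizeUncurryFin_apply]
  obtain ⟨R, hR, hRK⟩ := hK.isBounded.subset_closedBall_lt 0 0
  have hθm : ∀ p, 0 < m (q p) → θ p = 0 := fun p hp => by
    simp only [θ, G, if_neg (not_lt.2 hp.le), zero_smul]
  have hθR : ∀ (p : W) (i : Fin N), R + 1 ≤ |p i.succ| → θ p = 0 := by
    intro p i hp
    refine hθm p (zero_lt_one.trans_le (hmK _ _ fun h => ?_))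
    have h2 := mem_closedBall_zero_iff.1 (hRK h)
    have h3 := norm_le_pi_norm (Fin.tail p : Fin N → ℝ) i
    have h4 : ‖(Fin.tail p : Fin N → ℝ) i‖ = |p i.succ| := rfl
    linarith
  have hcons : ∀ s (x : Fin N → ℝ), q (Fin.cons s x) = (cl s, x) := fun s x => rfl
  have key := integral_closedForm_eq θ hθ hdθ (by linarith : 0 ≤ R + 1) hθR
  have hkey1 : ∀ x : Fin N → ℝ, θ (Fin.cons 1 x) = 0 := fun x =>
    hθm _ (by rw [hcons, hcl1]; exact h1 x)
  simp only [hkey1, ContinuousAlternatingMap.coe_zero, Pi.zero_apply, integral_zero] at key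
  -- Where `m < 0` this is `ρ(f) · c · det f'`, which is nonnegative by the choice of `r` and
  -- nonzero at `x0`. Its integral is therefore positive, while Stokes equates it with the vanishing
  -- integral at time 1.
  let J : (Fin N → ℝ) → ℝ := fun x => c * θ (Fin.cons 0 x) (fun i => Pi.single i.succ 1)
  have hι : Continuous fun x : Fin N → ℝ => (Fin.cons 0 x : W) :=
    continuous_pi (Fin.cases continuous_const fun i => continuous_apply i)
  have hJc : Continuous J := by
    refine continuous_const.mul ?_
    have h2 : Differentiable ℝ fun p => θ p (fun i => Pi.single i.succ 1) := fun p =>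
      ((hθ p).hasFDerivAt.continuousAlternatingMap_apply_const _).differentiableAt
    exact h2.continuous.comp hι
  have hmem : ∀ x, m (0, x) < 0 → ∀ᶠ x' in 𝓝 x, g (Fin.cons 0 x') = f x' := by
    intro x hx
    filter_upwards [(isOpen_lt (hm.comp (by fun_prop : Continuous fun x : Fin N → ℝ =>
      ((0 : ℝ), x))) continuous_const).mem_nhds hx] with x' hx'
    have h2 : q (Fin.cons 0 x') = (0, x') := by rw [hcons, hcl0 0 (by norm_num)]
    have h3 : (Fin.cons 0 x' : W) ∈ S := by
      refine ⟨by norm_num, ?_⟩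
      rw [h2]
      exact (le_of_lt hx').trans (by norm_num)
    rw [hgS h3]
    exact hvU _ (hSU h3)
  let ι : (Fin N → ℝ) →L[ℝ] W := LinearMap.toContinuousLinearMap
    { toFun := fun x => Fin.cons 0 x
      map_add' := fun x y => by
        ext i
        refine Fin.cases ?_ (fun i => rfl) i
        change (0 : ℝ) = 0 + 0
        rw [add_zero]
      map_smul' := fun a x => by
        ext i
        refine Fin.cases ?_ (fun i => rfl) i
        change (0 : ℝ) = a * 0
        rw [mul_zero] }
  have hιs : ∀ i : Fin N, ι (Pi.single i 1) = Pi.single i.succ 1 := by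
    intro i
    change (Fin.cons 0 (Pi.single i 1) : W) = _
    ext j
    refine Fin.cases ?_ (fun j => ?_) j
    · simp
    · simp [Pi.single_apply]
  have hJneg : ∀ x, m (0, x) < 0 → J x = ρ (f x) * (c * (fderiv ℝ f x).det) := by
    intro x hx
    have h2 : fderiv ℝ f x = (fderiv ℝ g (Fin.cons 0 x)).comp ι := by
      have h3 : HasFDerivAt (fun x' : Fin N → ℝ => g (ι x')) ((fderiv ℝ g (ι x)).comp ι) x :=
        (hg.differentiable (by simp) (ι x)).hasFDerivAt.comp x ι.hasFDerivAt
      exact (h3.congr_of_eventuallyEq ((hmem x hx).mono fun _ h => h.symm)).fderiv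
    have h3 : q (Fin.cons 0 x) = (0, x) := by rw [hcons, hcl0 0 (by norm_num)]
    have h4 : G (Fin.cons 0 x) = ρ (f x) := by
      simp only [G, h3, if_pos hx, (hmem x hx).self_of_nhds]
    have h5 : θ (Fin.cons 0 x) (fun i => Pi.single i.succ 1) = ρ (f x) * (fderiv ℝ f x).det := by
      rw [h2, ← detForm_comp_single, ← h4]
      simp only [ContinuousLinearMap.comp_apply, hιs]
      rfl
    simp only [J, h5]
    ring
  have hJpos : ∀ x, 0 < m (0, x) → J x = 0 := by
    intro x hx
    have h3 : q (Fin.cons 0 x) = (0, x) := by rw [hcons, hcl0 0 (by norm_num)]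
    simp only [J, hθm (Fin.cons 0 x) (by rwa [h3]), ContinuousAlternatingMap.coe_zero, Pi.zero_apply, mul_zero]
  have hJ0 : ∀ x, 0 ≤ J x := by
    intro x
    by_cases hx : m (0, x) < 0
    · rw [hJneg x hx]
      by_cases h2 : ‖f x‖ < r
      · exact mul_nonneg ρ.nonneg (hrdet x hx h2).le
      · rw [hρ _ (not_lt.1 h2), zero_mul]
    · have h3 : q (Fin.cons 0 x) = (0, x) := by rw [hcons, hcl0 0 (by norm_num)]
      simp only [J, θ, G, h3, if_neg hx, zero_smul, ContinuousAlternatingMap.coe_zero, Pi.zero_apply, mul_zero]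
      exact le_rfl
  have hJx0 : J x0 ≠ 0 := by
    rw [hJneg x0 hmx0, hx0]
    refine mul_ne_zero ?_ (hc x0 hx0 hmx0).ne'
    rw [ρ.one_of_mem_closedBall (Metric.mem_closedBall_self (half_pos hr).le)]
    exact one_ne_zero
  have hsupp : ∀ x, x ∉ Set.Icc (fun _ : Fin N => -(R + 1)) (fun _ => R + 1) → J x = 0 := by
    intro x hx
    refine hJpos x (zero_lt_one.trans_le (hmK 0 x fun h => hx ?_))
    have h2 := mem_closedBall_zero_iff.1 (hRK h)
    have h3 := fun i => abs_le.1 ((norm_le_pi_norm x i).trans h2)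
    exact ⟨fun i => by linarith [(h3 i).1], fun i => by linarith [(h3 i).2]⟩
  have hpos := hJc.integral_pos_of_hasCompactSupport_nonneg_nonzero (μ := volume)
    (HasCompactSupport.intro isCompact_Icc hsupp) hJ0 hJx0
  rw [← setIntegral_eq_integral_of_forall_compl_eq_zero hsupp, integral_const_mul, ← key,
    mul_zero] at hpos
  exact lt_irrefl _ hpos

/-- The degree principle `degree_principle_pi` on a finite-dimensional normed space. -/
theorem degree_principle {E : Type*} [NormedAddCommGroup E] [NormedSpace ℝ E]
    [FiniteDimensional ℝ E] (f : E → E) (hf : ContDiff ℝ (⊤ : ℕ∞) f)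
    (v : ℝ × E → E) (m : ℝ × E → ℝ) (hv : Continuous v)
    (hm : Continuous m) (hvm : ∀ p, m p = 0 → v p ≠ 0) {K : Set E} (hK : IsCompact K)
    (hmK : ∀ t x, x ∉ K → 1 ≤ m (t, x)) (h1 : ∀ x, 0 < m (1, x))
    (h0 : ∀ x, m (0, x) < 1 / 2 → v (0, x) = f x) (c : ℝ)
    (hc : ∀ x, f x = 0 → m (0, x) < 0 → 0 < c * (fderiv ℝ f x).det)
    (hx : ∃ x, f x = 0 ∧ m (0, x) < 0) : False := by
  let e : E ≃L[ℝ] (Fin (Module.finrank ℝ E) → ℝ) :=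
    ContinuousLinearEquiv.ofFinrankEq (by simp)
  refine degree_principle_pi (fun y => e (f (e.symm y)))
    (e.contDiff.comp (hf.comp e.symm.contDiff)) (fun p => e (v (p.1, e.symm p.2)))
    (fun p => m (p.1, e.symm p.2)) (by fun_prop) (by fun_prop) (fun p hp => ?_)
    (hK.image e.continuous) (fun t y hy => hmK t _ fun h => hy ⟨_, h, e.apply_symm_apply y⟩)
    (fun y => h1 _) (fun y hy => congrArg e (h0 _ hy)) c (fun y hy hy' => ?_) ?_
  · simpa using hvm _ hp
  · have h2 : HasFDerivAt (fun y => e (f (e.symm y)))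
        ((e : E →L[ℝ] (Fin (Module.finrank ℝ E) → ℝ)).comp
          ((fderiv ℝ f (e.symm y)).comp (e.symm : (Fin (Module.finrank ℝ E) → ℝ) →L[ℝ] E))) y :=
      e.hasFDerivAt.comp y
        ((hf.differentiable (by simp) _).hasFDerivAt.comp y e.symm.hasFDerivAt)
    rw [h2.fderiv]
    have h3 : ((e : E →L[ℝ] (Fin (Module.finrank ℝ E) → ℝ)).comp
          ((fderiv ℝ f (e.symm y)).comp (e.symm : (Fin (Module.finrank ℝ E) → ℝ) →L[ℝ] E))).det =
        (fderiv ℝ f (e.symm y)).det :=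
      LinearMap.det_conj (fderiv ℝ f (e.symm y) : E →ₗ[ℝ] E) e.toLinearEquiv
    rw [h3]
    exact hc _ (by simpa using hy) hy'
  · obtain ⟨x, hx, hx'⟩ := hx
    exact ⟨e x, by simp [hx], by simpa using hx'⟩

end Degree

/-! ### Families of maps which are essential by the degree principle -/

section Cut

variable {W : Type*} [NormedAddCommGroup W] [NormedSpace ℝ W]

/-- The collapse of the complement of the ball of radius `1 / 10` to the point `(0, 1)`. It has
values in a space `W × ℝ` without the origin, and it is the identity in the first coordinate near
the ball where the second coordinate is not positive. -/
noncomputable def cut (w : W) : W × ℝ :=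
  -- The second coordinate changes sign at radius 1/20 and reaches 1 at 3/40; only from there on
  -- does the first one shrink, to vanish at 1/10. The two never vanish together.
  (max 0 (min 1 (4 - 40 * ‖w‖)) • w, min 1 (40 * ‖w‖ - 2))

lemma continuous_cut : Continuous (cut : W → W × ℝ) := by
  unfold cut
  fun_prop

lemma cut_fst {w : W} (h : (cut w).2 < 1) : (cut w).1 = w := by
  have h1 : 40 * ‖w‖ - 2 < 1 := (min_lt_iff.1 h).resolve_left (lt_irrefl _)
  change max 0 (min 1 (4 - 40 * ‖w‖)) • w = w
  rw [min_eq_left (by linarith), max_eq_right zero_le_one, one_smul]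

lemma cut_ne_zero {w : W} (h : (cut w).2 = 0) : (cut w).1 ≠ 0 := by
  have h1 : (cut w).2 < 1 := h.trans_lt one_pos
  rw [cut_fst h1]
  rintro rfl
  norm_num [cut] at h

lemma cut_eq {w : W} (h : 1 / 10 ≤ ‖w‖) : cut w = (0, 1) := by
  rw [cut, max_eq_left ((min_le_right _ _).trans (by linarith)), zero_smul,
    min_eq_left (by linarith)]

variable (W) in
/-- Maps from `Q` to the complement of the origin in `W × ℝ` which send `Qb` to `(0, 1)`. -/
abbrev CutMaps {Q : Type*} [TopologicalSpace Q] (Qb : Set Q) : Type _ :=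
  {g : C(Q, W × ℝ) // ∀ q, ((g q).2 = 0 → (g q).1 ≠ 0) ∧ (q ∈ Qb → g q = (0, 1))}

variable {B Q : Type*} [TopologicalSpace B] [TopologicalSpace Q] {Qb : Set Q}

/-- The base point of the space `CutMaps W Qb`. -/
def CutMaps.base (W : Type*) [NormedAddCommGroup W] (Qb : Set Q) : CutMaps W Qb :=
  ⟨ContinuousMap.const Q (0, 1), fun _ => ⟨fun h => absurd h one_ne_zero, fun _ => rfl⟩⟩

/-- The family of maps `q ↦ cut (φ (b, q))`. -/
noncomputable def cutFamily (φ : C(B × Q, W)) (h : ∀ b, ∀ q ∈ Qb, 1 / 10 ≤ ‖φ (b, q)‖) :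
    C(B, CutMaps W Qb) where
  toFun b := ⟨((⟨cut, continuous_cut⟩ : C(W, W × ℝ)).comp φ).curry b,
    fun q => ⟨fun hq => cut_ne_zero hq, fun hq => cut_eq (h b q hq)⟩⟩
  continuous_toFun := Continuous.subtype_mk (ContinuousMap.continuous _) _

lemma cutFamily_eq_base (φ : C(B × Q, W)) (h : ∀ b, ∀ q ∈ Qb, 1 / 10 ≤ ‖φ (b, q)‖) {b : B}
    (hb : ∀ q, 1 / 10 ≤ ‖φ (b, q)‖) : cutFamily φ h b = CutMaps.base W Qb :=
  Subtype.ext (ContinuousMap.ext fun q => cut_eq (hb q))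

/-- A family of maps `q ↦ cut (φ (b, q))` is essential if a part of it can be identified with a
smooth map `f` on a compact set, such that the zeros of `f` have Jacobian determinants of the same
sign. -/
theorem cutFamily_not_nullhomotopic [FiniteDimensional ℝ W] [LocallyCompactSpace Q]
    (φ : C(B × Q, W)) (h : ∀ b, ∀ q ∈ Qb, 1 / 10 ≤ ‖φ (b, q)‖) {b0 : B}
    (hb0 : ∀ q, 1 / 10 ≤ ‖φ (b0, q)‖) {R : Set W} (hR : IsCompact R) {β : W → B}
    (hβ : ContinuousOn β R) {ρ : W → Q} (hρ : ContinuousOn ρ R)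
    (hint : ∀ w ∈ R, ρ w ∉ Qb → R ∈ 𝓝 w) {f : W → W} (hf : ContDiff ℝ (⊤ : ℕ∞) f)
    (hfR : ∀ w ∈ R, φ (β w, ρ w) = f w) (c : ℝ)
    (hc : ∀ w ∈ R, f w = 0 → 0 < c * (fderiv ℝ f w).det) (hx : ∃ w ∈ R, f w = 0) :
    ¬ (cutFamily φ h).Nullhomotopic := by
  intro hnull
  -- The family takes the base value at `b0`, so a null-homotopy can be made to end at the base map.
  have hF : (cutFamily φ h).Homotopic (ContinuousMap.const B (CutMaps.base W Qb)) := by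
    obtain ⟨z, hz⟩ := hnull
    have h1 : ContinuousMap.const B (CutMaps.base W Qb) =
        (cutFamily φ h).comp (ContinuousMap.const B b0) :=
      ContinuousMap.ext fun _ => (cutFamily_eq_base φ h hb0).symm
    rw [h1]
    exact hz.trans (hz.symm.comp (ContinuousMap.Homotopic.refl (ContinuousMap.const B b0)))
  obtain ⟨F⟩ := hF
  classical
  -- The homotopy, read in the coordinates `(β, ρ)` on `R`, is extended by `(0, 1)`. This is
  -- continuous because at a frontier point of `R` the parameter `ρ w` lies in `Qb`.
  let H : ℝ × W → W × ℝ := (Set.univ ×ˢ R).piecewise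
    (fun p => (F (Set.projIcc 0 1 zero_le_one p.1, β p.2)).1 (ρ p.2)) (fun _ => (0, 1))
  have hHR : ∀ t, ∀ w ∈ R, H (t, w) = (F (Set.projIcc 0 1 zero_le_one t, β w)).1 (ρ w) :=
    fun t w hw => Set.piecewise_eq_of_mem _ _ _ ⟨Set.mem_univ _, hw⟩
  have hHR' : ∀ t, ∀ w ∉ R, H (t, w) = (0, 1) :=
    fun t w hw => Set.piecewise_eq_of_notMem _ _ _ fun h => hw h.2
  have hH : Continuous H := by
    have hcl : IsClosed ((Set.univ : Set ℝ) ×ˢ R) := isClosed_univ.prod hR.isClosed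
    refine continuous_piecewise ?_ ?_ continuousOn_const
    · rintro ⟨t, w⟩ hw
      have hwR : w ∈ R := (hcl.frontier_subset hw).2
      refine ((F (Set.projIcc 0 1 zero_le_one t, β w)).2 (ρ w)).2 ?_
      by_contra hq
      refine hw.2 (mem_interior_iff_mem_nhds.2 (prod_mem_nhds Filter.univ_mem (hint w hwR hq)))
    · rw [hcl.closure_eq]
      have h2 : ContinuousOn (fun p : ℝ × W => F (Set.projIcc 0 1 zero_le_one p.1, β p.2))
          (Set.univ ×ˢ R) :=
        F.continuous.comp_continuousOn ((continuous_projIcc.comp continuous_fst).continuousOn.prodMk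
          (hβ.comp continuousOn_snd fun p hp => hp.2))
      exact (continuous_subtype_val.comp_continuousOn h2).eval
        (hρ.comp continuousOn_snd fun p hp => hp.2)
  have hH0 : ∀ w ∈ R, H (0, w) = cut (f w) := by
    intro w hw
    rw [hHR 0 w hw, Set.projIcc_left, ← hfR w hw]
    exact congrArg (fun g : CutMaps W Qb => g.1 (ρ w)) (F.map_zero_left (β w))
  refine degree_principle f hf (fun p => (H p).1) (fun p => (H p).2) (by fun_prop) (by fun_prop)
    ?_ hR ?_ ?_ ?_ c ?_ ?_
  · rintro ⟨t, w⟩ hp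
    by_cases hw : w ∈ R
    · simp only [hHR t w hw] at hp ⊢
      exact ((F (Set.projIcc 0 1 zero_le_one t, β w)).2 (ρ w)).1 hp
    · simp only [hHR' t w hw] at hp
      exact absurd hp one_ne_zero
  · intro t w hw
    simp only [hHR' t w hw]
    exact le_rfl
  · intro w
    by_cases hw : w ∈ R
    · have h2 : H (1, w) = (0, 1) := by
        rw [hHR 1 w hw, Set.projIcc_right]
        exact congrArg (fun g : CutMaps W Qb => g.1 (ρ w)) (F.map_one_left (β w))
      simp only [h2]
      exact one_pos
    · simp only [hHR' 1 w hw]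
      exact one_pos
  · intro w hm
    by_cases hw : w ∈ R
    · simp only [hH0 w hw] at hm ⊢
      exact cut_fst (hm.trans (by norm_num))
    · simp only [hHR' 0 w hw] at hm
      norm_num at hm
  · intro w hw hm
    by_cases hwR : w ∈ R
    · exact hc w hwR hw
    · simp only [hHR' 0 w hwR] at hm
      norm_num at hm
  · obtain ⟨w, hwR, hw⟩ := hx
    refine ⟨w, hw, ?_⟩
    simp only [hH0 w hwR, hw]
    simp [cut]

end Cut

/-! ### Lower bounds for spheres -/

section LowerBound

variable {n : ℕ}

/-- The range of the radial coordinate. -/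
abbrev Radius : Type := Set.Icc (1 / 2 : ℝ) 2

/-- The nearest point in the interval `[1/2, 2]`. -/
noncomputable def toRadius : ℝ → Radius := Set.projIcc (1 / 2) 2 (by norm_num)

lemma continuous_toRadius : Continuous toRadius := continuous_projIcc

lemma toRadius_coe {r : ℝ} (hr : r ∈ Set.Icc (1 / 2 : ℝ) 2) : (toRadius r : ℝ) = r := by
  rw [toRadius, Set.projIcc_of_mem _ hr]

lemma abs_le_norm_smul_add {a b : ℝ} (ha : 0 ≤ a) (hb : 0 ≤ b)
    {v w : EuclideanSpace ℝ (Fin (n + 1))} (hv : ‖v‖ = 1) (hw : ‖w‖ = 1) :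
    |a - b| ≤ ‖a • v + b • w‖ := by
  have h := abs_norm_sub_norm_le (a • v) (-(b • w))
  rwa [norm_neg, sub_neg_eq_add, norm_smul, norm_smul, hv, hw, Real.norm_of_nonneg ha,
    Real.norm_of_nonneg hb, mul_one, mul_one] at h

/-- The loop `r ↦ r y + x` avoids the origin for `x = y`, so it gives a map to a loop space that is
constant on the diagonal. With `x = e` fixed and `w = r y` in polar coordinates it becomes the
translation `w + e`, which has one nondegenerate zero. -/
theorem not_nullhomotopic_zero (n : ℕ) :
    ¬ ((HomotopyCofibre.incl (fatWedge (pathFibration (Sph n)) 0).map).comp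
      (diagPow (Sph n × Sph n) 1)).Nullhomotopic := by
  intro hn
  let E := EuclideanSpace ℝ (Fin (n + 1))
  let e : Sph n := basePt n
  let φ : C((Sph n × Sph n) × Radius, E) :=
    ⟨fun z => (z.2 : ℝ) • (z.1.2 : E) + (1 : ℝ) • (z.1.1 : E), by fun_prop⟩
  let Qb : Set Radius := {q | (q : ℝ) = 1 / 2 ∨ (q : ℝ) = 2}
  have hb : ∀ b, ∀ q ∈ Qb, 1 / 10 ≤ ‖φ (b, q)‖ := by
    intro b q hq
    refine le_trans ?_ (abs_le_norm_smul_add (by linarith [q.2.1]) zero_le_one b.2.norm_coe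
      b.1.norm_coe)
    rcases hq with hq | hq <;> rw [hq] <;> norm_num [abs_of_pos, abs_of_neg]
  have hd : ∀ (x : Sph n) (q : Radius), 1 / 10 ≤ ‖φ ((x, x), q)‖ := by
    intro x q
    change 1 / 10 ≤ ‖(q : ℝ) • (x : E) + (1 : ℝ) • (x : E)‖
    rw [← add_smul, norm_smul, x.norm_coe, mul_one, Real.norm_eq_abs]
    exact le_trans (by linarith [q.2.1]) (le_abs_self _)
  have h1 := nullhomotopic_of_const_on_diagonal (cutFamily φ hb) _
    (fun x => cutFamily_eq_base φ hb (hd x)) hn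
  have hR : IsCompact {w : E | ‖w‖ ∈ Set.Icc (1 / 2 : ℝ) 2} := by
    refine (isCompact_closedBall (0 : E) 2).of_isClosed_subset
      (isClosed_Icc.preimage continuous_norm) fun w hw => mem_closedBall_zero_iff.2 hw.2
  have hne : ∀ w : E, ‖w‖ ∈ Set.Icc (1 / 2 : ℝ) 2 → w ≠ 0 := fun w hw =>
    norm_pos_iff.1 (by linarith [hw.1])
  have hfd : ∀ w : E, HasFDerivAt (fun w => w + (e : E)) (ContinuousLinearMap.id ℝ E) w :=
    fun w => (hasFDerivAt_id w).add_const _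
  refine cutFamily_not_nullhomotopic φ hb (b0 := (e, e)) (hd e) hR (β := fun w => (e, toSph w))
    (continuousOn_const.prodMk (continuousOn_toSph.mono hne)) (ρ := fun w => toRadius ‖w‖)
    (continuous_toRadius.comp continuous_norm).continuousOn ?_ (f := fun w => w + (e : E))
    (by fun_prop) ?_ 1 ?_ ?_ h1
  · intro w hw hq
    refine continuous_norm.continuousAt (Icc_mem_nhds ?_ ?_)
    · exact lt_of_le_of_ne hw.1 fun h => hq (Or.inl ((toRadius_coe hw).trans h.symm))
    · exact lt_of_le_of_ne hw.2 fun h => hq (Or.inr ((toRadius_coe hw).trans h))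
  · intro w hw
    change (toRadius ‖w‖ : ℝ) • (toSph w : E) + (1 : ℝ) • (e : E) = w + (e : E)
    rw [toRadius_coe hw, norm_smul_toSph (hne w hw), one_smul]
  · intro w _ _
    rw [(hfd w).fderiv, one_mul]
    change 0 < LinearMap.det (LinearMap.id : E →ₗ[ℝ] E)
    rw [LinearMap.det_id]
    exact one_pos
  · refine ⟨-(e : E), ?_, neg_add_cancel _⟩
    change ‖-(e : E)‖ ∈ Set.Icc (1 / 2 : ℝ) 2
    rw [norm_neg, e.norm_coe]
    norm_num

/-- Off-diagonal entries of the twist are antisymmetric and cancel; only a middle coordinate, with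
sign `+1`, can contribute. The bound keeps `r x + s T x` away from 0 on the second diagonal. -/
lemma inner_twist_nonneg (v : EuclideanSpace ℝ (Fin (n + 1))) : 0 ≤ inner ℝ v (twist n v) := by
  have h1 : inner ℝ v (twist n v) = ∑ i, halfSign i * v i.rev * v i := by
    simp only [PiLp.inner_apply, twist_apply]
    rfl
  have h2 : inner ℝ v (twist n v) = ∑ i : Fin (n + 1), halfSign i.rev * v i * v i.rev := by
    rw [h1, ← Equiv.sum_comp Fin.revPerm]
    simp only [Fin.revPerm_apply, Fin.rev_rev]
  have h3 : 0 ≤ ∑ i : Fin (n + 1),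
      (halfSign i * v i.rev * v i + halfSign i.rev * v i * v i.rev) := by
    refine Finset.sum_nonneg fun i _ => ?_
    by_cases h : i = i.rev
    · rw [← h, halfSign, if_pos h.le]
      nlinarith [mul_self_nonneg (v i)]
    · have h4 : halfSign i.rev = -halfSign i := by
        linear_combination halfSign i * halfSign_mul_rev i h - halfSign i.rev *
          halfSign_mul_self i
      rw [h4]
      exact le_of_eq (by ring)
  rw [Finset.sum_add_distrib, ← h1, ← h2] at h3
  linarith

/-- For even `n` there is one middle coordinate, fixed by the twist; on all the others its square is
`-1`, so a fixed vector vanishes there. -/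
lemma exists_twist_fixed (hn : Even n) : ∃ e : Sph n, twist n e = (e : EuclideanSpace ℝ _) ∧
    ∀ v, twist n v = v → ∃ c : ℝ, v = c • (e : EuclideanSpace ℝ (Fin (n + 1))) := by
  obtain ⟨k, rfl⟩ := hn
  let i0 : Fin (k + k + 1) := ⟨k, by omega⟩
  have hi0 : i0.rev = i0 := by ext; simp [i0, Fin.rev]
  have hi : ∀ i : Fin (k + k + 1), i ≠ i0 → i ≠ i.rev := by
    intro i h h'
    apply h
    have := congrArg Fin.val h'
    rw [Fin.val_rev] at this
    ext
    change (i : ℕ) = k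
    omega
  refine ⟨sphBasis i0, ?_, fun v hv => ⟨v i0, ?_⟩⟩
  · ext i
    rw [twist_apply]
    by_cases h : i = i0
    · rw [h, hi0, halfSign, hi0, if_pos le_rfl, one_mul]
    · have h2 : i.rev ≠ i0 := fun h' => h (by rw [← Fin.rev_rev i, h', hi0])
      simp [sphBasis, h, h2]
  · ext i
    by_cases h : i = i0
    · simp [h, sphBasis]
    · have h2 := twist_twist_apply v (hi i h)
      rw [hv, hv] at h2
      have h3 : v i = 0 := by linarith
      simp [h3, h, sphBasis]

/-- Two copies of the previous family are combined, the second twisted by `T`. On the diagonal they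
become `(X, Y) ↦ (Y + X, Y + |X|² T X)` in polar coordinates. Its zeros satisfy `Y = -X`, `|X| = 1`
and `T X = X`, hence `X = ±e`, and both have the same derivative. -/
theorem not_nullhomotopic_one (hn : Even n) :
    ¬ ((HomotopyCofibre.incl (fatWedge (pathFibration (Sph n)) 1).map).comp
      (diagPow (Sph n × Sph n) 2)).Nullhomotopic := by
  intro hnull
  let E := EuclideanSpace ℝ (Fin (n + 1))
  obtain ⟨e, he, he'⟩ := exists_twist_fixed hn
  let T : E →L[ℝ] E := twist n
  -- The cube isolates the zeros radially: `r₂ = r₁ = r₁³` holds only at 1 in this range, so they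
  -- stay away from `Qb`.
  let φ : C(((Sph n × Sph n) × (Sph n × Sph n)) × (Radius × Radius), E × E) :=
    ⟨fun z => ((z.2.2 : ℝ) • (z.1.1.2 : E) + (z.2.1 : ℝ) • (z.1.1.1 : E),
      (z.2.2 : ℝ) • (z.1.2.2 : E) + (z.2.1 : ℝ) ^ 3 • T z.1.2.1), by fun_prop⟩
  let Qb : Set (Radius × Radius) := {q | ((q.1 : ℝ) = 1 / 2 ∨ (q.1 : ℝ) = 2) ∨
    ((q.2 : ℝ) = 1 / 2 ∨ (q.2 : ℝ) = 2)}
  have hT : ∀ x : Sph n, ‖T x‖ = 1 := fun x => (norm_twist _).trans x.norm_coe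
  have hb : ∀ b, ∀ q ∈ Qb, 1 / 10 ≤ ‖φ (b, q)‖ := by
    intro b q hq
    have h1 : |(q.2 : ℝ) - q.1| ≤ ‖φ (b, q)‖ := by
      refine le_trans (abs_le_norm_smul_add ?_ ?_ b.1.2.norm_coe b.1.1.norm_coe) (le_max_left _ _)
      · linarith [q.2.2.1]
      · linarith [q.1.2.1]
    have h2 : |(q.2 : ℝ) - (q.1 : ℝ) ^ 3| ≤ ‖φ (b, q)‖ := by
      refine le_trans (abs_le_norm_smul_add ?_ ?_ b.2.2.norm_coe (hT b.2.1)) (le_max_right _ _)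
      · linarith [q.2.2.1]
      · exact pow_nonneg (by linarith [q.1.2.1]) 3
    by_contra h3
    rw [not_le] at h3
    obtain ⟨h4, h5⟩ := abs_lt.1 (h1.trans_lt h3)
    obtain ⟨h6, h7⟩ := abs_lt.1 (h2.trans_lt h3)
    -- On an edge of the square `r₂` cannot be within 1/10 of both `r₁` and `r₁³`.
    rcases hq with (hq | hq) | (hq | hq)
    · rw [hq] at h4 h5 h6 h7; linarith
    · rw [hq] at h4 h5 h6 h7; linarith
    · rw [hq] at h4 h5 h6 h7
      nlinarith [q.1.2.1, mul_nonneg (sub_nonneg.2 q.1.2.1) (sub_nonneg.2 q.1.2.1)]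
    · rw [hq] at h4 h5 h6 h7
      nlinarith [q.1.2.1, mul_nonneg (sub_nonneg.2 q.1.2.1) (sub_nonneg.2 q.1.2.1)]
  have hd1 : ∀ (x : Sph n) b (q : Radius × Radius), 1 / 10 ≤ ‖φ (((x, x), b), q)‖ := by
    intro x b q
    refine le_trans ?_ (le_max_left _ _)
    change 1 / 10 ≤ ‖(q.2 : ℝ) • (x : E) + (q.1 : ℝ) • (x : E)‖
    rw [← add_smul, norm_smul, x.norm_coe, mul_one, Real.norm_eq_abs]
    exact le_trans (by linarith [q.2.2.1, q.1.2.1]) (le_abs_self _)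
  have hd2 : ∀ b (x : Sph n) (q : Radius × Radius), 1 / 10 ≤ ‖φ ((b, (x, x)), q)‖ := by
    intro b x q
    refine le_trans ?_ (le_max_right _ _)
    change 1 / 10 ≤ ‖(q.2 : ℝ) • (x : E) + (q.1 : ℝ) ^ 3 • T x‖
    have h1 := real_inner_le_norm (x : E) ((q.2 : ℝ) • (x : E) + (q.1 : ℝ) ^ 3 • T x)
    rw [inner_add_right, real_inner_smul_right, real_inner_smul_right, real_inner_self_eq_norm_sq,
      x.norm_coe, one_mul] at h1
    have h2 : 0 ≤ (q.1 : ℝ) ^ 3 * inner ℝ (x : E) (T x) :=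
      mul_nonneg (pow_nonneg (by linarith [q.1.2.1]) 3) (inner_twist_nonneg _)
    linarith [q.2.2.1]
  have h1 := nullhomotopic_of_const_on_diagonals (cutFamily φ hb) _
    (fun x b => cutFamily_eq_base φ hb (hd1 x b)) (fun b x => cutFamily_eq_base φ hb (hd2 b x))
    hnull
  let δ : C((Sph n × Sph n) × (Radius × Radius),
      ((Sph n × Sph n) × (Sph n × Sph n)) × (Radius × Radius)) :=
    ⟨fun z => ((z.1, z.1), z.2), by fun_prop⟩
  let φ' := φ.comp δ
  have hb' : ∀ b, ∀ q ∈ Qb, 1 / 10 ≤ ‖φ' (b, q)‖ := fun b q hq => hb (b, b) q hq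
  have h1' : (cutFamily φ' hb').Nullhomotopic := h1
  let f : E × E → E × E := fun p => (p.2 + p.1, p.2 + ‖p.1‖ ^ 2 • T p.1)
  have hf : ContDiff ℝ (⊤ : ℕ∞) f :=
    (contDiff_snd.add contDiff_fst).prodMk (contDiff_snd.add
      ((contDiff_fst.norm_sq ℝ).smul (T.contDiff.comp contDiff_fst)))
  let D : E → (E × E →L[ℝ] E × E) := fun X =>
    (ContinuousLinearMap.snd ℝ E E + ContinuousLinearMap.fst ℝ E E).prod
      (ContinuousLinearMap.snd ℝ E E + (‖X‖ ^ 2 • T.comp (ContinuousLinearMap.fst ℝ E E) +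
        (2 • (innerSL ℝ X).comp (ContinuousLinearMap.fst ℝ E E)).smulRight (T X)))
  have hD : ∀ p, HasFDerivAt f (D p.1) p := fun p =>
    (hasFDerivAt_snd.add hasFDerivAt_fst).prodMk (hasFDerivAt_snd.add
      (hasFDerivAt_fst.norm_sq.smul (T.hasFDerivAt.comp p hasFDerivAt_fst)))
  -- A kernel vector has `V = -U` and `T U + 2⟨e, U⟩e = U`. Pairing with the fixed vector `e` gives
  -- `⟨e, U⟩ = 0`, so `U` is fixed by `T`, a multiple of `e`, and zero.
  have hDe : (D e).det ≠ 0 := by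
    intro h0
    have h2 := LinearMap.bot_lt_ker_of_det_eq_zero h0
    refine h2.ne' ((Submodule.eq_bot_iff _).2 ?_)
    rintro ⟨U, V⟩ hUV
    have h3 : V + U = 0 := congrArg Prod.fst hUV
    have h4 : V + (‖(e : E)‖ ^ 2 • T U + (2 • inner ℝ (e : E) U) • T e) = 0 :=
      congrArg Prod.snd hUV
    rw [e.norm_coe, one_pow, one_smul, he] at h4
    have hV : V = -U := eq_neg_of_add_eq_zero_left h3
    let Tᵢ : E →ₗᵢ[ℝ] E := ⟨T.toLinearMap, norm_twist⟩
    have h5 : inner ℝ (e : E) (T U) = inner ℝ (e : E) U := by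
      have h6 : inner ℝ (T e) (T U) = inner ℝ (e : E) U := Tᵢ.inner_map_map e U
      rwa [he] at h6
    have h6 : inner ℝ (e : E) U = 0 := by
      have h7 := congrArg (fun w => inner ℝ (e : E) w) h4
      simp only [inner_add_right, inner_zero_right, real_inner_smul_right, hV, inner_neg_right,
        h5, real_inner_self_eq_norm_sq, e.norm_coe, nsmul_eq_mul, Nat.cast_ofNat] at h7
      linarith
    rw [h6, smul_zero, zero_smul, add_zero, hV, neg_add_eq_zero] at h4
    obtain ⟨c, rfl⟩ := he' U h4.symm
    rw [real_inner_smul_right, real_inner_self_eq_norm_sq, e.norm_coe, one_pow, mul_one] at h6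
    rw [hV, h6, zero_smul, neg_zero]
    rfl
  -- The derivative is even in `X`: it involves `X` only through `|X|²` and the product of `⟨X, ·⟩`
  -- with `T X`. The zeros `±e` therefore cannot cancel, and `c = det (D e)` gives both a positive
  -- sign.
  have hzero : ∀ p, ‖p.1‖ ∈ Set.Icc (1 / 2 : ℝ) 2 → f p = 0 → D p.1 = D e := by
    rintro ⟨X, Y⟩ hX h0
    have h2 : Y + X = 0 := congrArg Prod.fst h0
    have h3 : Y + ‖X‖ ^ 2 • T X = 0 := congrArg Prod.snd h0
    rw [eq_neg_of_add_eq_zero_left h2, neg_add_eq_zero] at h3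
    have h4 : ‖X‖ ^ 2 = 1 := by
      have h5 := congrArg norm h3
      have h6 : ‖T X‖ = ‖X‖ := norm_twist X
      rw [norm_smul, h6, Real.norm_of_nonneg (sq_nonneg _)] at h5
      have h7 : 0 < ‖X‖ := by linarith [hX.1]
      exact mul_right_cancel₀ h7.ne' (h5.symm.trans (one_mul _).symm)
    rw [h4, one_smul] at h3
    obtain ⟨c, rfl⟩ := he' X h3.symm
    rw [norm_smul, e.norm_coe, mul_one, Real.norm_eq_abs, sq_abs, sq_eq_one_iff] at h4
    rcases h4 with rfl | rfl
    · rw [one_smul]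
    · refine ContinuousLinearMap.ext fun p => Prod.ext rfl ?_
      change p.2 + (‖(-1 : ℝ) • (e : E)‖ ^ 2 • T p.1 +
        (2 • inner ℝ ((-1 : ℝ) • (e : E)) p.1) • T ((-1 : ℝ) • (e : E))) =
        p.2 + (‖(e : E)‖ ^ 2 • T p.1 + (2 • inner ℝ (e : E) p.1) • T e)
      rw [neg_one_smul, norm_neg, inner_neg_left, map_neg, smul_neg, smul_neg, neg_smul, neg_neg]
  let R : Set (E × E) := {p | ‖p.1‖ ∈ Set.Icc (1 / 2 : ℝ) 2 ∧ ‖p.2‖ ∈ Set.Icc (1 / 2 : ℝ) 2}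
  have hR : IsCompact R := by
    refine (isCompact_closedBall (0 : E × E) 2).of_isClosed_subset
      ((isClosed_Icc.preimage (continuous_norm.comp continuous_fst)).inter
        (isClosed_Icc.preimage (continuous_norm.comp continuous_snd))) fun w hw =>
        mem_closedBall_zero_iff.2 (max_le hw.1.2 hw.2.2)
  have hne : ∀ w : E, ‖w‖ ∈ Set.Icc (1 / 2 : ℝ) 2 → w ≠ 0 := fun w hw =>
    norm_pos_iff.1 (by linarith [hw.1])
  refine cutFamily_not_nullhomotopic φ' hb' (b0 := (e, e)) (fun q => hd1 e (e, e) q) hR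
    (β := fun w => (toSph w.1, toSph w.2))
    ((continuousOn_toSph.comp continuousOn_fst fun p hp => hne _ hp.1).prodMk
      (continuousOn_toSph.comp continuousOn_snd fun p hp => hne _ hp.2))
    (ρ := fun w => (toRadius ‖w.1‖, toRadius ‖w.2‖))
    (((continuous_toRadius.comp continuous_norm).comp continuous_fst).prodMk
      ((continuous_toRadius.comp continuous_norm).comp continuous_snd)).continuousOn ?_ hf ?_
      (D e).det ?_ ?_ h1'
  · intro w hw hq
    refine Filter.inter_mem ((continuous_norm.comp continuous_fst).continuousAt
      (Icc_mem_nhds ?_ ?_)) ((continuous_norm.comp continuous_snd).continuousAt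
      (Icc_mem_nhds ?_ ?_))
    · exact lt_of_le_of_ne hw.1.1 fun h => hq (Or.inl (Or.inl ((toRadius_coe hw.1).trans h.symm)))
    · exact lt_of_le_of_ne hw.1.2 fun h => hq (Or.inl (Or.inr ((toRadius_coe hw.1).trans h)))
    · exact lt_of_le_of_ne hw.2.1 fun h => hq (Or.inr (Or.inl ((toRadius_coe hw.2).trans h.symm)))
    · exact lt_of_le_of_ne hw.2.2 fun h => hq (Or.inr (Or.inr ((toRadius_coe hw.2).trans h)))
  · intro w hw
    have hX := norm_smul_toSph (hne _ hw.1)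
    have hY := norm_smul_toSph (hne _ hw.2)
    change ((toRadius ‖w.2‖ : ℝ) • (toSph w.2 : E) + (toRadius ‖w.1‖ : ℝ) • (toSph w.1 : E),
      (toRadius ‖w.2‖ : ℝ) • (toSph w.2 : E) + (toRadius ‖w.1‖ : ℝ) ^ 3 • T (toSph w.1)) =
      (w.2 + w.1, w.2 + ‖w.1‖ ^ 2 • T w.1)
    rw [toRadius_coe hw.1, toRadius_coe hw.2, hX, hY, pow_succ, mul_smul, ← map_smul, hX]
  · intro w hw h0
    rw [(hD w).fderiv, hzero w hw.1 h0]
    exact mul_self_pos.2 hDe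
  · have hmem : (1 : ℝ) ∈ Set.Icc (1 / 2 : ℝ) 2 := by norm_num
    refine ⟨((e : E), -(e : E)), ⟨?_, ?_⟩, ?_⟩
    · change ‖(e : E)‖ ∈ Set.Icc (1 / 2 : ℝ) 2
      rwa [e.norm_coe]
    · change ‖-(e : E)‖ ∈ Set.Icc (1 / 2 : ℝ) 2
      rwa [norm_neg, e.norm_coe]
    · change (-(e : E) + (e : E), -(e : E) + ‖(e : E)‖ ^ 2 • T e) = 0
      rw [e.norm_coe, he, one_pow, one_smul, neg_add_cancel]
      rfl

end LowerBound

/-! ### The weak topological complexity of spheres -/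

section WTC

variable {n : ℕ}

lemma wsecat_eq_of_forall_lt {E B : Type u} [TopologicalSpace E] [TopologicalSpace B] (p : C(E, B))
    (m : ℕ) (h : ((HomotopyCofibre.incl (fatWedge p m).map).comp (diagPow B (m + 1))).Nullhomotopic)
    (h' : ∀ k < m,
      ¬ ((HomotopyCofibre.incl (fatWedge p k).map).comp (diagPow B (k + 1))).Nullhomotopic) :
    wsecat p = m := by
  refine le_antisymm (sInf_le ⟨m, rfl, h⟩) (le_sInf ?_)
  rintro _ ⟨k, rfl, hk⟩
  exact_mod_cast not_lt.1 fun hlt => h' k hlt hk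

theorem wTC_sphere_of_odd (hn : Odd n) : wTC (Sph n) = 1 := by
  refine wsecat_eq_of_forall_lt _ 1 (nullhomotopic_of_odd hn) fun k hk => ?_
  obtain rfl : k = 0 := by omega
  exact not_nullhomotopic_zero n

theorem wTC_sphere_of_even (h1 : 1 ≤ n) (hn : Even n) : wTC (Sph n) = 2 := by
  refine wsecat_eq_of_forall_lt _ 2 (nullhomotopic_two h1) fun k hk => ?_
  obtain rfl | rfl : k = 0 ∨ k = 1 := by omega
  · exact not_nullhomotopic_zero n
  · exact not_nullhomotopic_one hn

end WTC

end WeakTC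

theorem mainTheorem8 (n : ℕ) (hn : 1 ≤ n) :
    Nonempty (ContinuousMap.HomotopyEquiv
      (WeakTC.HomotopyCofibre (WeakTC.diagonal (WeakTC.Sph n)))
      (WeakTC.AttachCell (WeakTC.whiteheadSquare n))) ∧
    (Odd n → WeakTC.wTC (WeakTC.Sph n) = 1) ∧
    (Even n → WeakTC.wTC (WeakTC.Sph n) = 2) :=
  ⟨WeakTC.nonempty_cofibre_diagonal_homotopyEquiv_attachCell hn, WeakTC.wTC_sphere_of_odd,
    WeakTC.wTC_sphere_of_even hn⟩
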